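/- **Minsum bin packing with ready times.** Let $k\ge 1$ and let $1\le\tau_1<\dots<\tau_k$ be fixed integers (ready times). An instance consists of $n$ items, each belonging to one of $k$ classes and having a rational weight in $[0,1]$; the weights are given over a common denominator, i.e. as integers $0\le s_j\le C$ with $C\ge 1$, meaning weight $s_j/C$. A feasible packing assigns each item to a bin $B_b$, $b\in\{1,2,\dots\}$, such that every bin has total weight at most $1$ and no item of class $i$ is in a bin numbered below $\tau_i$. Its cost is $\sum_b b\,|B_b|$, and $OPT$ denotes the minimum cost of a feasible packing. Let $$c=\sum_{i=1}^{k}\frac{1}{4^{i-1}}\binom{k}{i}(4+9\tau_k)^i,\qquad c_1=\frac{k+2}{4}+\frac12,\qquad d=c+c_1+\frac{c\,c_1}{4}.$$ For every fixed $\epsilon$ with $0<\epsilon\le\frac14$ and $1/\epsilon$ an integer there is an algorithm that runs in time polynomial in $n$ (on a unit-cost random access machine whose arithmetic is addition and truncated subtraction; the program and the polynomial depend only on $k,\tau_1,\dots,\tau_k,\epsilon$) and outputs for every instance a feasible packing of cost at most $(1+d\,\epsilon)\,OPT$. **Flow on a path.** In MS-DWSF, a graph has edges $e$ with capacities $C(e)$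 and lengths $d(e)$ (positive integers) and a set $F$ of facilities; each of $n$ groups $G$ has a home node, a positive integer size $S(G)$ and a positive integer weight $w(G)$. Time is discrete, $t=0,1,2,\dots$. Each group starts at its home node at time $0$. At each time $t$, a group that is at a node $u$ (a group arriving at time $t$ included) may be sent along one edge $\{u,v\}$; it then reaches $v$ at time $t+d(\{u,v\})$. The total size of the groups sent from $u$ to $v$ along $\{u,v\}$ at time $t$ is at most $C(\{u,v\})$. Every group has to reach $F$; with $\alpha(G)$ the first time at which $G$ is at a node of $F$, the objective is to minimize $\sum_G w(G)\alpha(G)$. Fix a path with $k$ nodes, positive integer edge lengths, and one facility, placed at any node. Then for every fixed $\epsilon>0$ there is an algorithm that runs in time polynomial in $n$ (on the same machine, the program and the polynomial depending only on the path, the edge lengths, the facility and $\epsilon$) and that, for every instance on this path with uniform capacity $C$ and unit weights $w\equiv 1$, in which every group not starting at the facility has size at most $C$, outputs a feasible flow (as a list of dispatches) of cost at most $(1+\epsilon)$ times the optimum. -/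

import Mathlib

/-! ## Random access machine with a step count

Machine programs work on finitely many unbounded arrays of natural numbers (those named in the
program), with indirect addressing.  The only arithmetic is addition and truncated subtraction,
every elementary operation costs one step.  As there is no multiplication, the length of a number
grows by at most one bit per step, so that polynomial time on this machine and polynomial time on
a Turing machine agree. -/

/-- A memory: `σ a i` is the content of cell `i` of array `a`. -/
abbrev RamState : Type := ℕ → ℕ → ℕ

/-- Arithmetic expressions. -/
inductive RamExpr : Type
  | lit (c : ℕ)
  | read (a : ℕ) (e : RamExpr)
  | add (e₁ e₂ : RamExpr)
  | sub (e₁ e₂ : RamExpr)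

/-- Value of an expression in a memory. -/
def RamExpr.eval (σ : RamState) : RamExpr → ℕ
  | .lit c => c
  | .read a e => σ a (e.eval σ)
  | .add e₁ e₂ => e₁.eval σ + e₂.eval σ
  | .sub e₁ e₂ => e₁.eval σ - e₂.eval σ

/-- Number of elementary operations in the evaluation of an expression. -/
def RamExpr.steps : RamExpr → ℕ
  | .lit _ => 1
  | .read _ e => e.steps + 1
  | .add e₁ e₂ => e₁.steps + e₂.steps + 1
  | .sub e₁ e₂ => e₁.steps + e₂.steps + 1

/-- Programs: `write a i v` stores the value of `v` in cell `i` of array `a`; `cond e P Q` runs `P`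
if `e ≠ 0` and `Q` otherwise; `loop e P` repeats `P` as long as `e ≠ 0`. -/
inductive RamProgram : Type
  | skip
  | write (a : ℕ) (i v : RamExpr)
  | seq (P Q : RamProgram)
  | cond (e : RamExpr) (P Q : RamProgram)
  | loop (e : RamExpr) (P : RamProgram)

/-- The memory `σ` after the value `v` has been stored in cell `i` of array `a`. -/
def RamState.set (σ : RamState) (a i v : ℕ) : RamState :=
  fun a' i' => if a' = a ∧ i' = i then v else σ a' i'

/-- `RamRun P σ σ' T`: the program `P`, started in the memory `σ`, halts in the memory `σ'` after
exactly `T` steps. -/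
inductive RamRun : RamProgram → RamState → RamState → ℕ → Prop
  | skip (σ : RamState) : RamRun .skip σ σ 1
  | write (σ : RamState) (a : ℕ) (i v : RamExpr) :
      RamRun (.write a i v) σ (σ.set a (i.eval σ) (v.eval σ)) (i.steps + v.steps + 1)
  | seq {P Q : RamProgram} {σ σ' σ'' : RamState} {T T' : ℕ} :
      RamRun P σ σ' T → RamRun Q σ' σ'' T' → RamRun (.seq P Q) σ σ'' (T + T')
  | condTrue {e : RamExpr} {P Q : RamProgram} {σ σ' : RamState} {T : ℕ} :
      e.eval σ ≠ 0 → RamRun P σ σ' T → RamRun (.cond e P Q) σ σ' (e.steps + T + 1)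
  | condFalse {e : RamExpr} {P Q : RamProgram} {σ σ' : RamState} {T : ℕ} :
      e.eval σ = 0 → RamRun Q σ σ' T → RamRun (.cond e P Q) σ σ' (e.steps + T + 1)
  | loopDone {e : RamExpr} {P : RamProgram} {σ : RamState} :
      e.eval σ = 0 → RamRun (.loop e P) σ σ (e.steps + 1)
  | loopStep {e : RamExpr} {P : RamProgram} {σ σ' σ'' : RamState} {T T' : ℕ} :
      e.eval σ ≠ 0 → RamRun P σ σ' T → RamRun (.loop e P) σ' σ'' T' →
      RamRun (.loop e P) σ σ'' (e.steps + T + T' + 1)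

/-- The input memory for `n` objects with sizes `size` and integer labels `label` and for the
capacity `C`: array 0 holds `n`, array 1 holds `C` (both in cell 0), array 2 holds the sizes,
array 3 holds the labels; every other cell is 0. -/
def ramInput (n C : ℕ) (size label : Fin n → ℕ) : RamState := fun a i =>
  match a with
  | 0 => if i = 0 then n else 0
  | 1 => if i = 0 then C else 0
  | 2 => if h : i < n then size ⟨i, h⟩ else 0
  | 3 => if h : i < n then label ⟨i, h⟩ else 0
  | _ => 0

/-! ## Minsum bin packing with ready times -/

/-- An instance with `n` items in `k` classes.  Weights are rational and are given over a common
denominator: item `j` has weight `size j / cap ≤ 1`, bins have capacity `1`, that is, `cap` in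
units of `1 / cap`. -/
structure PackingInstance (k n : ℕ) where
  cap : ℕ
  size : Fin n → ℕ
  cls : Fin n → Fin k
  cap_pos : 0 < cap
  size_le : ∀ j, size j ≤ cap

namespace PackingInstance

variable {k n : ℕ}

/-- The input of the machine. -/
def input (I : PackingInstance k n) : RamState :=
  ramInput n I.cap I.size (fun j => (I.cls j : ℕ))

/-- The bin with number `b` of the packing that puts item `j` into the bin with number `p j`. -/
def bin (p : Fin n → ℕ) (b : ℕ) : Finset (Fin n) := Finset.univ.filter (fun j => p j = b)

/-- No item of class `i` is in a bin with a number below `τ i`, and no bin is overfull. -/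
def Feasible (I : PackingInstance k n) (τ : Fin k → ℕ) (p : Fin n → ℕ) : Prop :=
  (∀ j, τ (I.cls j) ≤ p j) ∧ ∀ b, ∑ j ∈ bin p b, I.size j ≤ I.cap

/-- The cost `∑ b, b * |B_b|`, the sum being over the nonempty bins. -/
def cost (p : Fin n → ℕ) : ℕ := ∑ b ∈ Finset.univ.image p, b * (bin p b).card

/-- The minimum cost of a feasible packing. -/
noncomputable def opt (I : PackingInstance k n) (τ : Fin k → ℕ) : ℕ :=
  sInf {x | ∃ p : Fin n → ℕ, I.Feasible τ p ∧ cost p = x}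

end PackingInstance

/-- The packing in the output memory: cell `j` of array 4 holds the bin number of item `j`. -/
def ramPacking (n : ℕ) (σ : RamState) : Fin n → ℕ := fun j => σ 4 j

/-! ## The constants -/

/-- `c = ∑_{i=1}^k 4^{-(i-1)} (k choose i) (4 + 9t)^i`, where `t` is the last ready time. -/
noncomputable def constC (k t : ℕ) : ℝ :=
  ∑ i ∈ Finset.Icc 1 k, 1 / (4 : ℝ) ^ (i - 1) * (k.choose i : ℝ) * (4 + 9 * (t : ℝ)) ^ i

/-- `c₁ = (k + 2) / 4 + 1 / 2`. -/
noncomputable def constC1 (k : ℕ) : ℝ := ((k : ℝ) + 2) / 4 + 1 / 2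

/-- `d = c + c₁ + c c₁ / 4`. -/
noncomputable def constD (k t : ℕ) : ℝ := constC k t + constC1 k + constC k t * constC1 k / 4

/-! ## Discrete and weighted set flow on a dynamic network -/

/-- An instance of MS-DWSF with node set `V` and `n` groups. -/
structure FlowInstance (V : Type) (n : ℕ) where
  graph : SimpleGraph V
  capacity : Sym2 V → ℕ
  distance : Sym2 V → ℕ
  facilities : Set V
  home : Fin n → V
  size : Fin n → ℕ
  weight : Fin n → ℕ
  capacity_pos : ∀ e ∈ graph.edgeSet, 0 < capacity e
  distance_pos : ∀ e ∈ graph.edgeSet, 0 < distance e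
  size_pos : ∀ g, 0 < size g
  weight_pos : ∀ g, 0 < weight g

/-- A flow: `D u v t` is the set of groups that leave `u` at time `t` along the edge to `v`. -/
abbrev GroupFlow (V : Type) (n : ℕ) : Type := V → V → ℕ → Finset (Fin n)

namespace FlowInstance

variable {V : Type} {n : ℕ}

/-- The groups that arrive at `v` from `u` at time `t`. -/
def arrivals (I : FlowInstance V n) (D : GroupFlow V n) (u v : V) (t : ℕ) : Set (Fin n) :=
  {g | I.graph.Adj u v ∧ I.distance s(u, v) ≤ t ∧ g ∈ D u v (t - I.distance s(u, v))}

/-- The groups that are at a node at time `t`, before the departures of time `t`. -/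
def present (I : FlowInstance V n) (D : GroupFlow V n) : ℕ → V → Set (Fin n)
  | 0, v => {g | I.home g = v}
  | t + 1, v => (present I D t v \ ⋃ u, (D v u t : Set (Fin n))) ∪ ⋃ u, I.arrivals D u v (t + 1)

/-- Groups are sent only along edges, from the node at which they are, each along one edge at a
time, within the capacity, and every group reaches a facility. -/
structure Feasible (I : FlowInstance V n) (D : GroupFlow V n) : Prop where
  adj : ∀ u v t, (D u v t).Nonempty → I.graph.Adj u v
  isPresent : ∀ u v t, (D u v t : Set (Fin n)) ⊆ I.present D t u
  disjoint : ∀ u v v' t, v ≠ v' → Disjoint (D u v t) (D u v' t)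
  capacity_le : ∀ u v t, I.graph.Adj u v → ∑ g ∈ D u v t, I.size g ≤ I.capacity s(u, v)
  reaches : ∀ g, ∃ t, ∃ v ∈ I.facilities, g ∈ I.present D t v

/-- The first time at which the group `g` is at a facility (meaningful for feasible flows). -/
noncomputable def arrivalTime (I : FlowInstance V n) (D : GroupFlow V n) (g : Fin n) : ℕ :=
  sInf {t | ∃ v ∈ I.facilities, g ∈ I.present D t v}

/-- The objective: the weighted sum of the arrival times. -/
noncomputable def cost (I : FlowInstance V n) (D : GroupFlow V n) : ℕ :=
  ∑ g, I.weight g * I.arrivalTime D g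

/-- The minimum cost of a feasible flow. -/
noncomputable def opt (I : FlowInstance V n) : ℕ :=
  sInf {x | ∃ D : GroupFlow V n, I.Feasible D ∧ I.cost D = x}

end FlowInstance

/-- The flow in the output memory, written as a list of dispatches: cell 0 of array 4 holds their
number `m`, and for `l < m` cell `l` of the arrays 5, 6, 7, 8 holds the group, the node it leaves,
the node it is sent to, and the time of departure of the dispatch `l`. -/
def ramFlow (k n : ℕ) (σ : RamState) : GroupFlow (Fin k) n := fun u v t =>
  Finset.univ.filter (fun g : Fin n => ∃ l < σ 4 0,
    σ 5 l = (g : ℕ) ∧ σ 6 l = (u : ℕ) ∧ σ 7 l = (v : ℕ) ∧ σ 8 l = t)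

/-! Both halves rest on one approximation scheme for packings in which the ready time of an item
depends on its label (`exists_packing_program`). It reaches the factor 1 + δ for every fixed δ > 0,
so the factor 1 + dε follows from d > 0 (`constD_pos`).

Structure of good packings. Rank the items of each class by decreasing size, cut the ranks into
segments [L^m, L^(m+1)) and every segment into at most L^2 groups of consecutive ranks. By
`Ranking.exists_windowed` any packing can be changed, at relative extra cost 1/D + 4Q/H + 4Q^4 H/L,
so that (a) sizes may be rounded up to the largest size in the group, and (b) in each class the
items of segments m + 3 and higher are packed no later than any item of segment m. For (a), an item
takes over the bin of a slot, an item at least as large that is one group earlier. The items without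
a slot, or with a slot that is packed among the last 1/H of the reference block, are at most a
fraction 1/H of that block. If e is the time at which the rest of the block is packed, they are
repacked at about the time e/H: the many items of the block packed by time e are at least as large,
so up to a constant there is room (`Ranking.prefetched_mass_le`), and Markov's inequality bounds the
cost (`Ranking.prefetched_cost_le`). For (b), large items are delayed until the much smaller ones
are packed. They are so few compared with the items three segments higher that this costs little
(`Ranking.delay_cost_le`). All displaced items are repacked by next-fit (`exists_nextFit`) into
spare bins, one inserted after every D regular bins. Spare bins have numbers above D, hence above
all ready times.

Dynamic program. With (a) and (b), the set of items packed by time b can be replaced by one that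
contains an initial piece of every group. It is described by the lowest segment in use in every
class and by the counts for the groups of three segments (`Ranking.mem_placed_iff`). These are k +
3kL^2 numbers of size at most n, so there are polynomially many sets. A packing is a chain of such
sets, bin b holding the difference of two consecutive ones, and its cost is the sum over time of the
number of items not yet packed. A cheapest chain with respect to the true sizes is a packing
(`chainBin_spec`), and it is nearly optimal (`exists_chain`).

Machine. Expressions with bounded sums compile to programs whose time is polynomial in the common
bound M of all sums (`SumExpr.compile_spec`). Multiplication, division and search are such sums. M
is a polynomially large number obtained by repeated squaring, and the tables of the dynamic program
are arrays filled cell by cell (`exists_fill_list`).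

Flow. Groups that reach the facility at the same time from the same side have just crossed the same
edge together, so arrival times form a packing with the distances as ready times
(`FlowInstance.Feasible.path_packing`). Conversely, a packing is realised by letting each group
start as late as possible and travel without stops (`exists_path_flow`). A path is therefore two
independent packing problems. -/

/-! ## An expression language with bounded sums, compiled to the machine -/

/-- Expressions with bounded sums, with de Bruijn variables. -/
inductive SumExpr : Type
  | lit (c : ℕ)
  | var (i : ℕ)
  | read (a : ℕ) (e : SumExpr)
  | add (x y : SumExpr)
  | sub (x y : SumExpr)
  | ite (c x y : SumExpr)
  | sum (e : SumExpr)

/-- Prepend a value to an environment. -/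
def envCons (i : ℕ) (v : ℕ → ℕ) : ℕ → ℕ
  | 0 => i
  | j + 1 => v j

@[simp] lemma envCons_zero (i : ℕ) (v : ℕ → ℕ) : envCons i v 0 = i := rfl
@[simp] lemma envCons_succ (i : ℕ) (v : ℕ → ℕ) (j : ℕ) : envCons i v (j + 1) = v j := rfl

namespace SumExpr

/-- The value of an expression; all sums run up to the content of cell 0 of array `B`. -/
def eval (B : ℕ) (σ : RamState) : SumExpr → (ℕ → ℕ) → ℕ
  | lit c, _ => c
  | var i, v => v i
  | read a e, v => σ a (e.eval B σ v)
  | add x y, v => x.eval B σ v + y.eval B σ v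
  | sub x y, v => x.eval B σ v - y.eval B σ v
  | ite c x y, v => if c.eval B σ v ≠ 0 then x.eval B σ v else y.eval B σ v
  | sum e, v => ∑ i ∈ Finset.range (σ B 0), e.eval B σ (envCons i v)

/-- All arrays that are read have a number below `k`. -/
def Below (k : ℕ) : SumExpr → Prop
  | lit _ => True
  | var _ => True
  | read a e => a < k ∧ e.Below k
  | add x y => x.Below k ∧ y.Below k
  | sub x y => x.Below k ∧ y.Below k
  | ite c x y => c.Below k ∧ x.Below k ∧ y.Below k
  | sum e => e.Below k

/-- Renaming of variables. -/
def rename (ρ : ℕ → ℕ) : SumExpr → SumExpr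
  | lit c => lit c
  | var i => var (ρ i)
  | read a e => read a (e.rename ρ)
  | add x y => add (x.rename ρ) (y.rename ρ)
  | sub x y => sub (x.rename ρ) (y.rename ρ)
  | ite c x y => ite (c.rename ρ) (x.rename ρ) (y.rename ρ)
  | sum e => sum (e.rename (envCons 0 (fun i => ρ i + 1)))

/-- Simultaneous substitution. -/
def subst : (ℕ → SumExpr) → SumExpr → SumExpr
  | _, lit c => lit c
  | s, var i => s i
  | s, read a e => read a (e.subst s)
  | s, add x y => add (x.subst s) (y.subst s)
  | s, sub x y => sub (x.subst s) (y.subst s)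
  | s, ite c x y => ite (c.subst s) (x.subst s) (y.subst s)
  | s, sum e => sum (e.subst (fun i => match i with
      | 0 => var 0
      | j + 1 => (s j).rename (· + 1)))

lemma eval_rename (B : ℕ) (σ : RamState) (e : SumExpr) :
    ∀ (ρ v : ℕ → ℕ), (e.rename ρ).eval B σ v = e.eval B σ (fun i => v (ρ i)) := by
  induction e with
  | lit c => intros; rfl
  | var i => intros; rfl
  | read a e ih => intro ρ v; simp only [rename, eval, ih]
  | add x y hx hy => intro ρ v; simp only [rename, eval, hx, hy]
  | sub x y hx hy => intro ρ v; simp only [rename, eval, hx, hy]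
  | ite c x y hc hx hy => intro ρ v; simp only [rename, eval, hc, hx, hy]
  | sum e ih =>
    intro ρ v
    simp only [rename, eval, ih]
    refine Finset.sum_congr rfl fun i _ => ?_
    congr 1
    funext j
    cases j <;> rfl

lemma eval_subst (B : ℕ) (σ : RamState) (e : SumExpr) :
    ∀ (s : ℕ → SumExpr) (v : ℕ → ℕ),
      (e.subst s).eval B σ v = e.eval B σ (fun i => (s i).eval B σ v) := by
  induction e with
  | lit c => intros; rfl
  | var i => intros; rfl
  | read a e ih => intro ρ v; simp only [subst, eval, ih]
  | add x y hx hy => intro ρ v; simp only [subst, eval, hx, hy]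
  | sub x y hx hy => intro ρ v; simp only [subst, eval, hx, hy]
  | ite c x y hc hx hy => intro ρ v; simp only [subst, eval, hc, hx, hy]
  | sum e ih =>
    intro s v
    simp only [subst, eval, ih]
    refine Finset.sum_congr rfl fun i _ => ?_
    congr 1
    funext j
    cases j with
    | zero => rfl
    | succ j => simp [eval_rename]

lemma Below.rename {k : ℕ} (e : SumExpr) : ∀ (ρ : ℕ → ℕ), e.Below k → (e.rename ρ).Below k := by
  induction e with
  | lit c => intros; trivial
  | var i => intros; trivial
  | read a e ih => exact fun ρ h => ⟨h.1, ih ρ h.2⟩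
  | add x y hx hy => exact fun ρ h => ⟨hx ρ h.1, hy ρ h.2⟩
  | sub x y hx hy => exact fun ρ h => ⟨hx ρ h.1, hy ρ h.2⟩
  | ite c x y hc hx hy => exact fun ρ h => ⟨hc ρ h.1, hx ρ h.2.1, hy ρ h.2.2⟩
  | sum e ih => exact fun ρ h => ih _ h

lemma Below.subst {k : ℕ} (e : SumExpr) :
    ∀ (s : ℕ → SumExpr), (∀ i, (s i).Below k) → e.Below k → (e.subst s).Below k := by
  induction e with
  | lit c => intros; trivial
  | var i => exact fun s hs _ => hs i
  | read a e ih => exact fun s hs h => ⟨h.1, ih s hs h.2⟩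
  | add x y hx hy => exact fun s hs h => ⟨hx s hs h.1, hy s hs h.2⟩
  | sub x y hx hy => exact fun s hs h => ⟨hx s hs h.1, hy s hs h.2⟩
  | ite c x y hc hx hy => exact fun s hs h => ⟨hc s hs h.1, hx s hs h.2.1, hy s hs h.2.2⟩
  | sum e ih =>
    intro s hs h
    refine ih _ (fun i => ?_) h
    cases i with
    | zero => trivial
    | succ j => exact Below.rename _ _ (hs j)

lemma Below.mono {k l : ℕ} (hkl : k ≤ l) (e : SumExpr) : e.Below k → e.Below l := by
  induction e with
  | lit c => intros; trivial
  | var i => intros; trivial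
  | read a e ih => exact fun h => ⟨h.1.trans_le hkl, ih h.2⟩
  | add x y hx hy => exact fun h => ⟨hx h.1, hy h.2⟩
  | sub x y hx hy => exact fun h => ⟨hx h.1, hy h.2⟩
  | ite c x y hc hx hy => exact fun h => ⟨hc h.1, hx h.2.1, hy h.2.2⟩
  | sum e ih => exact fun h => ih h

/-- Compiled subexpressions leave scratch values in the arrays from `k` on. An expression never
looks there, so its value survives the evaluation of its neighbours. -/
lemma eval_congr {B k : ℕ} (hB : B < k) {σ τ : RamState} (h : ∀ a < k, σ a = τ a) (e : SumExpr) :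
    e.Below k → ∀ v, e.eval B σ v = e.eval B τ v := by
  induction e with
  | lit c => intros; rfl
  | var i => intros; rfl
  | read a e ih => intro hb v; simp only [eval, ih hb.2 v, h a hb.1]
  | add x y hx hy => intro hb v; simp only [eval, hx hb.1 v, hy hb.2 v]
  | sub x y hx hy => intro hb v; simp only [eval, hx hb.1 v, hy hb.2 v]
  | ite c x y hc hx hy => intro hb v; simp only [eval, hc hb.1 v, hx hb.2.1 v, hy hb.2.2 v]
  | sum e ih => intro hb v; simp only [eval, h B hB, ih hb]

/-- An upper bound for the running time of the compiled expression if all sums have `M` terms. -/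
def time (M : ℕ) : SumExpr → ℕ
  | lit _ => 3
  | var _ => 5
  | read _ e => e.time M + 10
  | add x y => x.time M + y.time M + 10
  | sub x y => x.time M + y.time M + 10
  | ite c x y => c.time M + x.time M + y.time M + 10
  | sum e => M * (e.time M + 30) + 30

end SumExpr

/-- Cell 0 of an array, as a machine expression. -/
def cell (k : ℕ) : RamExpr := .read k (.lit 0)

@[simp] lemma cell_eval (k : ℕ) (σ : RamState) : (cell k).eval σ = σ k 0 := rfl
@[simp] lemma cell_steps (k : ℕ) : (cell k).steps = 2 := rfl

lemma RamState.set_of_ne {σ : RamState} {a i v b : ℕ} (h : b ≠ a) : σ.set a i v b = σ b := by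
  funext j
  simp [RamState.set, h]

@[simp] lemma RamState.set_same {σ : RamState} {a i v : ℕ} : σ.set a i v a i = v := by
  simp [RamState.set]

lemma RamState.set_same_of_ne {σ : RamState} {a i v j : ℕ} (h : j ≠ i) :
    σ.set a i v a j = σ a j := by
  simp [RamState.set, h]

namespace SumExpr

/-- The compiler.  The result is stored in cell 0 of array `k`, the arrays below `k` are kept, and
the variable `i` is found in cell 0 of array `ρ i`. -/
def compile (B : ℕ) : SumExpr → (ℕ → ℕ) → ℕ → RamProgram
  | lit c, _, k => .write k (.lit 0) (.lit c)
  | var i, ρ, k => .write k (.lit 0) (cell (ρ i))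
  | read a e, ρ, k => .seq (e.compile B ρ k) (.write k (.lit 0) (.read a (cell k)))
  | add x y, ρ, k => .seq (x.compile B ρ k) (.seq (y.compile B ρ (k + 1))
      (.write k (.lit 0) (.add (cell k) (cell (k + 1)))))
  | sub x y, ρ, k => .seq (x.compile B ρ k) (.seq (y.compile B ρ (k + 1))
      (.write k (.lit 0) (.sub (cell k) (cell (k + 1)))))
  | ite c x y, ρ, k => .seq (c.compile B ρ k)
      (.cond (cell k) (x.compile B ρ k) (y.compile B ρ k))
  | sum e, ρ, k => .seq (.write k (.lit 0) (.lit 0)) (.seq (.write (k + 1) (.lit 0) (.lit 0))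
      (.loop (.sub (cell B) (cell (k + 1)))
        (.seq (e.compile B (envCons (k + 1) ρ) (k + 2))
          (.seq (.write k (.lit 0) (.add (cell k) (cell (k + 2))))
            (.write (k + 1) (.lit 0) (.add (cell (k + 1)) (.lit 1)))))))

end SumExpr

/-- A counting loop: if the body works with the counter in cell 0 of array `c`, keeps the bound in
array `B` and the invariant, then the whole loop runs up to the bound. -/
lemma ramRun_countingLoop {B c : ℕ} {P : RamProgram} (I : ℕ → RamState → Prop) (N t : ℕ)
    (hI : ∀ i σ, I i σ → σ B 0 = N ∧ σ c 0 = i)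
    (hP : ∀ i σ, i < N → I i σ → ∃ σ' T, RamRun P σ σ' T ∧ T ≤ t ∧ I (i + 1) σ')
    (σ : RamState) (h0 : I 0 σ) :
    ∃ σ' T, RamRun (.loop (.sub (cell B) (cell c)) P) σ σ' T ∧ T ≤ N * (t + 6) + 6 ∧ I N σ' := by
  have key : ∀ d i σ, i + d = N → I i σ →
      ∃ σ' T, RamRun (.loop (.sub (cell B) (cell c)) P) σ σ' T ∧ T ≤ d * (t + 6) + 6 ∧ I N σ' := by
    intro d
    induction d with
    | zero =>
      intro i σ hi h
      obtain rfl : i = N := by omega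
      have := hI _ _ h
      refine ⟨σ, _, .loopDone ?_, ?_, h⟩
      · simp [RamExpr.eval, this.1, this.2]
      · simp [RamExpr.steps]
    | succ d ih =>
      intro i σ hi h
      have h1 := hI _ _ h
      obtain ⟨σ₁, T₁, r₁, l₁, h₁⟩ := hP i σ (by omega) h
      obtain ⟨σ₂, T₂, r₂, l₂, h₂⟩ := ih (i + 1) σ₁ (by omega) h₁
      refine ⟨σ₂, _, .loopStep ?_ r₁ r₂, ?_, h₂⟩
      · simp [RamExpr.eval, h1.1, h1.2]; omega
      · simp only [RamExpr.steps, cell_steps]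
        rw [Nat.add_mul]
        omega
  exact key N 0 σ (by omega) h0

namespace SumExpr

/-- Scratch space grows like a stack: a second operand is evaluated from array `k + 1` on, above the
first result, and the body of a sum from `k + 2` on, above the accumulator `k` and the counter `k +
1`. -/
theorem compile_spec (B k₀ : ℕ) (hB : B < k₀) (e : SumExpr) :
    ∀ (ρ : ℕ → ℕ) (k : ℕ) (σ : RamState) (v : ℕ → ℕ), e.Below k₀ → k₀ ≤ k → (∀ i, ρ i < k) →
      (∀ i, σ (ρ i) 0 = v i) →
      ∃ σ' T, RamRun (e.compile B ρ k) σ σ' T ∧ T ≤ e.time (σ B 0) ∧ (∀ a < k, σ' a = σ a) ∧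
        σ' k 0 = e.eval B σ v := by
  -- Addition and subtraction share this argument: `f` is the machine operation, `g` its meaning.
  have bin : ∀ (x y : SumExpr) (f : RamExpr → RamExpr → RamExpr) (g : ℕ → ℕ → ℕ)
      (hf : ∀ p q σ, (f p q).eval σ = g (p.eval σ) (q.eval σ))
      (hs : ∀ p q, (f p q).steps = p.steps + q.steps + 1) (ρ : ℕ → ℕ) (k : ℕ) (σ : RamState)
      (v : ℕ → ℕ), x.Below k₀ → y.Below k₀ → k₀ ≤ k → (∀ i, ρ i < k) → (∀ i, σ (ρ i) 0 = v i) →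
      (∀ (ρ : ℕ → ℕ) (k : ℕ) (σ : RamState) (v : ℕ → ℕ), x.Below k₀ → k₀ ≤ k → (∀ i, ρ i < k) →
        (∀ i, σ (ρ i) 0 = v i) →
        ∃ σ' T, RamRun (x.compile B ρ k) σ σ' T ∧ T ≤ x.time (σ B 0) ∧ (∀ a < k, σ' a = σ a) ∧
          σ' k 0 = x.eval B σ v) →
      (∀ (ρ : ℕ → ℕ) (k : ℕ) (σ : RamState) (v : ℕ → ℕ), y.Below k₀ → k₀ ≤ k → (∀ i, ρ i < k) →
        (∀ i, σ (ρ i) 0 = v i) →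
        ∃ σ' T, RamRun (y.compile B ρ k) σ σ' T ∧ T ≤ y.time (σ B 0) ∧ (∀ a < k, σ' a = σ a) ∧
          σ' k 0 = y.eval B σ v) →
      ∃ σ' T, RamRun (.seq (x.compile B ρ k) (.seq (y.compile B ρ (k + 1))
          (.write k (.lit 0) (f (cell k) (cell (k + 1)))))) σ σ' T ∧
        T ≤ x.time (σ B 0) + y.time (σ B 0) + 10 ∧ (∀ a < k, σ' a = σ a) ∧
        σ' k 0 = g (x.eval B σ v) (y.eval B σ v) := by
    intro x y f g hf hs ρ k σ v bx b_y hk hρ hv hx hy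
    obtain ⟨σ₁, T₁, r₁, l₁, a₁, e₁⟩ := hx ρ k σ v bx hk hρ hv
    obtain ⟨σ₂, T₂, r₂, l₂, a₂, e₂⟩ := hy ρ (k + 1) σ₁ v b_y (by omega)
      (fun i => (hρ i).trans (by omega)) (fun i => by rw [a₁ _ (hρ i), hv])
    refine ⟨_, _, .seq r₁ (.seq r₂ (.write _ _ _ _)), ?_, ?_, ?_⟩
    · rw [a₁ B (by omega)] at l₂
      simp only [RamExpr.steps, hs, cell_steps]
      omega
    · intro a ha
      rw [RamState.set_of_ne (by omega), a₂ a (by omega), a₁ a ha]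
    · have : (RamExpr.lit 0).eval σ₂ = 0 := rfl
      rw [this, RamState.set_same, hf, cell_eval, cell_eval, a₂ k (by omega), e₁, e₂,
        eval_congr hB (fun a ha => a₁ a (by omega)) y b_y]
  induction e with
  | lit c =>
    intro ρ k σ v _ hk hρ hv
    refine ⟨_, _, .write _ _ _ _, le_of_eq rfl, fun a ha => RamState.set_of_ne (by omega), ?_⟩
    exact RamState.set_same
  | var i =>
    intro ρ k σ v _ hk hρ hv
    refine ⟨_, _, .write _ _ _ _, le_of_lt (by decide : 4 < 5),
      fun a ha => RamState.set_of_ne (by omega), ?_⟩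
    refine RamState.set_same.trans ?_
    simp [eval, hv]
  | read a e ih =>
    intro ρ k σ v hb hk hρ hv
    obtain ⟨σ₁, T₁, r₁, l₁, a₁, e₁⟩ := ih ρ k σ v hb.2 hk hρ hv
    refine ⟨_, _, .seq r₁ (.write _ _ _ _), ?_, ?_, ?_⟩
    · simp only [RamExpr.steps, cell_steps, time]; omega
    · intro b hb'
      rw [RamState.set_of_ne (by omega), a₁ b hb']
    · refine RamState.set_same.trans ?_
      have := hb.1
      simp only [RamExpr.eval, cell_eval, eval, e₁]
      rw [a₁ a (by omega)]
  | add x y hx hy =>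
    intro ρ k σ v hb hk hρ hv
    exact bin x y .add (· + ·) (fun _ _ _ => rfl) (fun _ _ => rfl) ρ k σ v hb.1 hb.2 hk hρ hv hx hy
  | sub x y hx hy =>
    intro ρ k σ v hb hk hρ hv
    exact bin x y .sub (· - ·) (fun _ _ _ => rfl) (fun _ _ => rfl) ρ k σ v hb.1 hb.2 hk hρ hv hx hy
  | ite c x y hc hx hy =>
    intro ρ k σ v hb hk hρ hv
    obtain ⟨σ₁, T₁, r₁, l₁, a₁, e₁⟩ := hc ρ k σ v hb.1 hk hρ hv
    by_cases h : c.eval B σ v = 0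
    · obtain ⟨σ₂, T₂, r₂, l₂, a₂, e₂⟩ := hy ρ k σ₁ v hb.2.2 hk hρ
        (fun i => by rw [a₁ _ (hρ i), hv])
      rw [a₁ B (by omega)] at l₂
      refine ⟨σ₂, _, .seq r₁ (.condFalse ?_ r₂), ?_, ?_, ?_⟩
      · rw [cell_eval, e₁, h]
      · simp only [cell_steps, time]; omega
      · exact fun a ha => (a₂ a ha).trans (a₁ a ha)
      · rw [e₂, eval_congr hB (fun a ha => a₁ a (by omega)) y hb.2.2]
        simp [eval, h]
    · obtain ⟨σ₂, T₂, r₂, l₂, a₂, e₂⟩ := hx ρ k σ₁ v hb.2.1 hk hρ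
        (fun i => by rw [a₁ _ (hρ i), hv])
      rw [a₁ B (by omega)] at l₂
      refine ⟨σ₂, _, .seq r₁ (.condTrue ?_ r₂), ?_, ?_, ?_⟩
      · rw [cell_eval, e₁]; exact h
      · simp only [cell_steps, time]; omega
      · exact fun a ha => (a₂ a ha).trans (a₁ a ha)
      · rw [e₂, eval_congr hB (fun a ha => a₁ a (by omega)) x hb.2.1]
        simp [eval, h]
  | sum e ih =>
    intro ρ k σ v hb hk hρ hv
    set σ₁ := (σ.set k 0 0).set (k + 1) 0 0 with hσ₁
    have agree : ∀ a < k, σ₁ a = σ a := fun a ha => by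
      rw [hσ₁, RamState.set_of_ne (by omega), RamState.set_of_ne (by omega)]
    obtain ⟨σ₂, T, r, l, hI⟩ := ramRun_countingLoop (B := B) (c := k + 1)
      (P := .seq (e.compile B (envCons (k + 1) ρ) (k + 2))
          (.seq (.write k (.lit 0) (.add (cell k) (cell (k + 2))))
            (.write (k + 1) (.lit 0) (.add (cell (k + 1)) (.lit 1)))))
      (fun i τ => (∀ a < k, τ a = σ a) ∧ τ (k + 1) 0 = i ∧
        τ k 0 = ∑ j ∈ Finset.range i, e.eval B σ (envCons j v))
      (σ B 0) (e.time (σ B 0) + 14)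
      (fun i τ h => ⟨by rw [h.1 B (by omega)], h.2.1⟩)
      (by
        rintro i τ hi ⟨h1, h2, h3⟩
        obtain ⟨τ₁, T₁, r₁, l₁, a₁, e₁⟩ := ih (envCons (k + 1) ρ) (k + 2) τ (envCons i v) hb
          (by omega) (fun j => by cases j with
            | zero => simp
            | succ j => exact (hρ j).trans (by omega))
          (fun j => by cases j with
            | zero => simpa using h2
            | succ j => simp [h1 _ (hρ j), hv])
        refine ⟨_, _, .seq r₁ (.seq (.write _ _ _ _) (.write _ _ _ _)), ?_, ?_, ?_, ?_⟩
        · rw [h1 B (by omega)] at l₁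
          simp only [RamExpr.steps, cell_steps]; omega
        · intro a ha
          rw [RamState.set_of_ne (by omega), RamState.set_of_ne (by omega), a₁ a (by omega),
            h1 a ha]
        · refine RamState.set_same.trans ?_
          simp only [RamExpr.eval, cell_eval]
          rw [RamState.set_of_ne (by omega), a₁ (k + 1) (by omega), h2]
        · rw [RamState.set_of_ne (by omega)]
          refine RamState.set_same.trans ?_
          simp only [RamExpr.eval, cell_eval]
          rw [a₁ k (by omega), h3, e₁, Finset.sum_range_succ,
            eval_congr hB (fun a ha => h1 a (by omega)) e hb])
      σ₁ ⟨agree, by simp [hσ₁], by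
        rw [hσ₁, RamState.set_of_ne (by omega)]; simp⟩
    refine ⟨σ₂, _, .seq (.write _ _ _ _) (.seq (.write _ _ _ _) r), ?_, hI.1, hI.2.2⟩
    simp only [RamExpr.steps, time]
    have : e.time (σ B 0) + 14 + 6 ≤ e.time (σ B 0) + 30 := by omega
    have := Nat.mul_le_mul_left (σ B 0) this
    omega

end SumExpr

/-! ## Polynomial bounds -/

/-- A function is bounded by a polynomial. -/
def PolyBounded (f : ℕ → ℕ) : Prop := ∃ a b, ∀ n, f n ≤ a * (n + 1) ^ b

namespace PolyBounded

lemma const (c : ℕ) : PolyBounded (fun _ => c) := ⟨c, 0, fun n => by simp⟩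

lemma id : PolyBounded (fun n => n) := ⟨1, 1, fun n => by simp⟩

lemma of_le {f g : ℕ → ℕ} (hg : PolyBounded g) (h : ∀ n, f n ≤ g n) : PolyBounded f := by
  obtain ⟨a, b, hab⟩ := hg
  exact ⟨a, b, fun n => (h n).trans (hab n)⟩

lemma add {f g : ℕ → ℕ} (hf : PolyBounded f) (hg : PolyBounded g) :
    PolyBounded (fun n => f n + g n) := by
  obtain ⟨a, b, h⟩ := hf
  obtain ⟨c, d, h'⟩ := hg
  refine ⟨a + c, b + d, fun n => ?_⟩
  have h1 : (n + 1) ^ b ≤ (n + 1) ^ (b + d) := Nat.pow_le_pow_right (by omega) (by omega)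
  have h2 : (n + 1) ^ d ≤ (n + 1) ^ (b + d) := Nat.pow_le_pow_right (by omega) (by omega)
  calc f n + g n ≤ a * (n + 1) ^ b + c * (n + 1) ^ d := add_le_add (h n) (h' n)
    _ ≤ a * (n + 1) ^ (b + d) + c * (n + 1) ^ (b + d) :=
      add_le_add (Nat.mul_le_mul_left _ h1) (Nat.mul_le_mul_left _ h2)
    _ = _ := by ring

lemma mul {f g : ℕ → ℕ} (hf : PolyBounded f) (hg : PolyBounded g) :
    PolyBounded (fun n => f n * g n) := by
  obtain ⟨a, b, h⟩ := hf
  obtain ⟨c, d, h'⟩ := hg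
  refine ⟨a * c, b + d, fun n => (Nat.mul_le_mul (h n) (h' n)).trans (le_of_eq ?_)⟩
  ring

lemma pow {f : ℕ → ℕ} (hf : PolyBounded f) (m : ℕ) : PolyBounded (fun n => f n ^ m) := by
  induction m with
  | zero => simpa using const 1
  | succ m ih => simpa [pow_succ] using ih.mul hf

lemma comp {f g : ℕ → ℕ} (hf : PolyBounded f) (hg : PolyBounded g) :
    PolyBounded (fun n => f (g n)) := by
  obtain ⟨a, b, h⟩ := hf
  exact ((const a).mul ((hg.add (const 1)).pow b)).of_le fun n => h (g n)

end PolyBounded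

/-- Nested sums multiply the number of terms, but the nesting depth is fixed with the expression. -/
lemma SumExpr.polyBounded_time (e : SumExpr) : PolyBounded (fun M => e.time M) := by
  induction e with
  | lit c => exact .const _
  | var i => exact .const _
  | read a e ih => exact ih.add (.const _)
  | add x y hx hy => exact (hx.add hy).add (.const _)
  | sub x y hx hy => exact (hx.add hy).add (.const _)
  | ite c x y hc hx hy => exact ((hc.add hx).add hy).add (.const _)
  | sum e ih => exact (PolyBounded.id.mul (ih.add (.const _))).add (.const _)

/-! ## Definable functions -/

/-- The function `F` of the memory and of an environment is the value of an expression that reads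
only arrays below `k` and whose sums run up to the content of cell 0 of array `B`. -/
def Definable (B k : ℕ) (F : RamState → (ℕ → ℕ) → ℕ) : Prop :=
  ∃ e : SumExpr, e.Below k ∧ ∀ σ v, e.eval B σ v = F σ v

/-- A relation between memory and environment is decided by an expression. -/
def DefinableRel (B k : ℕ) (p : RamState → (ℕ → ℕ) → Prop) : Prop :=
  ∃ e : SumExpr, e.Below k ∧ ∀ σ v, e.eval B σ v ≠ 0 ↔ p σ v

namespace Definable

variable {B k : ℕ} {F G : RamState → (ℕ → ℕ) → ℕ} {p q : RamState → (ℕ → ℕ) → Prop}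

lemma const (c : ℕ) : Definable B k (fun _ _ => c) := ⟨.lit c, trivial, fun _ _ => rfl⟩

lemma var (i : ℕ) : Definable B k (fun _ v => v i) := ⟨.var i, trivial, fun _ _ => rfl⟩

lemma read {a : ℕ} (ha : a < k) (hF : Definable B k F) : Definable B k (fun σ v => σ a (F σ v)) := by
  obtain ⟨e, he, h⟩ := hF
  exact ⟨.read a e, ⟨ha, he⟩, fun σ v => by simp [SumExpr.eval, h]⟩

lemma add (hF : Definable B k F) (hG : Definable B k G) :
    Definable B k (fun σ v => F σ v + G σ v) := by
  obtain ⟨e, he, h⟩ := hF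
  obtain ⟨e', he', h'⟩ := hG
  exact ⟨.add e e', ⟨he, he'⟩, fun σ v => by simp [SumExpr.eval, h, h']⟩

lemma sub (hF : Definable B k F) (hG : Definable B k G) :
    Definable B k (fun σ v => F σ v - G σ v) := by
  obtain ⟨e, he, h⟩ := hF
  obtain ⟨e', he', h'⟩ := hG
  exact ⟨.sub e e', ⟨he, he'⟩, fun σ v => by simp [SumExpr.eval, h, h']⟩

lemma ite [∀ σ v, Decidable (p σ v)] (hp : DefinableRel B k p) (hF : Definable B k F)
    (hG : Definable B k G) : Definable B k (fun σ v => if p σ v then F σ v else G σ v) := by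
  obtain ⟨c, hc, h⟩ := hp
  obtain ⟨e, he, h₁⟩ := hF
  obtain ⟨e', he', h₂⟩ := hG
  refine ⟨.ite c e e', ⟨hc, he, he'⟩, fun σ v => ?_⟩
  simp only [SumExpr.eval, h, h₁, h₂]

lemma sum {H : RamState → (ℕ → ℕ) → ℕ → ℕ}
    (hH : Definable B k (fun σ w => H σ (fun i => w (i + 1)) (w 0))) :
    Definable B k (fun σ v => ∑ i ∈ Finset.range (σ B 0), H σ v i) := by
  obtain ⟨e, he, h⟩ := hH
  exact ⟨.sum e, he, fun σ v => by simp [SumExpr.eval, h]⟩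

lemma subst (hF : Definable B k F) {s : RamState → (ℕ → ℕ) → ℕ → ℕ}
    (hs : ∀ i, Definable B k (fun σ v => s σ v i)) :
    Definable B k (fun σ v => F σ (s σ v)) := by
  obtain ⟨e, he, h⟩ := hF
  choose t ht h' using hs
  refine ⟨e.subst t, .subst e t ht he, fun σ v => ?_⟩
  rw [SumExpr.eval_subst, h]
  congr 1
  funext i
  exact h' i σ v

lemma shift (hF : Definable B k F) : Definable B k (fun σ w => F σ (fun i => w (i + 1))) :=
  hF.subst fun i => var (i + 1)

lemma mono {l : ℕ} (hkl : k ≤ l) (hF : Definable B k F) : Definable B l F := by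
  obtain ⟨e, he, h⟩ := hF
  exact ⟨e, .mono hkl e he, h⟩

lemma congr_arrays (hB : B < k) (hF : Definable B k F) {σ τ : RamState}
    (h : ∀ a < k, σ a = τ a) (v : ℕ → ℕ) : F σ v = F τ v := by
  obtain ⟨e, he, h'⟩ := hF
  rw [← h', ← h', SumExpr.eval_congr hB h e he]

end Definable

namespace DefinableRel

variable {B k : ℕ} {F G : RamState → (ℕ → ℕ) → ℕ} {p q : RamState → (ℕ → ℕ) → Prop}

lemma le (hF : Definable B k F) (hG : Definable B k G) :
    DefinableRel B k (fun σ v => F σ v ≤ G σ v) := by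
  obtain ⟨e, he, h⟩ := (Definable.const 1).sub (hF.sub hG)
  refine ⟨e, he, fun σ v => ?_⟩
  rw [h]
  show 1 - (F σ v - G σ v) ≠ 0 ↔ F σ v ≤ G σ v
  omega

lemma not (hp : DefinableRel B k p) : DefinableRel B k (fun σ v => ¬ p σ v) := by
  obtain ⟨c, hc, h⟩ := hp
  refine ⟨.sub (.lit 1) c, ⟨trivial, hc⟩, fun σ v => ?_⟩
  show _ ↔ ¬ p σ v
  rw [← h]
  simp only [SumExpr.eval]
  omega

lemma of_iff (hp : DefinableRel B k p) (h : ∀ σ v, p σ v ↔ q σ v) : DefinableRel B k q := by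
  obtain ⟨c, hc, h'⟩ := hp
  exact ⟨c, hc, fun σ v => (h' σ v).trans (h σ v)⟩

lemma lt (hF : Definable B k F) (hG : Definable B k G) :
    DefinableRel B k (fun σ v => F σ v < G σ v) :=
  (le hG hF).not.of_iff fun _ _ => not_le

lemma or (hp : DefinableRel B k p) (hq : DefinableRel B k q) :
    DefinableRel B k (fun σ v => p σ v ∨ q σ v) := by
  obtain ⟨c, hc, h⟩ := hp
  obtain ⟨c', hc', h'⟩ := hq
  refine ⟨.add c c', ⟨hc, hc'⟩, fun σ v => ?_⟩
  show _ ↔ p σ v ∨ q σ v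
  rw [← h, ← h']
  simp only [SumExpr.eval]
  omega

lemma and (hp : DefinableRel B k p) (hq : DefinableRel B k q) :
    DefinableRel B k (fun σ v => p σ v ∧ q σ v) :=
  (hp.not.or hq.not).not.of_iff fun _ _ => by tauto

lemma imp (hp : DefinableRel B k p) (hq : DefinableRel B k q) :
    DefinableRel B k (fun σ v => p σ v → q σ v) :=
  (hp.not.or hq).of_iff fun _ _ => by tauto

lemma eq (hF : Definable B k F) (hG : Definable B k G) :
    DefinableRel B k (fun σ v => F σ v = G σ v) :=
  ((le hF hG).and (le hG hF)).of_iff fun _ _ => by omega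

lemma ne (hF : Definable B k F) (hG : Definable B k G) :
    DefinableRel B k (fun σ v => F σ v ≠ G σ v) :=
  (eq hF hG).not

lemma ex {r : RamState → (ℕ → ℕ) → ℕ → Prop}
    (hr : DefinableRel B k (fun σ w => r σ (fun i => w (i + 1)) (w 0))) :
    DefinableRel B k (fun σ v => ∃ i < σ B 0, r σ v i) := by
  obtain ⟨e, he, h⟩ := hr
  refine ⟨.sum e, he, fun σ v => ?_⟩
  simp only [SumExpr.eval, ne_eq, Finset.sum_eq_zero_iff, Finset.mem_range, not_forall]
  constructor
  · rintro ⟨i, hi, hne⟩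
    exact ⟨i, hi, by simpa using (h σ (envCons i v)).1 hne⟩
  · rintro ⟨i, hi, hr⟩
    exact ⟨i, hi, (h σ (envCons i v)).2 (by simpa using hr)⟩

lemma all {r : RamState → (ℕ → ℕ) → ℕ → Prop}
    (hr : DefinableRel B k (fun σ w => r σ (fun i => w (i + 1)) (w 0))) :
    DefinableRel B k (fun σ v => ∀ i < σ B 0, r σ v i) :=
  (ex (r := fun σ v i => ¬ r σ v i) hr.not).not.of_iff fun _ _ => by push Not; rfl

lemma subst (hp : DefinableRel B k p) {s : RamState → (ℕ → ℕ) → ℕ → ℕ}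
    (hs : ∀ i, Definable B k (fun σ v => s σ v i)) :
    DefinableRel B k (fun σ v => p σ (s σ v)) := by
  obtain ⟨e, he, h⟩ := hp
  obtain ⟨e', he', h'⟩ := Definable.subst ⟨e, he, fun _ _ => rfl⟩ hs
  exact ⟨e', he', fun σ v => by rw [h', h]⟩

end DefinableRel

/-! ### Multiplication, division and bounded search by bounded sums -/

/-- `x * y` for `x ≤ M`. -/
def boundedMul (M x y : ℕ) : ℕ := ∑ i ∈ Finset.range M, if i < x then y else 0

lemma boundedMul_eq {M x : ℕ} (h : x ≤ M) (y : ℕ) : boundedMul M x y = x * y := by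
  rw [boundedMul, ← Finset.sum_filter, Finset.sum_const, smul_eq_mul]
  congr 1
  have : (Finset.range M).filter (· < x) = Finset.range x := by
    ext i; simp; omega
  rw [this, Finset.card_range]

/-- The least `i < M` with `p i`, and `M` if there is none. -/
noncomputable def boundedFind (M : ℕ) (p : ℕ → Prop) : ℕ :=
  open Classical in ∑ i ∈ Finset.range M, if ∀ j < M, j ≤ i → ¬ p j then 1 else 0

/-- The indices counted are exactly those before the first solution, so their number is that
solution. -/
lemma boundedFind_eq_of_least {M : ℕ} {p : ℕ → Prop} {m : ℕ} (hm : m < M) (hp : p m)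
    (hl : ∀ j < m, ¬ p j) : boundedFind M p = m := by
  classical
  rw [boundedFind, ← Finset.sum_filter, Finset.sum_const, smul_eq_mul, mul_one]
  have : (Finset.range M).filter (fun i => ∀ j < M, j ≤ i → ¬ p j) = Finset.range m := by
    ext i
    simp only [Finset.mem_filter, Finset.mem_range]
    constructor
    · rintro ⟨_, h⟩
      by_contra hc
      exact h m hm (by omega) hp
    · exact fun hi => ⟨by omega, fun j _ hji => hl j (by omega)⟩
  exact (congrArg Finset.card this).trans (Finset.card_range m)

lemma boundedFind_spec {M : ℕ} {p : ℕ → Prop} (h : ∃ m < M, p m) :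
    boundedFind M p < M ∧ p (boundedFind M p) ∧ ∀ j < boundedFind M p, ¬ p j := by
  classical
  have h' : ∃ m, m < M ∧ p m := h
  have := boundedFind_eq_of_least (Nat.find_spec h').1 (Nat.find_spec h').2
    (fun j hj hp => Nat.find_min h' hj ⟨hj.trans (Nat.find_spec h').1, hp⟩)
  rw [this]
  exact ⟨(Nat.find_spec h').1, (Nat.find_spec h').2,
    fun j hj hp => Nat.find_min h' hj ⟨hj.trans (Nat.find_spec h').1, hp⟩⟩

lemma boundedFind_of_not {M : ℕ} {p : ℕ → Prop} (h : ∀ m < M, ¬ p m) : boundedFind M p = M := by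
  classical
  rw [boundedFind, Finset.sum_eq_card_nsmul (b := 1)]
  · simp
  · intro i _
    rw [if_pos fun j hj _ => h j hj]

/-- `x / y` for `x < M` and `y > 0`, found as the least `i` with `x < (i + 1) * y`. -/
noncomputable def boundedDiv (M x y : ℕ) : ℕ := boundedFind M (fun i => x < boundedMul M i y + y)

lemma boundedDiv_eq {M x y : ℕ} (hx : x < M) (hy : 0 < y) : boundedDiv M x y = x / y := by
  have hle : x / y ≤ x := Nat.div_le_self x y
  refine boundedFind_eq_of_least (hle.trans_lt hx) ?_ ?_
  · rw [boundedMul_eq (hle.trans hx.le)]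
    have := Nat.lt_div_mul_add (a := x) hy
    omega
  · intro j hj
    rw [boundedMul_eq (by omega), not_lt]
    have h1 : (j + 1) * y ≤ x := (Nat.le_div_iff_mul_le hy).1 hj
    linarith [Nat.add_mul j 1 y]

/-- `x % y` for `x < M` and `y > 0`. -/
noncomputable def boundedMod (M x y : ℕ) : ℕ := x - boundedMul M (boundedDiv M x y) y

lemma boundedMod_eq {M x y : ℕ} (hx : x < M) (hy : 0 < y) : boundedMod M x y = x % y := by
  rw [boundedMod, boundedDiv_eq hx hy, boundedMul_eq ((Nat.div_le_self x y).trans hx.le)]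
  have := Nat.div_add_mod x y
  have h : x / y * y = y * (x / y) := mul_comm _ _
  omega

namespace Definable

variable {B k : ℕ} {F G : RamState → (ℕ → ℕ) → ℕ}

lemma boundedMul (hF : Definable B k F) (hG : Definable B k G) :
    Definable B k (fun σ v => boundedMul (σ B 0) (F σ v) (G σ v)) :=
  sum (H := fun σ v i => if i < F σ v then G σ v else 0)
    (ite (.lt (var 0) hF.shift) hG.shift (const 0))

lemma boundedFind {r : RamState → (ℕ → ℕ) → ℕ → Prop}
    (hr : DefinableRel B k (fun σ w => r σ (fun i => w (i + 1)) (w 0))) :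
    Definable B k (fun σ v => boundedFind (σ B 0) (fun i => r σ v i)) := by
  classical
  refine sum (H := fun σ v i => if ∀ j < σ B 0, j ≤ i → ¬ r σ v j then 1 else 0)
    (ite (.all (r := fun σ v j => j ≤ v 0 → ¬ r σ (fun i => v (i + 1)) j) ?_) (const 1) (const 0))
  refine .imp (.le (var 0) (var 1)) (.not ?_)
  -- Under both binders variable 0 is the candidate `j` and variable 1 the outer index, which `r`
  -- must not see and which is therefore skipped.
  exact hr.subst (s := fun σ v i => match i with
    | 0 => v 0
    | j + 1 => v (j + 2)) (fun i => by cases i <;> exact var _)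

lemma boundedDiv (hF : Definable B k F) (hG : Definable B k G) :
    Definable B k (fun σ v => boundedDiv (σ B 0) (F σ v) (G σ v)) :=
  boundedFind (r := fun σ v i => F σ v < _root_.boundedMul (σ B 0) i (G σ v) + G σ v)
    (.lt hF.shift (((var 0).boundedMul hG.shift).add hG.shift))

lemma boundedMod (hF : Definable B k F) (hG : Definable B k G) :
    Definable B k (fun σ v => boundedMod (σ B 0) (F σ v) (G σ v)) :=
  hF.sub ((boundedDiv hF hG).boundedMul hG)

/-- Every function with finite support is definable. -/
lemma table (t : ℕ → ℕ) (m : ℕ) (hF : Definable B k F) :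
    Definable B k (fun σ v => if F σ v < m then t (F σ v) else 0) := by
  induction m with
  | zero => exact const 0
  | succ m ih =>
    have := ite (.eq hF (const m)) (const (t m)) ih
    obtain ⟨e, he, h⟩ := this
    refine ⟨e, he, fun σ v => ?_⟩
    rw [h]
    by_cases hm : F σ v = m
    · simp [hm]
    · have : F σ v < m ↔ F σ v < m + 1 := by omega
      simp only [hm, if_false, this]

end Definable

/-! ## Filling arrays -/

/-- The program that stores, for all `i` below the content of cell 0 of array `B`, the value of `e`
at `i` in cell `i` of array `a`, with working memory from array `s` on. -/
def fillProgram (B a s : ℕ) (e : SumExpr) : RamProgram :=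
  .seq (.write s (.lit 0) (.lit 0)) (.loop (.sub (cell B) (cell s))
    (.seq (e.compile B (fun _ => s) (s + 1))
      (.seq (.write a (cell s) (cell (s + 1)))
        (.write s (.lit 0) (.add (cell s) (.lit 1))))))

/-- If the value of `F` at `i` depends, in array `a`, only on cells below `i`, then some program
with polynomially bounded time fills array `a` according to the recursion `F`. -/
theorem exists_fill {B a s : ℕ} (hBs : B < s) (has : a < s) (hBa : B ≠ a)
    {F : RamState → (ℕ → ℕ) → ℕ} (hF : Definable B s F)
    (hrec : ∀ σ τ i, (∀ b < s, b ≠ a → σ b = τ b) → (∀ j < i, σ a j = τ a j) →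
      F σ (fun _ => i) = F τ (fun _ => i)) :
    ∃ P g, PolyBounded g ∧ ∀ σ, ∃ σ' T, RamRun P σ σ' T ∧ T ≤ g (σ B 0) ∧
      (∀ b < s, b ≠ a → σ' b = σ b) ∧ ∀ i < σ B 0, σ' a i = F σ' (fun _ => i) := by
  obtain ⟨e, he, heF⟩ := hF
  refine ⟨fillProgram B a s e, fun M => M * (e.time M + 30) + 30,
    (PolyBounded.id.mul (e.polyBounded_time.add (.const _))).add (.const _), fun σ => ?_⟩
  set σ₁ := σ.set s 0 0 with hσ₁
  obtain ⟨σ₂, T, r, l, hI⟩ := ramRun_countingLoop (B := B) (c := s)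
    (P := .seq (e.compile B (fun _ => s) (s + 1))
      (.seq (.write a (cell s) (cell (s + 1)))
        (.write s (.lit 0) (.add (cell s) (.lit 1)))))
    (fun i τ => (∀ b < s, b ≠ a → τ b = σ b) ∧ τ s 0 = i ∧
      ∀ j < i, τ a j = F τ (fun _ => j))
    (σ B 0) (e.time (σ B 0) + 14)
    (fun i τ h => ⟨by rw [h.1 B hBs hBa], h.2.1⟩)
    (by
      rintro i τ hi ⟨h1, h2, h3⟩
      obtain ⟨τ₁, T₁, r₁, l₁, a₁, e₁⟩ := SumExpr.compile_spec B s hBs e (fun _ => s) (s + 1) τ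
        (fun _ => i) he (by omega) (fun _ => by omega) (fun _ => h2)
      set τ₃ := (τ₁.set a (τ₁ s 0) (τ₁ (s + 1) 0)).set s 0 (τ₁ s 0 + 1) with hτ₃
      have hs : τ₁ s 0 = i := by rw [a₁ s (by omega), h2]
      have agree : ∀ b < s, b ≠ a → τ₃ b = τ b := fun b hb hba => by
        rw [hτ₃, RamState.set_of_ne (by omega), RamState.set_of_ne hba, a₁ b (by omega)]
      have old : ∀ j < i, τ₃ a j = τ a j := fun j hj => by
        rw [hτ₃, RamState.set_of_ne (by omega), hs, RamState.set_same_of_ne (by omega),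
          a₁ a (by omega)]
      have run : RamRun (.write s (.lit 0) (.add (cell s) (.lit 1)))
          (τ₁.set a (τ₁ s 0) (τ₁ (s + 1) 0)) τ₃ (1 + (2 + 1 + 1) + 1) := by
        convert RamRun.write _ s (.lit 0) (.add (cell s) (.lit 1)) using 1
        · simp only [cell_eval, RamExpr.eval, hτ₃]
          rw [RamState.set_of_ne (by omega : s ≠ a)]
        · rfl
      refine ⟨τ₃, _, .seq r₁ (.seq (.write _ _ _ _) run), ?_, ?_, ?_, ?_⟩
      · rw [h1 B hBs hBa] at l₁
        simp only [cell_steps]; omega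
      · exact fun b hb hba => (agree b hb hba).trans (h1 b hb hba)
      · rw [hτ₃, RamState.set_same, hs]
      · intro j hj
        -- Writing cell `i` does not affect the rule at `j ≤ i`, which sees array `a` only below
        -- `j`.
        rw [hrec τ₃ τ j agree (fun j' hj' => old j' (by omega))]
        rcases Nat.lt_succ_iff_lt_or_eq.1 hj with hj | rfl
        · rw [old j hj, h3 j hj]
        · rw [hτ₃, RamState.set_of_ne (by omega), hs, RamState.set_same, e₁, heF])
    σ₁ ⟨fun b hb _ => RamState.set_of_ne (by omega), by simp [hσ₁], by simp⟩
  refine ⟨σ₂, _, .seq (.write _ _ _ _) r, ?_, hI.1, hI.2.2⟩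
  simp only [RamExpr.steps]
  have : e.time (σ B 0) + 14 + 6 ≤ e.time (σ B 0) + 30 := by omega
  have := Nat.mul_le_mul_left (σ B 0) this
  omega

/-- `F` may be used to fill array `a`: it reads arrays below `a`, and array `a` itself only below
the current index. -/
structure FillRule (B a : ℕ) (F : RamState → (ℕ → ℕ) → ℕ) : Prop where
  definable : Definable B (a + 1) F
  recursive : ∀ σ τ i, (∀ b < a, σ b = τ b) → (∀ j < i, σ a j = τ a j) →
    F σ (fun _ => i) = F τ (fun _ => i)

lemma FillRule.of_definable {B a : ℕ} (hB : B < a) {F : RamState → (ℕ → ℕ) → ℕ}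
    (h : Definable B a F) : FillRule B a F :=
  ⟨h.mono (by omega), fun _ _ _ h₁ _ => h.congr_arrays hB h₁ _⟩

/-- Fill the arrays `a, a + 1, …` one after the other by a list of rules. -/
theorem exists_fill_list {B : ℕ} (L : List (RamState → (ℕ → ℕ) → ℕ)) : ∀ (a : ℕ), B < a →
    (∀ j (hj : j < L.length), FillRule B (a + j) L[j]) →
    ∃ P g, PolyBounded g ∧ ∀ σ, ∃ σ' T, RamRun P σ σ' T ∧ T ≤ g (σ B 0) ∧
      (∀ b < a, σ' b = σ b) ∧
      ∀ j (hj : j < L.length), ∀ i < σ B 0, σ' (a + j) i = L[j] σ' (fun _ => i) := by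
  induction L with
  | nil =>
    intro a _ _
    exact ⟨.skip, fun _ => 1, .const 1, fun σ => ⟨σ, 1, .skip σ, le_rfl, fun _ _ => rfl,
      fun j hj => by simp at hj⟩⟩
  | cons F L ih =>
    intro a hB hL
    have h0 : FillRule B a F := hL 0 (by simp)
    obtain ⟨P, g, hg, hP⟩ := exists_fill (B := B) (a := a) (s := a + 1) (by omega) (by omega)
      (by omega) h0.definable
      (fun σ τ i h₁ h₂ => h0.recursive σ τ i (fun b hb => h₁ b (by omega) (by omega)) h₂)
    obtain ⟨Q, g', hg', hQ⟩ := ih (a + 1) (by omega) (fun j hj => by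
      have := hL (j + 1) (by simpa using hj)
      simpa [add_assoc, add_comm 1] using this)
    refine ⟨.seq P Q, fun n => g n + g' n, hg.add hg', fun σ => ?_⟩
    obtain ⟨σ₁, T₁, r₁, l₁, a₁, e₁⟩ := hP σ
    obtain ⟨σ₂, T₂, r₂, l₂, a₂, e₂⟩ := hQ σ₁
    have hBσ : σ₁ B = σ B := a₁ B (by omega) (by omega)
    rw [hBσ] at l₂ e₂
    refine ⟨σ₂, _, .seq r₁ r₂, add_le_add l₁ l₂, fun b hb => ?_, ?_⟩
    · rw [a₂ b (by omega), a₁ b (by omega) (by omega)]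
    · intro j hj i hi
      cases j with
      | zero =>
        simp only [add_zero, List.getElem_cons_zero]
        rw [a₂ a (by omega), e₁ i hi]
        exact h0.definable.congr_arrays (by omega) (fun b hb => (a₂ b hb).symm) _
      | succ j =>
        have := e₂ j (by simpa using hj) i hi
        simpa [add_assoc, add_comm 1] using this

/-- A polynomially large number is stored in cell 0 of some array. -/
theorem exists_large_number (base K r : ℕ) :
    ∃ P g, PolyBounded g ∧ ∀ σ : RamState, ∃ σ' T, RamRun P σ σ' T ∧ T ≤ g (σ 0 0) ∧
      (∀ b < base, σ' b = σ b) ∧ σ' (base + r) 0 = (σ 0 0 + (K + 1)) ^ 2 ^ r := by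
  induction r with
  | zero =>
    refine ⟨.write base (.lit 0) (.add (cell 0) (.lit (K + 1))), fun _ => 10, .const _, fun σ =>
      ⟨_, _, .write _ _ _ _, by simp [RamExpr.steps], fun b hb => RamState.set_of_ne (by omega),
        ?_⟩⟩
    refine RamState.set_same.trans ?_
    simp [RamExpr.eval]
  | succ r ih =>
    obtain ⟨P, g, hg, hP⟩ := ih
    -- Squaring without multiplication: add up `M` copies of `M`, with `M` itself as the bound of
    -- the sum.
    have hd : Definable (base + r) (base + (r + 1)) (fun σ _ => ∑ _i ∈ Finset.range (σ (base + r) 0),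
        σ (base + r) 0) :=
      .sum (H := fun σ _ _ => σ (base + r) 0) (.read (by omega) (.const 0))
    obtain ⟨Q, g', hg', hQ⟩ := exists_fill (B := base + r) (a := base + (r + 1))
      (s := base + (r + 2)) (by omega) (by omega) (by omega)
      (F := fun σ _ => ∑ _i ∈ Finset.range (σ (base + r) 0), σ (base + r) 0) (hd.mono (by omega))
      (fun σ τ i h₁ _ => hd.congr_arrays (by omega) (fun b hb => h₁ b (by omega) (by omega)) (fun _ => i))
    refine ⟨.seq P Q, fun n => g n + g' ((n + (K + 1)) ^ 2 ^ r),
      hg.add (hg'.comp ((PolyBounded.id.add (.const _)).pow _)), fun σ => ?_⟩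
    obtain ⟨σ₁, T₁, r₁, l₁, a₁, e₁⟩ := hP σ
    obtain ⟨σ₂, T₂, r₂, l₂, a₂, e₂⟩ := hQ σ₁
    refine ⟨σ₂, _, .seq r₁ r₂, add_le_add l₁ (by rwa [e₁] at l₂), fun b hb => ?_, ?_⟩
    · rw [a₂ b (by omega) (by omega), a₁ b hb]
    · rw [e₂ 0 (by rw [e₁]; positivity), a₂ (base + r) (by omega) (by omega), e₁]
      simp only [Finset.sum_const, Finset.card_range, smul_eq_mul]
      ring

/-! ## Geometric groups of ranks

Ranks `1, 2, …` are divided into segments `[L ^ m, L ^ (m + 1))`, and every segment with `m ≥ 1`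
into groups of `L ^ (m - 1)` consecutive ranks. -/

/-- The size of the groups in the segment of the rank `r`. -/
def groupWidth (L r : ℕ) : ℕ := L ^ (Nat.log L r - 1)

/-- The first rank in the group of the rank `r`. -/
def groupStart (L r : ℕ) : ℕ := r / groupWidth L r * groupWidth L r

/-- First rank of the reference block of the group that starts at `a`. -/
def refLo (L a : ℕ) : ℕ :=
  if Nat.log L a = 0 then a else if a = L ^ Nat.log L a then L ^ (Nat.log L a - 1)
  else a - groupWidth L a

/-- End of the reference block of the group that starts at `a`. -/
def refHi (L a : ℕ) : ℕ := if Nat.log L a = 0 then a + 1 else a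

section

variable {L r a : ℕ}

lemma groupWidth_pos (hL : 2 ≤ L) : 0 < groupWidth L r := by unfold groupWidth; positivity

lemma groupStart_le : groupStart L r ≤ r := Nat.div_mul_le_self _ _

lemma lt_groupStart_add (hL : 2 ≤ L) : r < groupStart L r + groupWidth L r :=
  Nat.lt_div_mul_add (groupWidth_pos hL)

lemma groupWidth_dvd_pow_log : groupWidth L r ∣ L ^ Nat.log L r := pow_dvd_pow _ (by omega)

/-- The width divides the first rank of the segment, so rounding down to a multiple of the width
does not leave the segment. -/
lemma pow_log_le_groupStart (hL : 2 ≤ L) (hr : 1 ≤ r) : L ^ Nat.log L r ≤ groupStart L r := by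
  obtain ⟨q, hq⟩ := groupWidth_dvd_pow_log (L := L) (r := r)
  have h : L ^ Nat.log L r ≤ r := Nat.pow_log_le_self L (by omega)
  rw [groupStart, hq, mul_comm]
  refine Nat.mul_le_mul_right _ ((Nat.le_div_iff_mul_le (groupWidth_pos hL)).2 ?_)
  rwa [mul_comm, ← hq]

lemma one_le_groupStart (hL : 2 ≤ L) (hr : 1 ≤ r) : 1 ≤ groupStart L r :=
  le_trans (Nat.one_le_pow _ _ (by omega)) (pow_log_le_groupStart hL hr)

lemma log_eq_of_mem {m : ℕ} (hL : 2 ≤ L) (h₁ : L ^ m ≤ r) (h₂ : r < L ^ (m + 1)) :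
    Nat.log L r = m :=
  (Nat.log_eq_iff (Or.inr ⟨by omega, by have := Nat.pow_pos (n := m) (show 0 < L by omega); omega⟩)).2
    ⟨h₁, h₂⟩

lemma lt_pow_log_succ (hL : 2 ≤ L) : r < L ^ (Nat.log L r + 1) :=
  Nat.lt_pow_succ_log_self (by omega) r

lemma log_groupStart (hL : 2 ≤ L) (hr : 1 ≤ r) : Nat.log L (groupStart L r) = Nat.log L r :=
  log_eq_of_mem hL (pow_log_le_groupStart hL hr) (groupStart_le.trans_lt (lt_pow_log_succ hL))

lemma groupWidth_groupStart (hL : 2 ≤ L) (hr : 1 ≤ r) :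
    groupWidth L (groupStart L r) = groupWidth L r := by
  rw [groupWidth, log_groupStart hL hr, groupWidth]

lemma groupStart_groupStart (hL : 2 ≤ L) (hr : 1 ≤ r) :
    groupStart L (groupStart L r) = groupStart L r := by
  rw [groupStart, groupWidth_groupStart hL hr, groupStart,
    Nat.mul_div_cancel _ (groupWidth_pos hL)]

lemma groupStart_of_log_eq_zero (h : Nat.log L r = 0) : groupStart L r = r := by
  simp [groupStart, groupWidth, h]

lemma groupWidth_dvd_of_groupStart_eq (ha : groupStart L a = a) : groupWidth L a ∣ a :=
  ⟨a / groupWidth L a, by rw [mul_comm]; exact ha.symm⟩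

/-- Both `a` and the end of its segment are multiples of the width, so a full block of that width
from `a` on stays inside the segment. -/
lemma groupStart_eq_of_mem (hL : 2 ≤ L) {s : ℕ} (ha : groupStart L a = a) (ha1 : 1 ≤ a) (h₁ : a ≤ s)
    (h₂ : s < a + groupWidth L a) : groupStart L s = a := by
  obtain ⟨q, hq⟩ := groupWidth_dvd_of_groupStart_eq ha
  have hlog : Nat.log L s = Nat.log L a := by
    refine log_eq_of_mem hL ((Nat.pow_log_le_self L (by omega)).trans h₁) ?_
    have hd : groupWidth L a ∣ L ^ (Nat.log L a + 1) := pow_dvd_pow _ (by omega)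
    obtain ⟨q', hq'⟩ := hd
    have h3 : a < L ^ (Nat.log L a + 1) := lt_pow_log_succ hL
    rw [hq'] at h3 ⊢
    have h4 : q < q' := by
      by_contra hc
      have := Nat.mul_le_mul_left (groupWidth L a) (not_lt.1 hc)
      omega
    have := Nat.mul_le_mul_left (groupWidth L a) (Nat.succ_le_of_lt h4)
    rw [Nat.mul_succ] at this
    omega
  have hw : groupWidth L s = groupWidth L a := by rw [groupWidth, hlog, groupWidth]
  rw [groupStart, hw]
  have : s / groupWidth L a = q :=
    Nat.div_eq_of_lt_le (by rw [mul_comm]; omega) (by rw [Nat.add_mul, one_mul, mul_comm]; omega)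
  rw [this, mul_comm, ← hq]

/-- Distinct multiples of the width differ by at least the width: a group that is not the first of
its segment has a complete group before it. -/
lemma pow_log_add_groupWidth_le (ha : groupStart L a = a) (ha1 : 1 ≤ a)
    (hne : a ≠ L ^ Nat.log L a) : L ^ Nat.log L a + groupWidth L a ≤ a := by
  obtain ⟨q, hq⟩ := groupWidth_dvd_of_groupStart_eq ha
  obtain ⟨q', hq'⟩ := groupWidth_dvd_pow_log (L := L) (r := a)
  have h : L ^ Nat.log L a ≤ a := Nat.pow_log_le_self L (by omega)
  have h4 : q' < q := by
    by_contra hc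
    have := Nat.mul_le_mul_left (groupWidth L a) (not_lt.1 hc)
    omega
  have := Nat.mul_le_mul_left (groupWidth L a) (Nat.succ_le_of_lt h4)
  rw [Nat.mul_succ] at this
  omega

lemma one_le_refLo (hL : 2 ≤ L) (ha : groupStart L a = a) (ha1 : 1 ≤ a) : 1 ≤ refLo L a := by
  unfold refLo
  split_ifs with h₁ h₂
  · exact ha1
  · exact Nat.one_le_pow _ _ (by omega)
  · have := pow_log_add_groupWidth_le ha ha1 h₂
    have := Nat.one_le_pow (Nat.log L a) L (by omega)
    omega

/-- Only two reference blocks contain a given rank. -/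
lemma start_of_mem_ref (hL : 2 ≤ L) (ha : groupStart L a = a) (ha1 : 1 ≤ a) (h₁ : refLo L a ≤ r)
    (h₂ : r < refHi L a) :
    a = L ^ (Nat.log L r + 1) ∨
      a = if Nat.log L r = 0 then r else groupStart L r + groupWidth L r := by
  unfold refLo at h₁
  unfold refHi at h₂
  split_ifs at h₁ h₂ with h h'
  · right
    obtain rfl : a = r := by omega
    rw [if_pos h]
  · left
    have : Nat.log L r = Nat.log L a - 1 := by
      refine log_eq_of_mem hL h₁ ?_
      rwa [Nat.sub_add_cancel (by omega), ← h']
    rw [this, Nat.sub_add_cancel (by omega)]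
    exact h'
  · right
    have h3 := pow_log_add_groupWidth_le ha ha1 h'
    have hlog : Nat.log L r = Nat.log L a :=
      log_eq_of_mem hL (by omega) (h₂.trans (lt_pow_log_succ hL))
    have hw : groupWidth L r = groupWidth L a := by rw [groupWidth, hlog, groupWidth]
    rw [if_neg (by rwa [hlog])]
    obtain ⟨q, hq⟩ := groupWidth_dvd_of_groupStart_eq ha
    have hpos := groupWidth_pos (L := L) (r := a) hL
    have hq1 : 1 ≤ q := by
      rcases Nat.eq_zero_or_pos q with rfl | h
      · simp at hq; omega
      · exact h
    have hqq : groupWidth L a * (q - 1) + groupWidth L a = a := by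
      rw [← Nat.mul_succ, Nat.succ_eq_add_one, Nat.sub_add_cancel hq1, ← hq]
    have hdiv : r / groupWidth L a = q - 1 :=
      Nat.div_eq_of_lt_le (by rw [mul_comm]; omega)
        (by rw [Nat.add_mul, one_mul, mul_comm]; omega)
    rw [groupStart, hw, hdiv, mul_comm]
    omega

lemma pow_le_refHi_sub_refLo (hL : 2 ≤ L) (ha : groupStart L a = a) (ha1 : 1 ≤ a) :
    refLo L a + L ^ (Nat.log L a - 1) ≤ refHi L a := by
  unfold refLo refHi
  split_ifs with h h'
  · simp [h]
  · have : L ^ Nat.log L a = L * L ^ (Nat.log L a - 1) := by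
      rw [← pow_succ', Nat.sub_add_cancel (by omega)]
    have h2 := Nat.mul_le_mul_right (L ^ (Nat.log L a - 1)) hL
    omega
  · have := pow_log_add_groupWidth_le ha ha1 h'
    have h2 : groupWidth L a = L ^ (Nat.log L a - 1) := rfl
    omega

/-- A first group refers to the whole preceding segment, which is `L - 1 ≥ H` group widths long.
Hence giving up slots for the entire group concerns only a fraction `1 / H` of the block. -/
lemma mul_groupWidth_le_of_first {H : ℕ} (hH : H + 1 ≤ L) (h : Nat.log L a ≠ 0)
    (h' : a = L ^ Nat.log L a) : H * groupWidth L a ≤ refHi L a - refLo L a := by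
  have h1 : refLo L a = groupWidth L a := by
    rw [refLo, if_neg h, if_pos h']; rfl
  have h2 : refHi L a = a := if_neg h
  have h3 : a = L * groupWidth L a := by
    conv_lhs => rw [h']
    rw [groupWidth, ← pow_succ', Nat.sub_add_cancel (by omega)]
  rw [h1, h2]
  have := Nat.mul_le_mul_right (groupWidth L a) hH
  rw [Nat.add_mul, one_mul] at this
  omega

lemma log_of_mem_ref (hL : 2 ≤ L) (ha : groupStart L a = a) (ha1 : 1 ≤ a) (h₁ : refLo L a ≤ r)
    (h₂ : r < refHi L a) : Nat.log L r = Nat.log L a ∨ Nat.log L r + 1 = Nat.log L a := by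
  unfold refLo at h₁
  unfold refHi at h₂
  split_ifs at h₁ h₂ with h h'
  · left
    obtain rfl : a = r := by omega
    rfl
  · right
    have : Nat.log L r = Nat.log L a - 1 := by
      refine log_eq_of_mem hL h₁ ?_
      rwa [Nat.sub_add_cancel (by omega), ← h']
    omega
  · left
    have h3 := pow_log_add_groupWidth_le ha ha1 h'
    exact log_eq_of_mem hL (by omega) (h₂.trans (lt_pow_log_succ hL))

end

/-! ## Next-fit with keys -/

section

variable {ι : Type*} [DecidableEq ι]

/-- Next-fit in the order of increasing keys. The open bin is `K + c`, where `K` is the key treated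
last and `l` bounds the load of that bin. A new bin is opened when the key jumps or the item does
not fit; only the second event increases `c`, and then two consecutive bins together carry more than
`C`. This is what the potential `c * C + l` records. -/
lemma exists_nextFit_aux (w key : ι → ℕ) (C : ℕ) (Z : Finset ι) (hw : ∀ z ∈ Z, w z ≤ C) :
    ∃ (q : ι → ℕ) (K c l : ℕ), (∀ κ, (∀ z ∈ Z, key z ≤ κ) → K ≤ κ) ∧ (∀ z ∈ Z, q z ≤ K + c) ∧
      (∀ z ∈ Z, ∃ d, q z = key z + d ∧ d * C ≤ 2 * ∑ y ∈ Z with key y ≤ key z, w y) ∧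
      (∀ b, ∑ z ∈ Z with q z = b, w z ≤ C) ∧ (∑ z ∈ Z with q z = K + c, w z ≤ l) ∧
      c * C + l ≤ 2 * ∑ z ∈ Z, w z := by
  induction Z using Finset.induction_on_max_value key with
  | empty => exact ⟨fun _ => 0, 0, 0, 0, by simp, by simp, by simp, by simp, by simp, by simp⟩
  | insert z Z hz hmax ih =>
    obtain ⟨q, K, c, l, hK, hq, hd, hC, hl, hcl⟩ := ih (fun y hy => hw y (Finset.mem_insert_of_mem hy))
    have hwz := hw z (Finset.mem_insert_self _ _)
    have upd : ∀ v, ∀ y ∈ Z, Function.update q z v y = q y := fun v y hy =>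
      Function.update_of_ne (fun h : y = z => hz (h ▸ hy)) _ _
    have load : ∀ v b, ∑ y ∈ insert z Z with Function.update q z v y = b, w y =
        (if v = b then w z else 0) + ∑ y ∈ Z with q y = b, w y := by
      intro v b
      rw [Finset.sum_filter, Finset.sum_insert hz, Function.update_self, Finset.sum_filter]
      congr 1
      exact Finset.sum_congr rfl fun y hy => by rw [upd v y hy]
    have tot : ∑ y ∈ insert z Z, w y = w z + ∑ y ∈ Z, w y := Finset.sum_insert hz
    have old : ∀ v, ∀ y ∈ Z, ∃ d, Function.update q z v y = key y + d ∧
        d * C ≤ 2 * ∑ x ∈ insert z Z with key x ≤ key y, w x := by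
      intro v y hy
      obtain ⟨d, h1, h2⟩ := hd y hy
      refine ⟨d, by rw [upd v y hy, h1], h2.trans (Nat.mul_le_mul_left 2 ?_)⟩
      exact Finset.sum_le_sum_of_subset (Finset.filter_subset_filter _ (Finset.subset_insert _ _))
    have full : ∑ x ∈ insert z Z with key x ≤ key z, w x = ∑ y ∈ insert z Z, w y := by
      rw [Finset.filter_true_of_mem]
      intro x hx
      rcases Finset.mem_insert.1 hx with rfl | hx
      · exact le_rfl
      · exact hmax x hx
    -- the common part of the three cases
    have build : ∀ c' l', (∀ y ∈ Z, q y ≤ key z + c') →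
        (w z + ∑ y ∈ Z with q y = key z + c', w y ≤ l') → l' ≤ C →
        c' * C + l' ≤ 2 * ∑ y ∈ insert z Z, w y →
        ∃ (q : ι → ℕ) (K c l : ℕ), (∀ κ, (∀ y ∈ insert z Z, key y ≤ κ) → K ≤ κ) ∧
          (∀ y ∈ insert z Z, q y ≤ K + c) ∧
          (∀ y ∈ insert z Z, ∃ d, q y = key y + d ∧
            d * C ≤ 2 * ∑ x ∈ insert z Z with key x ≤ key y, w x) ∧
          (∀ b, ∑ y ∈ insert z Z with q y = b, w y ≤ C) ∧
          (∑ y ∈ insert z Z with q y = K + c, w y ≤ l) ∧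
          c * C + l ≤ 2 * ∑ y ∈ insert z Z, w y := by
      intro c' l' h1 h2 h3 h4
      refine ⟨Function.update q z (key z + c'), key z, c', l', ?_, ?_, ?_, ?_, ?_, h4⟩
      · exact fun κ hκ => hκ z (Finset.mem_insert_self _ _)
      · refine Finset.forall_mem_insert _ _ _ |>.2 ⟨by simp, fun y hy => ?_⟩
        rw [upd _ y hy]
        exact h1 y hy
      · refine Finset.forall_mem_insert _ _ _ |>.2 ⟨⟨c', by simp, ?_⟩, old _⟩
        rw [full]
        omega
      · intro b
        rw [load]
        split_ifs with hb
        · rw [← hb]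
          omega
        · simpa using hC b
      · rw [load, if_pos rfl]
        exact h2
    have hKz : K ≤ key z := hK _ hmax
    rcases hKz.eq_or_lt with rfl | hlt
    · by_cases hfit : l + w z ≤ C
      · exact build c (l + w z) hq (by omega) hfit (by rw [tot]; omega)
      -- The item does not fit, and `l + w z > C` pays for the additional bin.
      · refine build (c + 1) (w z) (fun y hy => (hq y hy).trans (by omega)) ?_ hwz ?_
        · rw [Finset.filter_false_of_mem]
          · simp
          · intro y hy
            have := hq y hy
            omega
        · rw [tot, Nat.add_mul]
          omega
    -- The key has grown, so `key z + c` is beyond all bins in use and the offset need not grow.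
    · refine build c (w z) (fun y hy => (hq y hy).trans (by omega)) ?_ hwz (by rw [tot]; omega)
      rw [Finset.filter_false_of_mem]
      · simp
      · intro y hy
        have := hq y hy
        omega

/-- If the items with keys at most `t` have total size at most `5 * C * t`, then the items can be
packed in such a way that every bin number is at least the key and at most 11 times the key. -/
lemma exists_nextFit (w key : ι → ℕ) (C : ℕ) (Z : Finset ι) (hw : ∀ z ∈ Z, w z ≤ C)
    (hmass : ∀ t, ∑ y ∈ Z with key y ≤ t, w y ≤ 5 * C * t) :
    ∃ q : ι → ℕ, (∀ z ∈ Z, key z ≤ q z ∧ q z ≤ 11 * key z) ∧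
      ∀ b, ∑ z ∈ Z with q z = b, w z ≤ C := by
  rcases Nat.eq_zero_or_pos C with rfl | hC
  · refine ⟨key, fun z _ => ⟨le_rfl, by omega⟩, fun b => ?_⟩
    rw [Finset.sum_eq_zero]
    intro z hz
    have := hw z (Finset.mem_of_mem_filter z hz)
    omega
  · obtain ⟨q, K, c, l, -, -, h, h', -, -⟩ := exists_nextFit_aux w key C Z hw
    refine ⟨q, fun z hz => ?_, h'⟩
    obtain ⟨d, h1, h2⟩ := h z hz
    have h3 : d * C ≤ 10 * key z * C := by
      have := hmass (key z)
      calc d * C ≤ _ := h2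
        _ ≤ 2 * (5 * C * key z) := by omega
        _ = _ := by ring
    have := Nat.le_of_mul_le_mul_right h3 hC
    omega

end

/-! ## Inserting spare bins -/

/-- The new number of bin `b` if a spare bin is inserted after every `D` bins. -/
def regularBin (D b : ℕ) : ℕ := b + (b - 1) / D

/-- This leaves the multiples of `D + 1` free to serve as spare bins. -/
lemma regularBin_mod {D b : ℕ} (hD : 0 < D) (hb : 1 ≤ b) : ¬ (D + 1) ∣ regularBin D b := by
  intro h
  have h1 := Nat.div_add_mod (b - 1) D
  have h2 := Nat.mod_lt (b - 1) hD
  have h3 : regularBin D b = (D + 1) * ((b - 1) / D) + ((b - 1) % D + 1) := by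
    rw [regularBin, Nat.add_mul, one_mul]
    omega
  rw [h3, Nat.dvd_add_right (Dvd.intro _ rfl)] at h
  have := Nat.le_of_dvd (by omega) h
  omega

lemma le_regularBin (D b : ℕ) : b ≤ regularBin D b := Nat.le_add_right _ _

lemma regularBin_strictMono (D : ℕ) : StrictMono (regularBin D) := by
  intro a b h
  have : (a - 1) / D ≤ (b - 1) / D := Nat.div_le_div_right (by omega)
  unfold regularBin
  omega

lemma mul_regularBin_le (D b : ℕ) : D * regularBin D b ≤ (D + 1) * b := by
  have := Nat.mul_div_le (b - 1) D
  rw [regularBin, Nat.mul_add, Nat.add_mul]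
  omega

lemma regularBin_le_two_mul (D b : ℕ) : regularBin D b ≤ 2 * b := by
  have := Nat.div_le_self (b - 1) D
  unfold regularBin
  omega

/-! ## Rounded packings with a window -/

/-- The items of every class are ranked by decreasing size, with ranks `1, 2, …` without gaps. -/
structure Ranking {ι : Type*} (cls size rank : ι → ℕ) : Prop where
  pos : ∀ x, 1 ≤ rank x
  inj : ∀ x y, cls x = cls y → rank x = rank y → x = y
  antitone : ∀ x y, cls x = cls y → rank x ≤ rank y → size y ≤ size x
  contiguous : ∀ y r, 1 ≤ r → r ≤ rank y → ∃ x, cls x = cls y ∧ rank x = r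

section

variable {ι : Type*} [Fintype ι] (cls size rank p : ι → ℕ) (L H Q : ℕ)

/-- The reference block of the group that starts at rank `a` in class `c`. -/
def refBlock (c a : ℕ) : Finset ι :=
  Finset.univ.filter fun x => cls x = c ∧ refLo L a ≤ rank x ∧ rank x < refHi L a

/-- The time at which all but a fraction `1 / H` of a reference block is packed by `p`. -/
noncomputable def doneTime (c a : ℕ) : ℕ :=
  sInf {t | H * ((refBlock cls rank L c a).filter (t < p ·)).card ≤ (refBlock cls rank L c a).card}

/-- The latest of these times for the groups of a segment. -/
noncomputable def segmentDone (c m : ℕ) : ℕ :=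
  (Finset.univ.filter fun y => cls y = c ∧ Nat.log L (rank y) = m).sup fun y =>
    doneTime cls rank p L H c (groupStart L (rank y))

/-- A bound for the number of segments. -/
def segmentBound : ℕ := Finset.univ.sup rank + 1

/-- The time before which the items of a segment are not packed. -/
noncomputable def segmentStart (c m : ℕ) : ℕ :=
  ∑ m' ∈ Finset.Ico (m + 3) (segmentBound rank), Q ^ (m' - m) * segmentDone cls rank p L H c m'

variable {cls size rank p L H Q}

lemma log_lt_segmentBound (y : ι) : Nat.log L (rank y) < segmentBound rank := by
  have h : rank y ≤ Finset.univ.sup rank := Finset.le_sup (Finset.mem_univ y)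
  have := Nat.log_le_self L (rank y)
  unfold segmentBound
  omega

lemma doneTime_spec (c a : ℕ) :
    H * ((refBlock cls rank L c a).filter (doneTime cls rank p L H c a < p ·)).card ≤
      (refBlock cls rank L c a).card := by
  refine Nat.sInf_mem (s := {t | H * ((refBlock cls rank L c a).filter (t < p ·)).card ≤
    (refBlock cls rank L c a).card}) ⟨Finset.univ.sup p, ?_⟩
  rw [Set.mem_ofPred_eq, Finset.filter_false_of_mem]
  · simp
  · intro x _
    have : p x ≤ Finset.univ.sup p := Finset.le_sup (Finset.mem_univ x)
    omega

/-- Markov's inequality: one time unit before `doneTime`, more than a fraction `1 / H` of the block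
is still unpacked, and each of these items costs at least `doneTime`. -/
lemma card_mul_doneTime_le (c a : ℕ) :
    (refBlock cls rank L c a).card * doneTime cls rank p L H c a ≤
      H * ∑ x ∈ refBlock cls rank L c a, p x := by
  set R := refBlock cls rank L c a with hR
  rcases Nat.eq_zero_or_pos (doneTime cls rank p L H c a) with h | h
  · simp [h]
  · have h1 : doneTime cls rank p L H c a - 1 ∉ {t | H * (R.filter (t < p ·)).card ≤ R.card} :=
      Nat.notMem_of_lt_sInf (by rw [← doneTime]; omega)
    simp only [Set.mem_ofPred_eq, not_le] at h1
    have h2 : (R.filter (doneTime cls rank p L H c a - 1 < p ·)).card *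
        doneTime cls rank p L H c a ≤ ∑ x ∈ R, p x := by
      rw [← smul_eq_mul]
      refine (Finset.card_nsmul_le_sum _ p _ fun x hx => ?_).trans
        (Finset.sum_le_sum_of_subset (Finset.filter_subset _ _))
      have := (Finset.mem_filter.1 hx).2
      omega
    calc R.card * doneTime cls rank p L H c a
        ≤ H * (R.filter (doneTime cls rank p L H c a - 1 < p ·)).card *
          doneTime cls rank p L H c a := Nat.mul_le_mul_right _ h1.le
      _ ≤ _ := by rw [mul_assoc]; exact Nat.mul_le_mul_left _ h2

lemma Ranking.card_filter_rank (hR : Ranking cls size rank) (y : ι) {lo hi : ℕ} (hlo : 1 ≤ lo) (hhi : hi ≤ rank y + 1) :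
    (Finset.univ.filter fun x => cls x = cls y ∧ lo ≤ rank x ∧ rank x < hi).card = hi - lo := by
  rw [← Nat.card_Ico, ← Finset.card_image_of_injOn (f := rank)]
  · congr 1
    ext r
    simp only [Finset.mem_image, Finset.mem_filter, Finset.mem_univ, true_and, Finset.mem_Ico]
    constructor
    · rintro ⟨x, ⟨_, h⟩, rfl⟩
      exact h
    · intro h
      obtain ⟨x, h1, h2⟩ := hR.contiguous y r (by omega) (by omega)
      exact ⟨x, ⟨h1, by omega⟩, h2⟩
  · intro x hx x' hx' h
    simp only [Finset.coe_filter, Finset.mem_univ, true_and, Set.mem_ofPred_eq] at hx hx'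
    exact hR.inj x x' (hx.1.trans hx'.1.symm) h

lemma Ranking.card_refBlock (hR : Ranking cls size rank) (hL : 2 ≤ L) (y : ι) :
    (refBlock cls rank L (cls y) (groupStart L (rank y))).card =
      refHi L (groupStart L (rank y)) - refLo L (groupStart L (rank y)) := by
  refine hR.card_filter_rank y (one_le_refLo hL (groupStart_groupStart hL (hR.pos y))
    (one_le_groupStart hL (hR.pos y))) ?_
  have : groupStart L (rank y) ≤ rank y := groupStart_le
  unfold refHi
  split_ifs <;> omega

variable (cls rank L) in
/-- The groups, as pairs of a class and a rank. -/
def rankGroups : Finset (ℕ × ℕ) := Finset.univ.image fun y => (cls y, groupStart L (rank y))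

/-- Double counting: by `start_of_mem_ref` an item belongs to the reference blocks of at most two
groups. -/
lemma Ranking.sum_refBlock_le (hR : Ranking cls size rank) (hL : 2 ≤ L) (f : ι → ℕ) :
    ∑ G ∈ rankGroups cls rank L, ∑ x ∈ refBlock cls rank L G.1 G.2, f x ≤ 2 * ∑ x, f x := by
  classical
  simp only [refBlock, Finset.sum_filter]
  rw [Finset.sum_comm, Finset.mul_sum]
  refine Finset.sum_le_sum fun x _ => ?_
  rw [← Finset.sum_filter, Finset.sum_const, smul_eq_mul]
  refine Nat.mul_le_mul_right _ (le_trans (Finset.card_le_card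
    (t := {(cls x, L ^ (Nat.log L (rank x) + 1)), (cls x, if Nat.log L (rank x) = 0 then rank x else
      groupStart L (rank x) + groupWidth L (rank x))}) ?_) Finset.card_le_two)
  rintro ⟨c, a⟩ h
  obtain ⟨hG, h1, h2, h3⟩ := Finset.mem_filter.1 h
  obtain ⟨y, -, hy⟩ := Finset.mem_image.1 hG
  obtain ⟨-, rfl⟩ := Prod.mk.inj hy
  dsimp only at h1 h2 h3
  have := start_of_mem_ref hL (groupStart_groupStart hL (hR.pos y))
    (one_le_groupStart hL (hR.pos y)) h2 h3
  rw [← h1]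
  simpa using this

/-- The charging scheme behind the estimates that go group by group: whatever each group charges to
its reference block is charged at most twice overall. -/
lemma Ranking.sum_le_sum_groups (hR : Ranking cls size rank) (hL : 2 ≤ L) {g : ℕ × ℕ → ℕ}
    {S : Finset ι} {K : ℕ} {h : ι → ℕ}
    (hS : ∀ G ∈ rankGroups cls rank L,
      K * (S.filter fun y => (cls y, groupStart L (rank y)) = G).card * g G ≤
        ∑ x ∈ refBlock cls rank L G.1 G.2, h x) :
    K * ∑ y ∈ S, g (cls y, groupStart L (rank y)) ≤ 2 * ∑ x, h x := by
  classical
  refine le_trans ?_ (hR.sum_refBlock_le hL h)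
  rw [← Finset.sum_fiberwise_of_maps_to (s := S) (t := rankGroups cls rank L)
    (g := fun y => (cls y, groupStart L (rank y)))
    (fun y _ => Finset.mem_image_of_mem _ (Finset.mem_univ y)), Finset.mul_sum]
  refine Finset.sum_le_sum fun G hG => le_trans (le_of_eq ?_) (hS G hG)
  rw [Finset.sum_congr rfl (g := fun _ => g G) (fun y hy => by rw [(Finset.mem_filter.1 hy).2]),
    Finset.sum_const, smul_eq_mul, mul_assoc]

/-- Every rank but those in the first group of a segment can be shifted by one group. -/
def HasSlot (L r : ℕ) : Prop := Nat.log L r = 0 ∨ groupStart L r ≠ L ^ Nat.log L r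

/-- `top y` is the first, hence largest, item of the group and provides the rounded size. `slot y`
lies one group width below `y`; in segment 0 it is `y` itself. -/
lemma Ranking.exists_slot (hR : Ranking cls size rank) (hL : 2 ≤ L) :
    ∃ top slot : ι → ι, (∀ y, cls (top y) = cls y ∧ rank (top y) = groupStart L (rank y)) ∧
      (∀ y, HasSlot L (rank y) →
        slot y ∈ refBlock cls rank L (cls y) (groupStart L (rank y))) ∧
      ∀ y y', HasSlot L (rank y) → HasSlot L (rank y') → slot y = slot y' → y = y' := by
  have h1 : ∀ y, ∃ x, cls x = cls y ∧ rank x = groupStart L (rank y) := fun y =>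
    hR.contiguous y _ (one_le_groupStart hL (hR.pos y)) groupStart_le
  have h2 : ∀ y, ∃ x, HasSlot L (rank y) → cls x = cls y ∧
      rank x + (if Nat.log L (rank y) = 0 then 0 else groupWidth L (rank y)) = rank y := by
    intro y
    by_cases h0 : Nat.log L (rank y) = 0
    · exact ⟨y, fun _ => ⟨rfl, by simp [h0]⟩⟩
    by_cases hs : HasSlot L (rank y)
    · have h3 := hs.resolve_left h0
      have hlog := log_groupStart hL (hR.pos y)
      have h4 := pow_log_add_groupWidth_le (groupStart_groupStart hL (hR.pos y))
        (one_le_groupStart hL (hR.pos y)) (by rwa [hlog])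
      rw [groupWidth_groupStart hL (hR.pos y)] at h4
      have h5 : groupStart L (rank y) ≤ rank y := groupStart_le
      have h6 := Nat.one_le_pow (Nat.log L (groupStart L (rank y))) L (by omega)
      obtain ⟨x, hx, hx'⟩ := hR.contiguous y (rank y - groupWidth L (rank y)) (by omega) (by omega)
      exact ⟨x, fun _ => ⟨hx, by rw [hx', if_neg h0]; omega⟩⟩
    · exact ⟨y, fun h => absurd h hs⟩
  choose top htop using h1
  choose slot hslot using h2
  have hmem : ∀ y, HasSlot L (rank y) →
        slot y ∈ refBlock cls rank L (cls y) (groupStart L (rank y)) := by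
    intro y hy
    obtain ⟨h1, h2⟩ := hslot y hy
    have hlog := log_groupStart hL (hR.pos y)
    have h5 : groupStart L (rank y) ≤ rank y := groupStart_le
    have h6 : rank y < groupStart L (rank y) + groupWidth L (rank y) := lt_groupStart_add hL
    have h7 := groupWidth_groupStart hL (hR.pos y)
    refine Finset.mem_filter.2 ⟨Finset.mem_univ _, h1, ?_⟩
    unfold refLo refHi
    rw [hlog, h7]
    split_ifs at h2 ⊢ with h8 h9
    · rw [groupStart_of_log_eq_zero h8]
      omega
    · exact absurd h9 (hy.resolve_left h8)
    · omega
  refine ⟨top, slot, htop, hmem, ?_⟩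
  intro y y' hy hy' heq
  -- The shift stays within the segment, so its length can be read off from the slot, and the shift
  -- can be undone.
  have key : ∀ y, HasSlot L (rank y) → Nat.log L (rank (slot y)) = Nat.log L (rank y) := by
    intro y hy
    obtain ⟨h1, h2⟩ := hslot y hy
    by_cases h0 : Nat.log L (rank y) = 0
    · rw [if_pos h0] at h2
      rw [← h2, add_zero]
    · rw [if_neg h0] at h2
      have hlog := log_groupStart hL (hR.pos y)
      have h4 := pow_log_add_groupWidth_le (groupStart_groupStart hL (hR.pos y))
        (one_le_groupStart hL (hR.pos y)) (by rw [hlog]; exact hy.resolve_left h0)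
      rw [groupWidth_groupStart hL (hR.pos y), hlog] at h4
      have h5 : groupStart L (rank y) ≤ rank y := groupStart_le
      refine log_eq_of_mem hL (by omega) ?_
      have := lt_pow_log_succ (r := rank y) hL
      omega
  obtain ⟨h1, h2⟩ := hslot y hy
  obtain ⟨h1', h2'⟩ := hslot y' hy'
  have hlog : Nat.log L (rank y) = Nat.log L (rank y') := by rw [← key y hy, ← key y' hy', heq]
  have hw : groupWidth L (rank y) = groupWidth L (rank y') := by rw [groupWidth, hlog, groupWidth]
  refine hR.inj y y' (by rw [← h1, ← h1', heq]) ?_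
  rw [← h2, ← h2', heq, hlog, hw]

end

/-! ### The cost of prefetching and of delaying items -/

section

variable {ι : Type*} [Fintype ι] {cls size rank p : ι → ℕ} {L H Q : ℕ}

open Classical in
variable (cls rank p L H) in
/-- The items without a slot that is used early enough. -/
noncomputable def prefetched (slot : ι → ι) : Finset ι :=
  Finset.univ.filter fun y => ¬ (HasSlot L (rank y) ∧
    p (slot y) ≤ doneTime cls rank p L H (cls y) (groupStart L (rank y)))

/-- A group with slots loses only those packed after `doneTime`, which are a fraction `1 / H` of the
block by the choice of `doneTime`. A group without slots is the first of its segment, and its block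
is at least `H` times as long as the group. -/
lemma Ranking.card_prefetched_le (hR : Ranking cls size rank) (hL : 2 ≤ L) (hHL : H + 1 ≤ L)
    {slot : ι → ι}
    (hslot : ∀ y, HasSlot L (rank y) →
        slot y ∈ refBlock cls rank L (cls y) (groupStart L (rank y)))
    (hinj : ∀ y y', HasSlot L (rank y) → HasSlot L (rank y') → slot y = slot y' → y = y')
    {G : ℕ × ℕ} (hG : G ∈ rankGroups cls rank L) :
    H * ((prefetched cls rank p L H slot).filter
      fun y => (cls y, groupStart L (rank y)) = G).card ≤ (refBlock cls rank L G.1 G.2).card := by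
  classical
  obtain ⟨y₀, -, rfl⟩ := Finset.mem_image.1 hG
  have hlog := log_groupStart hL (hR.pos y₀)
  have logeq : ∀ y, groupStart L (rank y) = groupStart L (rank y₀) →
      Nat.log L (rank y) = Nat.log L (rank y₀) := fun y h => by
    rw [← hlog, ← h, log_groupStart hL (hR.pos y)]
  by_cases hs : HasSlot L (rank y₀)
  · refine le_trans (Nat.mul_le_mul_left _ ?_) (doneTime_spec (p := p) (H := H) _ _)
    refine Finset.card_le_card_of_injOn slot ?_ ?_
    · intro y hy
      obtain ⟨h1, h2⟩ := Finset.mem_filter.1 (Finset.mem_coe.1 hy)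
      obtain ⟨h3, h4⟩ := Prod.mk.inj h2
      have hsy : HasSlot L (rank y) := by
        unfold HasSlot at hs ⊢
        rwa [h4, logeq y h4]
      have h5 := (Finset.mem_filter.1 h1).2
      rw [not_and, h3, h4] at h5
      refine Finset.mem_coe.2 (Finset.mem_filter.2 ⟨?_, not_le.1 (h5 hsy)⟩)
      have := hslot y hsy
      rwa [h3, h4] at this
    · intro y hy y' hy' h
      obtain ⟨-, h2⟩ := Finset.mem_filter.1 (Finset.mem_coe.1 hy)
      obtain ⟨-, h2'⟩ := Finset.mem_filter.1 (Finset.mem_coe.1 hy')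
      obtain ⟨h3, h4⟩ := Prod.mk.inj h2
      obtain ⟨h3', h4'⟩ := Prod.mk.inj h2'
      refine hinj y y' ?_ ?_ h
      · unfold HasSlot at hs ⊢
        rwa [h4, logeq y h4]
      · unfold HasSlot at hs ⊢
        rwa [h4', logeq y' h4']
  · unfold HasSlot at hs
    push Not at hs
    rw [hR.card_refBlock hL]
    refine le_trans (Nat.mul_le_mul_left _ ?_)
      (mul_groupWidth_le_of_first hHL (by rw [hlog]; exact hs.1) (by rw [hlog]; exact hs.2))
    have hcard : groupWidth L (groupStart L (rank y₀)) = (Finset.Ico (groupStart L (rank y₀))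
        (groupStart L (rank y₀) + groupWidth L (groupStart L (rank y₀)))).card := by simp
    rw [hcard]
    refine Finset.card_le_card_of_injOn rank ?_ ?_
    · intro y hy
      obtain ⟨-, h2⟩ := Finset.mem_filter.1 (Finset.mem_coe.1 hy)
      obtain ⟨h3, h4⟩ := Prod.mk.inj h2
      have h5 : groupStart L (rank y) ≤ rank y := groupStart_le
      have h6 : rank y < groupStart L (rank y) + groupWidth L (rank y) := lt_groupStart_add hL
      rw [← groupWidth_groupStart hL (hR.pos y), h4] at h6
      rw [h4] at h5
      exact Finset.mem_coe.2 (Finset.mem_Ico.2 ⟨h5, h6⟩)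
    · intro y hy y' hy' h
      obtain ⟨-, h2⟩ := Finset.mem_filter.1 (Finset.mem_coe.1 hy)
      obtain ⟨-, h2'⟩ := Finset.mem_filter.1 (Finset.mem_coe.1 hy')
      exact hR.inj y y' ((Prod.mk.inj h2).1.trans (Prod.mk.inj h2').1.symm) h

/-- As `H ≥ 2`, at least half of a reference block is packed by its `doneTime`, and no item of the
block is smaller than the rounded size of the group. So the prefetched items of the group weigh at
most `2 / H` times what `p` packs of the block by time `t`; the overlap of blocks gives another
factor 2. -/
lemma Ranking.prefetched_mass_le (hR : Ranking cls size rank) (hL : 2 ≤ L) (hH : 2 ≤ H)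
    (hHL : H + 1 ≤ L) {top slot : ι → ι}
    (htop : ∀ y, cls (top y) = cls y ∧ rank (top y) = groupStart L (rank y))
    (hslot : ∀ y, HasSlot L (rank y) →
        slot y ∈ refBlock cls rank L (cls y) (groupStart L (rank y)))
    (hinj : ∀ y y', HasSlot L (rank y) → HasSlot L (rank y') → slot y = slot y' → y = y') (t : ℕ) :
    H * ∑ y ∈ prefetched cls rank p L H slot with
        doneTime cls rank p L H (cls y) (groupStart L (rank y)) ≤ t, size (top y) ≤
      4 * ∑ x with p x ≤ t, size x := by
  classical
  -- The rounded size as a function of the group; the supremum is over a constant family, since the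
  -- items of a group share their `top`.
  let g : ℕ × ℕ → ℕ := fun G => if doneTime cls rank p L H G.1 G.2 ≤ t then
    (Finset.univ.filter fun y => (cls y, groupStart L (rank y)) = G).sup (fun y => size (top y))
    else 0
  have hg : ∀ y, doneTime cls rank p L H (cls y) (groupStart L (rank y)) ≤ t →
      g (cls y, groupStart L (rank y)) = size (top y) := by
    intro y hy
    simp only [g]
    rw [if_pos hy]
    refine le_antisymm (Finset.sup_le fun y' hy' => ?_)
      (Finset.le_sup (f := fun y => size (top y)) (Finset.mem_filter.2 ⟨Finset.mem_univ y, rfl⟩))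
    obtain ⟨h1, h2⟩ := Prod.mk.inj (Finset.mem_filter.1 hy').2
    rw [hR.inj (top y') (top y) (by rw [(htop _).1, (htop _).1, h1])
      (by rw [(htop _).2, (htop _).2, h2])]
  rw [Finset.sum_filter, Finset.sum_congr rfl (g := fun y => g (cls y, groupStart L (rank y)))]
  swap
  · intro y _
    split_ifs with h
    · exact (hg y h).symm
    · simp [g, h]
  have key := hR.sum_le_sum_groups hL (g := g) (S := prefetched cls rank p L H slot) (K := H)
    (h := fun x => 2 * if p x ≤ t then size x else 0) ?_
  · rw [← Finset.mul_sum, ← mul_assoc] at key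
    rw [Finset.sum_filter (fun x => p x ≤ t)]
    exact key
  · intro G hG
    have hc := hR.card_prefetched_le (p := p) hL hHL hslot hinj hG
    obtain ⟨y₀, -, rfl⟩ := Finset.mem_image.1 hG
    by_cases ht : doneTime cls rank p L H (cls y₀) (groupStart L (rank y₀)) ≤ t
    swap
    · simp [g, ht]
    rw [hg y₀ ht]
    set R := refBlock cls rank L (cls y₀) (groupStart L (rank y₀)) with hRdef
    refine (Nat.mul_le_mul_right _ hc).trans ?_
    have h1 := doneTime_spec (cls := cls) (rank := rank) (p := p) (L := L) (H := H)
      (cls y₀) (groupStart L (rank y₀))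
    rw [← hRdef] at h1
    have h2 := Finset.card_filter_add_card_filter_not (s := R)
      (doneTime cls rank p L H (cls y₀) (groupStart L (rank y₀)) < p ·)
    have h3 := Nat.mul_le_mul_right
      ((R.filter (doneTime cls rank p L H (cls y₀) (groupStart L (rank y₀)) < p ·)).card) hH
    have h4 : R.card ≤ 2 * (R.filter (fun x =>
        ¬ doneTime cls rank p L H (cls y₀) (groupStart L (rank y₀)) < p x)).card := by omega
    have h5 : (R.filter (fun x =>
        ¬ doneTime cls rank p L H (cls y₀) (groupStart L (rank y₀)) < p x)).card * size (top y₀) ≤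
        ∑ x ∈ R, if p x ≤ t then size x else 0 := by
      rw [← smul_eq_mul, ← Finset.sum_filter]
      refine (Finset.card_nsmul_le_sum _ size _ fun x hx => ?_).trans
        (Finset.sum_le_sum_of_subset fun x hx => ?_)
      · have hx' := (Finset.mem_filter.1 (Finset.mem_filter.1 hx).1).2
        refine hR.antitone x (top y₀) (by rw [(htop _).1, hx'.1]) ?_
        rw [(htop _).2]
        have := hx'.2.2
        unfold refHi at this
        split_ifs at this <;> omega
      · have hx' := Finset.mem_filter.1 hx
        exact Finset.mem_filter.2 ⟨hx'.1, (not_lt.1 hx'.2).trans ht⟩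
    rw [← Finset.mul_sum]
    calc R.card * size (top y₀) ≤ 2 * _ * size (top y₀) := Nat.mul_le_mul_right _ h4
      _ ≤ _ := by rw [mul_assoc]; exact Nat.mul_le_mul_left _ h5

/-- Two factors `1 / H` come together, one from the number of prefetched items and one from their
new time, while Markov's inequality for `doneTime` loses only one factor `H`. The summand 1 is paid
for by `1 ≤ p x`. -/
lemma Ranking.prefetched_cost_le (hR : Ranking cls size rank) (hL : 2 ≤ L) (hH : 1 ≤ H)
    (hHL : H + 1 ≤ L) {slot : ι → ι}
    (hslot : ∀ y, HasSlot L (rank y) →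
        slot y ∈ refBlock cls rank L (cls y) (groupStart L (rank y)))
    (hinj : ∀ y y', HasSlot L (rank y) → HasSlot L (rank y') → slot y = slot y' → y = y')
    (hp : ∀ x, 1 ≤ p x) :
    H * ∑ y ∈ prefetched cls rank p L H slot,
        (doneTime cls rank p L H (cls y) (groupStart L (rank y)) / H + 1) ≤
      4 * ∑ x, p x := by
  have key := hR.sum_le_sum_groups hL (g := fun G => doneTime cls rank p L H G.1 G.2 / H + 1)
    (S := prefetched cls rank p L H slot) (K := H) (h := fun x => 2 * p x) ?_
  · rw [← Finset.mul_sum, ← mul_assoc] at key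
    exact key
  · intro G hG
    refine (Nat.mul_le_mul_right _ (hR.card_prefetched_le hL hHL hslot hinj hG)).trans ?_
    set R := refBlock cls rank L G.1 G.2 with hRdef
    have h1 := card_mul_doneTime_le (cls := cls) (rank := rank) (p := p) (L := L) (H := H) G.1 G.2
    rw [← hRdef] at h1
    have h2 : R.card * (doneTime cls rank p L H G.1 G.2 / H) ≤ ∑ x ∈ R, p x := by
      refine Nat.le_of_mul_le_mul_left (le_trans ?_ h1) hH
      have := Nat.mul_le_mul_left R.card (Nat.mul_div_le (doneTime cls rank p L H G.1 G.2) H)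
      calc _ = R.card * (H * (doneTime cls rank p L H G.1 G.2 / H)) := by ring
        _ ≤ _ := this
    have h3 : R.card ≤ ∑ x ∈ R, p x := by
      rw [Finset.card_eq_sum_ones]
      exact Finset.sum_le_sum fun x _ => hp x
    rw [← Finset.mul_sum, Nat.mul_add, mul_one]
    omega

/-- By `2 * Q ≤ L` the terms at least double with `i`, so the sum is at most twice its last term. -/
lemma sum_pow_mul_pow_le (hLQ : 2 * Q ≤ L) (m : ℕ) :
    ∑ i ∈ Finset.range m, L ^ (i + 2) * Q ^ (m + 2 - i) ≤ 2 * Q ^ 3 * L ^ (m + 1) := by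
  induction m with
  | zero => simp
  | succ m ih =>
    have h1 : ∑ i ∈ Finset.range m, L ^ (i + 2) * Q ^ (m + 1 + 2 - i) =
        Q * ∑ i ∈ Finset.range m, L ^ (i + 2) * Q ^ (m + 2 - i) := by
      rw [Finset.mul_sum]
      refine Finset.sum_congr rfl fun i hi => ?_
      have : m + 1 + 2 - i = m + 2 - i + 1 := by have := Finset.mem_range.1 hi; omega
      rw [this, pow_succ]
      ring
    have h2 : m + 1 + 2 - m = 3 := by omega
    rw [Finset.sum_range_succ, h1, h2]
    have h3 := Nat.mul_le_mul_left Q ih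
    have h4 := Nat.mul_le_mul_right (Q ^ 3 * L ^ (m + 1)) hLQ
    calc _ ≤ Q * (2 * Q ^ 3 * L ^ (m + 1)) + L ^ (m + 2) * Q ^ 3 := Nat.add_le_add_right h3 _
      _ = 2 * Q * (Q ^ 3 * L ^ (m + 1)) + L ^ (m + 2) * Q ^ 3 := by ring
      _ ≤ L * (Q ^ 3 * L ^ (m + 1)) + L ^ (m + 2) * Q ^ 3 := Nat.add_le_add_right h4 _
      _ = _ := by ring

/-- Markov's inequality for the group that attains the maximum: its block has at least `L ^ (m - 1)`
items, all from the segments `m` and `m - 1`. -/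
lemma Ranking.pow_mul_segmentDone_le (hR : Ranking cls size rank) (hL : 2 ≤ L) (c m : ℕ) :
    L ^ (m - 1) * segmentDone cls rank p L H c m ≤
      H * ∑ x with cls x = c ∧ (Nat.log L (rank x) = m ∨ Nat.log L (rank x) + 1 = m), p x := by
  rcases (Finset.univ.filter fun y => cls y = c ∧ Nat.log L (rank y) = m).eq_empty_or_nonempty
    with h | h
  · simp [segmentDone, h]
  · obtain ⟨y, hy, hmax⟩ := Finset.exists_mem_eq_sup _ h fun y =>
      doneTime cls rank p L H c (groupStart L (rank y))
    obtain ⟨-, rfl, rfl⟩ := Finset.mem_filter.1 hy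
    have hlog := log_groupStart hL (hR.pos y)
    have ha := groupStart_groupStart hL (hR.pos y)
    have ha1 := one_le_groupStart hL (hR.pos y)
    rw [segmentDone, hmax]
    have h1 := pow_le_refHi_sub_refLo hL ha ha1
    rw [hlog] at h1
    have h2 : L ^ (Nat.log L (rank y) - 1) ≤
        (refBlock cls rank L (cls y) (groupStart L (rank y))).card := by
      rw [hR.card_refBlock hL]; omega
    refine (Nat.mul_le_mul_right _ h2).trans ((card_mul_doneTime_le _ _).trans
      (Nat.mul_le_mul_left _ (Finset.sum_le_sum_of_subset fun x hx => ?_)))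
    obtain ⟨-, h3, h4, h5⟩ := Finset.mem_filter.1 hx
    have := log_of_mem_ref hL ha ha1 h4 h5
    rw [hlog] at this
    exact Finset.mem_filter.2 ⟨Finset.mem_univ _, h3, this⟩

lemma Ranking.card_segment_le (hR : Ranking cls size rank) (hL : 2 ≤ L) (c m : ℕ) :
    (Finset.univ.filter fun y => cls y = c ∧ Nat.log L (rank y) = m).card ≤ L ^ (m + 1) := by
  rw [← Finset.card_range (L ^ (m + 1))]
  refine Finset.card_le_card_of_injOn rank ?_ ?_
  · intro y hy
    obtain ⟨-, -, rfl⟩ := Finset.mem_filter.1 (Finset.mem_coe.1 hy)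
    exact Finset.mem_coe.2 (Finset.mem_range.2 (lt_pow_log_succ hL))
  · intro y hy y' hy' h
    obtain ⟨-, h1, -⟩ := Finset.mem_filter.1 (Finset.mem_coe.1 hy)
    obtain ⟨-, h2, -⟩ := Finset.mem_filter.1 (Finset.mem_coe.1 hy')
    exact hR.inj y y' (h1.trans h2.symm) h

/-- At most `L ^ (m + 1)` items of segment `m` wait for segment `m'`, whose completion time is paid
for by at least `L ^ (m' - 1)` items. With a gap of three segments this wins a factor `L`, and the
sum over `m` is geometric. The constant 4 consists of a factor 2 from that sum and a factor 2
because an item pays for two segments. -/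
lemma Ranking.delay_cost_le (hR : Ranking cls size rank) (hL : 2 ≤ L) (hLQ : 2 * Q ≤ L) :
    L * ∑ y, segmentStart cls rank p L H Q (cls y) (Nat.log L (rank y)) ≤
      4 * Q ^ 3 * H * ∑ x, p x := by
  classical
  set N := segmentBound rank with hN
  set E : ℕ → ℕ → ℕ := segmentDone cls rank p L H with hE
  set S : ℕ → ℕ → ℕ := segmentStart cls rank p L H Q with hS
  set I := Finset.univ.image cls with hI
  have h1 : ∑ y, S (cls y) (Nat.log L (rank y)) ≤
      ∑ c ∈ I, ∑ m ∈ Finset.range N, L ^ (m + 1) * S c m := by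
    rw [← Finset.sum_product', ← Finset.sum_fiberwise_of_maps_to
      (t := I ×ˢ Finset.range N) (g := fun y => (cls y, Nat.log L (rank y)))
      (fun y _ => Finset.mem_product.2 ⟨Finset.mem_image_of_mem _ (Finset.mem_univ y),
        Finset.mem_range.2 (log_lt_segmentBound y)⟩)]
    refine Finset.sum_le_sum fun G _ => ?_
    rw [Finset.sum_congr rfl (g := fun _ => S G.1 G.2)
      (fun y hy => by rw [← (Finset.mem_filter.1 hy).2]), Finset.sum_const, smul_eq_mul]
    refine Nat.mul_le_mul_right _ (le_trans (Finset.card_le_card fun y hy => ?_)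
      (hR.card_segment_le hL G.1 G.2))
    have := (Finset.mem_filter.1 hy).2
    exact Finset.mem_filter.2 ⟨Finset.mem_univ _, by rw [← this], by rw [← this]⟩
  -- Exchange the sums: for a fixed `m'`, collect the delays that it causes in all segments `m ≤ m'
  -- - 3`.
  have h2 : ∀ c, L * ∑ m ∈ Finset.range N, L ^ (m + 1) * S c m ≤
      ∑ m' ∈ Finset.range N, 2 * Q ^ 3 * (L ^ (m' - 1) * E c m') := by
    intro c
    have h3 : L * ∑ m ∈ Finset.range N, L ^ (m + 1) * S c m =
        ∑ m ∈ Finset.range N, ∑ m' ∈ Finset.range N,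
          if m + 3 ≤ m' then L ^ (m + 2) * Q ^ (m' - m) * E c m' else 0 := by
      rw [Finset.mul_sum]
      refine Finset.sum_congr rfl fun m _ => ?_
      rw [← Finset.sum_filter]
      have : (Finset.range N).filter (fun m' => m + 3 ≤ m') = Finset.Ico (m + 3) N := by
        ext m'; simp; omega
      rw [this, hS, segmentStart, Finset.mul_sum, Finset.mul_sum]
      exact Finset.sum_congr rfl fun m' _ => by ring
    rw [h3, Finset.sum_comm]
    refine Finset.sum_le_sum fun m' hm' => ?_
    rw [← Finset.sum_filter]
    have h4 : (Finset.range N).filter (fun m => m + 3 ≤ m') = Finset.range (m' - 2) := by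
      have := Finset.mem_range.1 hm'
      ext m; simp; omega
    rw [h4, ← Finset.sum_mul, ← mul_assoc]
    refine Nat.mul_le_mul_right _ ?_
    rcases Nat.lt_or_ge m' 2 with h5 | h5
    · have : m' - 2 = 0 := by omega
      simp [this]
    · have := sum_pow_mul_pow_le hLQ (m' - 2)
      rwa [show m' - 2 + 1 = m' - 1 by omega, show m' - 2 + 2 = m' by omega] at this
  have h3 : ∑ c ∈ I, ∑ m ∈ Finset.range N, L ^ (m - 1) * E c m ≤ 2 * H * ∑ x, p x := by
    calc _ ≤ ∑ c ∈ I, ∑ m ∈ Finset.range N, H * ∑ x with cls x = c ∧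
          (Nat.log L (rank x) = m ∨ Nat.log L (rank x) + 1 = m), p x :=
        Finset.sum_le_sum fun c _ => Finset.sum_le_sum fun m _ => hR.pow_mul_segmentDone_le hL c m
      _ = H * ∑ x, ((I ×ˢ Finset.range N).filter fun G => cls x = G.1 ∧
          (Nat.log L (rank x) = G.2 ∨ Nat.log L (rank x) + 1 = G.2)).card * p x := by
        rw [← Finset.sum_product' (f := fun c m => H * ∑ x with cls x = c ∧
          (Nat.log L (rank x) = m ∨ Nat.log L (rank x) + 1 = m), p x), ← Finset.mul_sum]
        simp only [Finset.sum_filter]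
        rw [Finset.sum_comm]
        refine congrArg _ (Finset.sum_congr rfl fun x _ => ?_)
        rw [← Finset.sum_filter, Finset.sum_const, smul_eq_mul]
      _ ≤ H * ∑ x, 2 * p x := by
        refine Nat.mul_le_mul_left _ (Finset.sum_le_sum fun x _ => Nat.mul_le_mul_right _
          (le_trans (Finset.card_le_card (t := {(cls x, Nat.log L (rank x)),
            (cls x, Nat.log L (rank x) + 1)}) ?_) Finset.card_le_two))
        rintro ⟨c, m⟩ hG
        obtain ⟨-, h4, h5⟩ := Finset.mem_filter.1 hG
        dsimp only at h4 h5
        rw [h4]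
        rcases h5 with rfl | rfl <;> simp
      _ = _ := by rw [← Finset.mul_sum]; ring
  calc L * ∑ y, S (cls y) (Nat.log L (rank y))
      ≤ L * ∑ c ∈ I, ∑ m ∈ Finset.range N, L ^ (m + 1) * S c m := Nat.mul_le_mul_left _ h1
    _ = ∑ c ∈ I, L * ∑ m ∈ Finset.range N, L ^ (m + 1) * S c m := Finset.mul_sum _ _ _
    _ ≤ ∑ c ∈ I, ∑ m' ∈ Finset.range N, 2 * Q ^ 3 * (L ^ (m' - 1) * E c m') :=
      Finset.sum_le_sum fun c _ => h2 c
    _ = 2 * Q ^ 3 * ∑ c ∈ I, ∑ m ∈ Finset.range N, L ^ (m - 1) * E c m := by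
      simp only [Finset.mul_sum]
    _ ≤ 2 * Q ^ 3 * (2 * H * ∑ x, p x) := Nat.mul_le_mul_left _ h3
    _ = _ := by ring

end

/-! ### Assembling the windowed packing -/

section

variable {ι : Type*} [Fintype ι] {cls size rank p : ι → ℕ} {L H Q : ℕ}

lemma sum_le_mul_of_bins {C : ℕ} (hp : ∀ x, 1 ≤ p x) (hC : ∀ b, ∑ x with p x = b, size x ≤ C)
    (t : ℕ) : ∑ x with p x ≤ t, size x ≤ C * t := by
  rw [← Finset.sum_fiberwise_of_maps_to (s := Finset.univ.filter (p · ≤ t)) (t := Finset.Icc 1 t)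
    (g := p) (fun x hx => Finset.mem_Icc.2 ⟨hp x, (Finset.mem_filter.1 hx).2⟩)]
  refine (Finset.sum_le_card_nsmul _ _ C fun b _ => ?_).trans (le_of_eq ?_)
  · refine le_trans (Finset.sum_le_sum_of_subset fun x hx => ?_) (hC b)
    exact Finset.mem_filter.2 ⟨Finset.mem_univ _, (Finset.mem_filter.1 hx).2⟩
  · simp [mul_comm]

/-- The weights `Q ^ (m' - m)` in `segmentStart` are made for this: a loss of a factor `Q` in a
segment at least three higher is absorbed by the start of the lower segment. -/
lemma Ranking.segmentDone_le_segmentStart (hQ : 1 ≤ Q) {y x : ι} (hc : cls x = cls y)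
    (hseg : Nat.log L (rank y) + 3 ≤ Nat.log L (rank x)) :
    Q * doneTime cls rank p L H (cls x) (groupStart L (rank x)) ≤
        segmentStart cls rank p L H Q (cls y) (Nat.log L (rank y)) ∧
      Q * segmentStart cls rank p L H Q (cls x) (Nat.log L (rank x)) ≤
        segmentStart cls rank p L H Q (cls y) (Nat.log L (rank y)) := by
  set m := Nat.log L (rank y)
  set m' := Nat.log L (rank x) with hm'
  constructor
  · have h1 : doneTime cls rank p L H (cls x) (groupStart L (rank x)) ≤
        segmentDone cls rank p L H (cls x) m' :=
      Finset.le_sup (f := fun y => doneTime cls rank p L H (cls x) (groupStart L (rank y)))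
        (Finset.mem_filter.2 ⟨Finset.mem_univ x, rfl, rfl⟩)
    have h2 : Q ^ (m' - m) * segmentDone cls rank p L H (cls y) m' ≤
        segmentStart cls rank p L H Q (cls y) m :=
      Finset.single_le_sum (f := fun m' => Q ^ (m' - m) * segmentDone cls rank p L H (cls y) m')
        (fun _ _ => Nat.zero_le _) (Finset.mem_Ico.2 ⟨hseg, log_lt_segmentBound x⟩)
    refine le_trans ?_ h2
    rw [← hc]
    exact Nat.mul_le_mul (Nat.le_self_pow (by omega) Q) h1
  · rw [segmentStart, segmentStart, Finset.mul_sum, hc]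
    refine le_trans (Finset.sum_le_sum fun m'' hm'' => ?_) (Finset.sum_le_sum_of_subset
      (Finset.Ico_subset_Ico_left (by omega : m + 3 ≤ m' + 3)))
    rw [← mul_assoc, ← pow_succ']
    have := (Finset.mem_Ico.1 hm'').1
    exact Nat.mul_le_mul_right _ (Nat.pow_le_pow_right hQ (by omega))

/-- Every packing can be turned into one that is at most slightly more expensive, that stays
feasible when sizes are rounded up within the groups, and in which, for every class, an item of a
segment is not packed before the items of the segments that are at least 3 higher. -/
theorem Ranking.exists_windowed (hR : Ranking cls size rank) {D C : ℕ} (hD : 1 ≤ D)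
    (hQ : Q = 11 * (D + 1)) (hLQ : 2 * Q ≤ L) (hH : 2 ≤ H) (hHL : H + 1 ≤ L)
    (hp : ∀ x, 1 ≤ p x) (hC : ∀ b, ∑ x with p x = b, size x ≤ C) :
    ∃ p' w : ι → ℕ, (∀ y, D ≤ p' y ∨ ∃ x, cls x = cls y ∧ p x ≤ p' y) ∧ (∀ y, 1 ≤ p' y) ∧
      (∀ y, size y ≤ w y) ∧
      (∀ y y', cls y = cls y' → groupStart L (rank y) = groupStart L (rank y') → w y = w y') ∧
      (∀ b, ∑ y with p' y = b, w y ≤ C) ∧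
      (∀ x y, cls x = cls y → Nat.log L (rank y) + 3 ≤ Nat.log L (rank x) → p' x ≤ p' y) ∧
      ((∑ y, p' y : ℕ) : ℝ) ≤
        (1 + 1 / D + 4 * Q / H + 4 * Q ^ 4 * H / L) * ((∑ y, p y : ℕ) : ℝ) := by
  classical
  have hL : 2 ≤ L := by omega
  obtain ⟨top, slot, htop, hslot, hinj⟩ := hR.exists_slot hL
  set e : ι → ℕ := fun y => doneTime cls rank p L H (cls y) (groupStart L (rank y)) with he
  set s : ι → ℕ := fun y => segmentStart cls rank p L H Q (cls y) (Nat.log L (rank y)) with hs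
  set early : ι → Prop := fun y => HasSlot L (rank y) ∧ p (slot y) ≤ e y with hearly
  set kept : ι → Prop := fun y => early y ∧ s y ≤ p (slot y) with hkept
  set key : ι → ℕ := fun y => if early y then s y else max (s y) (e y / H + 1) with hkey
  set Z : Finset ι := Finset.univ.filter fun y => ¬ kept y with hZ
  set w : ι → ℕ := fun y => size (top y) with hw
  have slotcls : ∀ y, HasSlot L (rank y) → cls (slot y) = cls y := fun y hy =>
    ((Finset.mem_filter.1 (hslot y hy)).2).1
  have wslot : ∀ y, HasSlot L (rank y) → w y ≤ size (slot y) := by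
    intro y hy
    have hx' := (Finset.mem_filter.1 (hslot y hy)).2
    refine hR.antitone _ _ (by rw [(htop _).1, hx'.1]) ?_
    rw [(htop _).2]
    have := hx'.2.2
    unfold refHi at this
    split_ifs at this <;> omega
  have wC : ∀ y, w y ≤ C := by
    intro y
    refine le_trans ?_ (hC (p (top y)))
    exact Finset.single_le_sum (f := size) (fun _ _ => Nat.zero_le _)
      (Finset.mem_filter.2 ⟨Finset.mem_univ (top y), rfl⟩)
  have slotsum : ∀ (S : Finset ι) (P : ι → Prop) [DecidablePred P], (∀ y ∈ S, HasSlot L (rank y) ∧ P (slot y)) →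
      ∑ y ∈ S, w y ≤ ∑ x with P x, size x := by
    intro S P _ hS
    calc ∑ y ∈ S, w y ≤ ∑ y ∈ S, size (slot y) := Finset.sum_le_sum fun y hy => wslot y (hS y hy).1
      _ = ∑ x ∈ S.image slot, size x := (Finset.sum_image fun y hy y' hy' h =>
          hinj y y' (hS y hy).1 (hS y' hy').1 h).symm
      _ ≤ _ := Finset.sum_le_sum_of_subset fun x hx => by
          obtain ⟨y, hy, rfl⟩ := Finset.mem_image.1 hx
          exact Finset.mem_filter.2 ⟨Finset.mem_univ _, (hS y hy).2⟩
  have keypos : ∀ y ∈ Z, 1 ≤ key y := by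
    intro y hy
    have hny := (Finset.mem_filter.1 hy).2
    simp only [hkey]
    split_ifs with h
    · have : ¬ s y ≤ p (slot y) := fun h' => hny ⟨h, h'⟩
      omega
    · exact le_max_of_le_right (Nat.le_add_left 1 _)
  -- The factor 5 is 1 + 4. Delayed items have distinct slots which `p` packs before time `t`;
  -- prefetched items are bounded by `Ranking.prefetched_mass_le` at the time `H * t`.
  have hmass : ∀ t, ∑ y ∈ Z with key y ≤ t, w y ≤ 5 * C * t := by
    intro t
    have hA : ∑ y ∈ (Z.filter (key · ≤ t)).filter early, w y ≤ C * t := by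
      refine le_trans (slotsum _ (fun x => p x ≤ t) fun y hy => ?_) (sum_le_mul_of_bins hp hC t)
      obtain ⟨h1, h2⟩ := Finset.mem_filter.1 hy
      obtain ⟨h3, h4⟩ := Finset.mem_filter.1 h1
      have hny := (Finset.mem_filter.1 h3).2
      have : ¬ s y ≤ p (slot y) := fun h' => hny ⟨h2, h'⟩
      simp only [hkey, if_pos h2] at h4
      exact ⟨h2.1, by omega⟩
    have hB : ∑ y ∈ (Z.filter (key · ≤ t)).filter (fun y => ¬ early y), w y ≤ 4 * C * t := by
      have h1 := hR.prefetched_mass_le (p := p) hL hH hHL htop hslot hinj (H * t)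
      have h2 := sum_le_mul_of_bins hp hC (H * t)
      have hH0 : 0 < H := by omega
      refine le_of_mul_le_mul_left ?_ hH0
      refine le_trans (Nat.mul_le_mul_left H (Finset.sum_le_sum_of_subset fun y hy => ?_))
        (h1.trans ((Nat.mul_le_mul_left 4 h2).trans (le_of_eq (by ring))))
      obtain ⟨h1, h2⟩ := Finset.mem_filter.1 hy
      have h4 := (Finset.mem_filter.1 h1).2
      simp only [hkey, if_neg h2] at h4
      refine Finset.mem_filter.2 ⟨Finset.mem_filter.2 ⟨Finset.mem_univ _, h2⟩, ?_⟩
      have h5 : e y / H < t := by omega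
      have := (Nat.div_lt_iff_lt_mul (by omega)).1 h5
      rw [mul_comm]
      exact this.le
    calc _ = _ := (Finset.sum_filter_add_sum_filter_not _ early _).symm
      _ ≤ C * t + 4 * C * t := add_le_add (by convert hA) (by convert hB)
      _ = _ := by ring
  obtain ⟨q, hq, hqC⟩ := exists_nextFit w key C Z (fun z _ => wC z) hmass
  -- Kept items go to the regular bin of their slot, all others to spare bins.
  set p' : ι → ℕ := fun y => if kept y then regularBin D (p (slot y)) else (D + 1) * q y with hp'
  have hp'k : ∀ y, kept y → p' y = regularBin D (p (slot y)) := fun y h => if_pos h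
  have hp'n : ∀ y, ¬ kept y → p' y = (D + 1) * q y := fun y h => if_neg h
  have memZ : ∀ y, ¬ kept y → y ∈ Z := fun y h => Finset.mem_filter.2 ⟨Finset.mem_univ _, h⟩
  have big : ∀ y, ¬ kept y → D + 1 ≤ p' y := by
    intro y h
    have h1 := (hq y (memZ y h)).1
    have h2 := keypos y (memZ y h)
    rw [hp'n y h]
    exact Nat.le_mul_of_pos_right _ (by omega)
  -- The origin of `Q = 11 * (D + 1)`: next-fit loses a factor 11, the sparse spare bins a factor `D
  -- + 1`.
  have upper : ∀ y, ¬ kept y → p' y ≤ Q * key y := by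
    intro y h
    have h1 := (hq y (memZ y h)).2
    rw [hp'n y h, hQ]
    calc (D + 1) * q y ≤ (D + 1) * (11 * key y) := Nat.mul_le_mul_left _ h1
      _ = _ := by ring
  have lower : ∀ y, s y ≤ p' y := by
    intro y
    by_cases h : kept y
    · rw [hp'k y h]
      exact h.2.trans (le_regularBin _ _)
    · have h1 := (hq y (memZ y h)).1
      have h2 : s y ≤ key y := by
        simp only [hkey]
        split_ifs <;> omega
      rw [hp'n y h]
      exact h2.trans (h1.trans (Nat.le_mul_of_pos_left _ (by omega)))
  refine ⟨p', w, ?_, ?_, ?_, ?_, ?_, ?_, ?_⟩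
  · intro y
    by_cases h : kept y
    · exact Or.inr ⟨slot y, slotcls y h.1.1, by rw [hp'k y h]; exact le_regularBin _ _⟩
    · exact Or.inl (by have := big y h; omega)
  · intro y
    by_cases h : kept y
    · rw [hp'k y h]
      exact (hp _).trans (le_regularBin _ _)
    · have := big y h; omega
  · intro y
    refine hR.antitone _ _ (htop y).1 ?_
    rw [(htop y).2]
    exact groupStart_le
  · intro y y' h h'
    have : top y = top y' := hR.inj _ _ (by rw [(htop _).1, (htop _).1, h])
      (by rw [(htop _).2, (htop _).2, h'])
    simp only [hw, this]
  · intro b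
    by_cases hb : D + 1 ∣ b
    · obtain ⟨b, rfl⟩ := hb
      refine le_trans (Finset.sum_le_sum_of_subset fun y hy => ?_) (hqC b)
      have hy' := (Finset.mem_filter.1 hy).2
      have hk : ¬ kept y := fun h => by
        rw [hp'k y h] at hy'
        exact regularBin_mod hD (hp (slot y)) ⟨b, hy'⟩
      rw [hp'n y hk] at hy'
      exact Finset.mem_filter.2 ⟨memZ y hk, Nat.eq_of_mul_eq_mul_left (by omega) hy'⟩
    · rcases (Finset.univ.filter fun y => p' y = b).eq_empty_or_nonempty with h0 | ⟨y₀, hy₀⟩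
      · simp [h0]
      · have hk : ∀ y, p' y = b → kept y := fun y hy => by
          by_contra hk
          rw [hp'n y hk] at hy
          exact hb ⟨_, hy.symm⟩
        have hy₀' := (Finset.mem_filter.1 hy₀).2
        refine (slotsum _ (fun x => p x = p (slot y₀)) fun y hy => ?_).trans (hC _)
        have hy' := (Finset.mem_filter.1 hy).2
        refine ⟨(hk y hy').1.1, (regularBin_strictMono D).injective ?_⟩
        rw [← hp'k y (hk y hy'), ← hp'k y₀ (hk y₀ hy₀'), hy', hy₀']
  -- An item `x` is packed by `Q * max (e x) (s x)`, which the start of a segment three lower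
  -- dominates.
  · intro x y hc hseg
    refine le_trans ?_ (lower y)
    obtain ⟨h1, h2⟩ := Ranking.segmentDone_le_segmentStart (cls := cls) (rank := rank) (p := p)
      (L := L) (H := H) (Q := Q) (by omega) hc hseg
    by_cases h : kept x
    · rw [hp'k x h]
      refine (regularBin_le_two_mul _ _).trans (le_trans ?_ h1)
      exact Nat.mul_le_mul (by omega) h.1.2
    · refine (upper x h).trans ?_
      simp only [hkey]
      -- At time 0 nothing is packed; the block is not empty and `H ≥ 2`, so time 0 does not
      -- qualify.
      have he1 : 1 ≤ e x := by
        by_contra hc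
        have h0 : e x = 0 := by omega
        have h3 := doneTime_spec (cls := cls) (rank := rank) (p := p) (L := L) (H := H)
          (cls x) (groupStart L (rank x))
        simp only [he] at h0
        rw [h0, Finset.filter_true_of_mem (fun z _ => by have := hp z; omega)] at h3
        have h4 := hR.card_refBlock hL x
        have h5 := pow_le_refHi_sub_refLo hL (groupStart_groupStart hL (hR.pos x))
          (one_le_groupStart hL (hR.pos x))
        have h6 := Nat.one_le_pow (Nat.log L (groupStart L (rank x)) - 1) L (by omega)
        have h7 := Nat.mul_le_mul_right
          (refBlock cls rank L (cls x) (groupStart L (rank x))).card hH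
        omega
      have he2 : e x / H + 1 ≤ e x := by
        rcases Nat.lt_or_ge (e x) 2 with h3 | h3
        · rw [Nat.div_eq_of_lt (by omega)]; omega
        · have := Nat.div_le_div_left hH (by omega) (a := e x)
          omega
      split_ifs with h3
      · exact h2
      · rw [← Nat.mul_max_mul_left]
        exact max_le h2 ((Nat.mul_le_mul_left Q he2).trans h1)
  -- The three contributions are those of regular bins, delays and prefetching.
  · have hcost : ∀ y, p' y ≤ (if kept y then regularBin D (p (slot y)) else 0) + Q * s y +
        (if early y then 0 else Q * (e y / H + 1)) := by
      intro y
      by_cases h : kept y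
      · rw [hp'k y h, if_pos h]; omega
      · refine (upper y h).trans ?_
        rw [if_neg h]
        simp only [hkey]
        split_ifs
        · omega
        · rw [← Nat.mul_max_mul_left]; omega
    have h1 : D * ∑ y, (if kept y then regularBin D (p (slot y)) else 0) ≤ (D + 1) * ∑ x, p x := by
      rw [← Finset.sum_filter, Finset.mul_sum, Finset.mul_sum]
      calc _ ≤ ∑ y with kept y, (D + 1) * p (slot y) :=
            Finset.sum_le_sum fun y _ => mul_regularBin_le D _
        _ = ∑ x ∈ (Finset.univ.filter kept).image slot, (D + 1) * p x := by
            refine (Finset.sum_image (f := fun x => (D + 1) * p x) fun y hy y' hy' h => ?_).symm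
            exact hinj y y' (Finset.mem_filter.1 hy).2.1.1 (Finset.mem_filter.1 hy').2.1.1 h
        _ ≤ _ := Finset.sum_le_sum_of_subset (Finset.subset_univ _)
    have h2 : L * ∑ y, s y ≤ 4 * Q ^ 3 * H * ∑ x, p x := hR.delay_cost_le hL hLQ
    have h3 : H * ∑ y, (if early y then 0 else (e y / H + 1)) ≤ 4 * ∑ x, p x := by
      refine le_trans (le_of_eq ?_) (hR.prefetched_cost_le hL (by omega) hHL hslot hinj hp)
      rw [prefetched, Finset.sum_filter]
      congr 1
      refine Finset.sum_congr rfl fun y _ => ?_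
      by_cases h : early y
      · rw [if_pos h, if_neg (not_not.2 h)]
      · rw [if_neg h, if_pos h]
    have h4 : ∑ y, p' y ≤ ∑ y, (if kept y then regularBin D (p (slot y)) else 0) +
        Q * ∑ y, s y + Q * ∑ y, (if early y then 0 else (e y / H + 1)) := by
      rw [Finset.mul_sum, Finset.mul_sum, ← Finset.sum_add_distrib, ← Finset.sum_add_distrib]
      refine Finset.sum_le_sum fun y _ => (hcost y).trans (le_of_eq ?_)
      split_ifs <;> simp
    generalize ∑ y, (if kept y then regularBin D (p (slot y)) else 0) = A at h1 h4
    generalize ∑ y, s y = S at h2 h4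
    generalize ∑ y, (if early y then 0 else (e y / H + 1)) = E at h3 h4
    generalize ∑ y, p' y = P' at h4 ⊢
    generalize ∑ x, p x = P at h1 h2 h3 ⊢
    have hD' : (0 : ℝ) < D := by exact_mod_cast hD
    have hH' : (0 : ℝ) < H := by exact_mod_cast (by omega : 0 < H)
    have hL' : (0 : ℝ) < L := by exact_mod_cast (by omega : 0 < L)
    have hQ' : (0 : ℝ) ≤ Q := Nat.cast_nonneg Q
    have i1 : (A : ℝ) ≤ (1 + 1 / D) * P := by
      have : (D : ℝ) * A ≤ (D + 1) * P := by exact_mod_cast h1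
      rw [← mul_le_mul_iff_of_pos_left hD']
      refine this.trans (le_of_eq ?_)
      field_simp
    have i2 : (S : ℝ) ≤ 4 * Q ^ 3 * H / L * P := by
      have : (L : ℝ) * S ≤ 4 * Q ^ 3 * H * P := by exact_mod_cast h2
      rw [← mul_le_mul_iff_of_pos_left hL']
      refine this.trans (le_of_eq ?_)
      field_simp
    have i3 : (E : ℝ) ≤ 4 / H * P := by
      have : (H : ℝ) * E ≤ 4 * P := by exact_mod_cast h3
      rw [← mul_le_mul_iff_of_pos_left hH']
      refine this.trans (le_of_eq ?_)
      field_simp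
    have i4 : (P' : ℝ) ≤ A + Q * S + Q * E := by exact_mod_cast h4
    have j2 := mul_le_mul_of_nonneg_left i2 hQ'
    have j3 := mul_le_mul_of_nonneg_left i3 hQ'
    calc (P' : ℝ) ≤ (1 + 1 / D) * P + Q * (4 * Q ^ 3 * H / L * P) + Q * (4 / H * P) := by linarith
      _ = _ := by ring

end

/-! ### Sets of packed items as initial pieces of the groups -/

section

variable {ι : Type*} [Fintype ι] {cls size rank p : ι → ℕ} {L : ℕ}

/-- The position of a rank in its group. -/
def groupPos (L r : ℕ) : ℕ := r % groupWidth L r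

/-- The number of a group in its segment. -/
def groupDigit (L r : ℕ) : ℕ := r / groupWidth L r

lemma groupStart_add_groupPos (L r : ℕ) : groupStart L r + groupPos L r = r := by
  rw [groupStart, groupPos, mul_comm]
  exact Nat.div_add_mod _ _

lemma groupDigit_lt (hL : 2 ≤ L) (r : ℕ) : groupDigit L r < L ^ 2 := by
  rw [groupDigit, Nat.div_lt_iff_lt_mul (groupWidth_pos hL), groupWidth, ← pow_add]
  exact (lt_pow_log_succ hL).trans_le (Nat.pow_le_pow_right (by omega) (by omega))

lemma groupStart_eq_iff (hL : 2 ≤ L) {r s : ℕ} (hr : 1 ≤ r) (hs : 1 ≤ s) :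
    groupStart L r = groupStart L s ↔ Nat.log L r = Nat.log L s ∧ groupDigit L r = groupDigit L s := by
  constructor
  · intro h
    have h1 : Nat.log L r = Nat.log L s := by rw [← log_groupStart hL hr, h, log_groupStart hL hs]
    have hw : groupWidth L r = groupWidth L s := by rw [groupWidth, h1, groupWidth]
    refine ⟨h1, ?_⟩
    rw [groupStart, groupStart, hw] at h
    rw [groupDigit, groupDigit, hw]
    exact Nat.eq_of_mul_eq_mul_right (groupWidth_pos hL) h
  · rintro ⟨h1, h2⟩
    have hw : groupWidth L r = groupWidth L s := by rw [groupWidth, h1, groupWidth]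
    rw [groupDigit, groupDigit, hw] at h2
    rw [groupStart, groupStart, hw, h2]

variable (cls rank L) in
/-- The group of an item. -/
def groupKey (y : ι) : ℕ × ℕ := (cls y, groupStart L (rank y))

variable (cls rank L p) in
/-- The number of items of a group that are packed by time `b`. -/
def groupCount (b : ℕ) (G : ℕ × ℕ) : ℕ :=
  (Finset.univ.filter fun y => groupKey cls rank L y = G ∧ p y ≤ b).card

variable (cls rank L p) in
/-- The first items of every group, as many as are packed by time `b`. -/
def placed (b : ℕ) : Finset ι :=
  Finset.univ.filter fun y => groupPos L (rank y) < groupCount cls rank p L b (groupKey cls rank L y)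

/-- As ranks have no gaps, the positions present in a group form an initial segment, even in an
incomplete last group. -/
lemma Ranking.card_groupPos_lt (hR : Ranking cls size rank) (hL : 2 ≤ L) (G : ℕ × ℕ) {c : ℕ}
    (hc : c ≤ (Finset.univ.filter fun y => groupKey cls rank L y = G).card) :
    (Finset.univ.filter fun y => groupKey cls rank L y = G ∧ groupPos L (rank y) < c).card = c := by
  classical
  have hinj : Set.InjOn (fun y => groupPos L (rank y)) {y : ι | groupKey cls rank L y = G} := by
    rintro y rfl y' (hy' : _ = _) h
    obtain ⟨h1, h2⟩ := Prod.mk.inj hy'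
    refine hR.inj y y' h1.symm ?_
    rw [← groupStart_add_groupPos L (rank y), ← groupStart_add_groupPos L (rank y'), h2]
    exact congrArg _ h
  conv_rhs => rw [← Finset.card_range c]
  refine Finset.card_bij (fun y _ => groupPos L (rank y))
    (fun y hy => Finset.mem_range.2 (Finset.mem_filter.1 hy).2.2)
    (fun y hy y' hy' h => hinj (Finset.mem_filter.1 hy).2.1 (Finset.mem_filter.1 hy').2.1 h) ?_
  intro i hi
  have hic := Finset.mem_range.1 hi
  obtain ⟨y, hy, hyi⟩ : ∃ y, groupKey cls rank L y = G ∧ i ≤ groupPos L (rank y) := by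
    by_contra hcon
    push Not at hcon
    have := Finset.card_le_card_of_injOn (s := Finset.univ.filter fun y => groupKey cls rank L y = G)
      (t := Finset.range i) (fun y => groupPos L (rank y))
      (fun y hy => Finset.mem_coe.2 (Finset.mem_range.2
        (hcon y (Finset.mem_filter.1 (Finset.mem_coe.1 hy)).2)))
      (hinj.mono fun y hy => (Finset.mem_filter.1 (Finset.mem_coe.1 hy)).2)
    rw [Finset.card_range] at this
    omega
  obtain ⟨hk1, hk2⟩ := Prod.mk.inj hy
  have h1 : 1 ≤ groupStart L (rank y) := one_le_groupStart hL (hR.pos y)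
  have h2 := groupStart_add_groupPos L (rank y)
  obtain ⟨x, hx, hx'⟩ := hR.contiguous y (groupStart L (rank y) + i) (by omega) (by omega)
  have h3 : groupPos L (rank y) < groupWidth L (rank y) := Nat.mod_lt _ (groupWidth_pos hL)
  have h4 : groupStart L (rank x) = groupStart L (rank y) :=
    groupStart_eq_of_mem hL (groupStart_groupStart hL (hR.pos y)) h1 (by omega)
      (by rw [groupWidth_groupStart hL (hR.pos y)]; omega)
  have h5 := groupStart_add_groupPos L (rank x)
  refine ⟨x, Finset.mem_filter.2 ⟨Finset.mem_univ _, Prod.ext (hx.trans hk1) (h4.trans hk2), ?_⟩, ?_⟩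
  · omega
  · show groupPos L (rank x) = i
    omega

lemma groupCount_mono {b b' : ℕ} (h : b ≤ b') (G : ℕ × ℕ) :
    groupCount cls rank p L b G ≤ groupCount cls rank p L b' G :=
  Finset.card_le_card fun y hy => by
    obtain ⟨-, h1, h2⟩ := Finset.mem_filter.1 hy
    exact Finset.mem_filter.2 ⟨Finset.mem_univ _, h1, h2.trans h⟩

lemma placed_mono {b b' : ℕ} (h : b ≤ b') : placed cls rank p L b ⊆ placed cls rank p L b' :=
  fun _ hy => Finset.mem_filter.2 ⟨Finset.mem_univ _,
    (Finset.mem_filter.1 hy).2.trans_le (groupCount_mono h _)⟩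

/-- For `f` the items of a group are interchangeable, so only their number matters. Applied to the
rounded sizes and to the constant 1, this preserves the load of every bin and the cost. -/
lemma Ranking.sum_placed (hR : Ranking cls size rank) (hL : 2 ≤ L) {f : ι → ℕ}
    (hf : ∀ y y', cls y = cls y' → groupStart L (rank y) = groupStart L (rank y') → f y = f y')
    (b : ℕ) : ∑ y ∈ placed cls rank p L b, f y = ∑ y with p y ≤ b, f y := by
  classical
  set I := Finset.univ.image (groupKey cls rank L) with hI
  have key : ∀ S : Finset ι, ∑ y ∈ S, f y =
      ∑ G ∈ I, ∑ y ∈ S with groupKey cls rank L y = G, f y := fun S =>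
    (Finset.sum_fiberwise_of_maps_to (fun y _ => Finset.mem_image_of_mem _ (Finset.mem_univ y)) _).symm
  rw [key, key]
  refine Finset.sum_congr rfl fun G hG => ?_
  obtain ⟨y₀, -, rfl⟩ := Finset.mem_image.1 hG
  have hconst : ∀ S : Finset ι, ∑ y ∈ S with groupKey cls rank L y = groupKey cls rank L y₀, f y =
      (S.filter fun y => groupKey cls rank L y = groupKey cls rank L y₀).card * f y₀ := by
    intro S
    rw [Finset.sum_congr rfl (g := fun _ => f y₀), Finset.sum_const, smul_eq_mul]
    intro y hy
    obtain ⟨h1, h2⟩ := Prod.mk.inj (Finset.mem_filter.1 hy).2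
    exact hf y y₀ h1 h2
  rw [hconst, hconst]
  congr 1
  have h1 := hR.card_groupPos_lt hL (groupKey cls rank L y₀)
    (c := groupCount cls rank p L b (groupKey cls rank L y₀)) (Finset.card_le_card fun y hy =>
      Finset.mem_filter.2 ⟨Finset.mem_univ _, (Finset.mem_filter.1 hy).2.1⟩)
  trans groupCount cls rank p L b (groupKey cls rank L y₀)
  · rw [← h1]
    congr 1
    ext y
    simp only [placed, Finset.mem_filter, Finset.mem_univ, true_and]
    constructor
    · rintro ⟨h2, h3⟩
      exact ⟨h3, by rwa [h3] at h2⟩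
    · rintro ⟨h2, h3⟩
      exact ⟨by rwa [h2], h2⟩
  · unfold groupCount
    congr 1
    ext y
    simp only [Finset.mem_filter, Finset.mem_univ, true_and]
    tauto

/-- An item enters only when the count of its group grows. The item that makes it grow has the same
class, hence the same ready time. -/
lemma exists_of_mem_placed_succ {b : ℕ} {y : ι} (h : y ∈ placed cls rank p L (b + 1))
    (h' : y ∉ placed cls rank p L b) : ∃ z, cls z = cls y ∧ p z = b + 1 := by
  classical
  by_contra hcon
  push Not at hcon
  refine h' (Finset.mem_filter.2 ⟨Finset.mem_univ _, (Finset.mem_filter.1 h).2.trans_le ?_⟩)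
  refine Finset.card_le_card fun z hz => ?_
  obtain ⟨-, h1, h2⟩ := Finset.mem_filter.1 hz
  have := hcon z (Prod.mk.inj h1).1
  exact Finset.mem_filter.2 ⟨Finset.mem_univ _, h1, by omega⟩

lemma placed_zero (hp : ∀ y, 1 ≤ p y) : placed cls rank p L 0 = ∅ := by
  refine Finset.filter_false_of_mem fun y _ => ?_
  rw [groupCount, Finset.filter_false_of_mem]
  · simp
  · intro z _ h
    have := hp z
    omega

lemma Ranking.placed_of_le (hR : Ranking cls size rank) (hL : 2 ≤ L) {b : ℕ} {y : ι}
    (h : ∀ z, groupKey cls rank L z = groupKey cls rank L y → p z ≤ b) :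
    y ∈ placed cls rank p L b := by
  classical
  refine Finset.mem_filter.2 ⟨Finset.mem_univ _, ?_⟩
  set c := (Finset.univ.filter fun z => groupKey cls rank L z = groupKey cls rank L y).card with hc
  have h1 := hR.card_groupPos_lt hL (groupKey cls rank L y) (c := c) le_rfl
  have h2 : Finset.univ.filter (fun z => groupKey cls rank L z = groupKey cls rank L y ∧
      groupPos L (rank z) < c) =
      Finset.univ.filter fun z => groupKey cls rank L z = groupKey cls rank L y :=
    Finset.eq_of_subset_of_card_le (fun z hz => Finset.mem_filter.2 ⟨Finset.mem_univ _,
      (Finset.mem_filter.1 hz).2.1⟩) (by rw [h1])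
  have h3 : y ∈ Finset.univ.filter (fun z => groupKey cls rank L z = groupKey cls rank L y ∧
      groupPos L (rank z) < c) := by
    rw [h2]
    exact Finset.mem_filter.2 ⟨Finset.mem_univ _, rfl⟩
  refine (Finset.mem_filter.1 h3).2.2.trans_le (Finset.card_le_card fun z hz => ?_)
  have := (Finset.mem_filter.1 hz).2
  exact Finset.mem_filter.2 ⟨Finset.mem_univ _, this, h z this⟩

/-! ### Encoding of the sets of placed items by few numbers -/

/-- An item of class `c` in segment `m`, with group number `d` and position `i` in the group, is in
the set described by `g` if its segment is high enough, or if it is in one of three segments and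
its position is below the number given for the group. -/
def InWindow (k L : ℕ) (g : ℕ → ℕ) (c m d i : ℕ) : Prop :=
  g c + 3 ≤ m ∨ g c ≤ m ∧ i < g (k + ((c * 3 + (m - g c)) * L ^ 2 + d))

open Classical in
variable (cls rank p L) in
/-- The lowest segment of a class with an item packed by time `b`. -/
noncomputable def lowestSegment (b c : ℕ) : ℕ :=
  if ∃ y, cls y = c ∧ p y ≤ b then sInf {m | ∃ y, cls y = c ∧ p y ≤ b ∧ Nat.log L (rank y) = m}
  -- The default exceeds the segment numbers of all items, so an untouched class contributes no
  -- item.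
  else Fintype.card ι

variable (cls rank p L) in
/-- The numbers that describe the set of the items placed by time `b`. -/
noncomputable def windowDigits (k b i : ℕ) : ℕ :=
  if i < k then lowestSegment cls rank p L b i else
    (Finset.univ.filter fun y => cls y = (i - k) / L ^ 2 / 3 ∧
      Nat.log L (rank y) = lowestSegment cls rank p L b ((i - k) / L ^ 2 / 3) + (i - k) / L ^ 2 % 3 ∧
      groupDigit L (rank y) = (i - k) % L ^ 2 ∧ p y ≤ b).card

lemma Ranking.rank_le_card (hR : Ranking cls size rank) (y : ι) : rank y ≤ Fintype.card ι := by
  have h := hR.card_filter_rank y (lo := 1) (hi := rank y + 1) le_rfl le_rfl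
  rw [Nat.add_sub_cancel] at h
  rw [← h]
  exact Finset.card_le_univ _

lemma Ranking.log_lt_card (hR : Ranking cls size rank) (y : ι) :
    Nat.log L (rank y) < Fintype.card ι :=
  (Nat.log_lt_self L (by have := hR.pos y; omega)).trans_le (hR.rank_le_card y)

lemma Ranking.windowDigits_le (hR : Ranking cls size rank) (k b i : ℕ) :
    windowDigits cls rank p L k b i ≤ Fintype.card ι := by
  unfold windowDigits
  split_ifs with h
  · unfold lowestSegment
    split_ifs with h'
    · obtain ⟨y, h1, h2⟩ := h'
      exact (Nat.sInf_le (s := {m | ∃ y, cls y = i ∧ p y ≤ b ∧ Nat.log L (rank y) = m})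
        ⟨y, h1, h2, rfl⟩).trans (hR.log_lt_card y).le
    · exact le_rfl
  · exact Finset.card_le_univ _

/-- Below the lowest segment in use nothing of the class is placed. From three segments above it on,
`hwin` forces every group to be complete. In between the counts decide. -/
lemma Ranking.mem_placed_iff (hR : Ranking cls size rank) (hL : 2 ≤ L)
    (hwin : ∀ x y, cls x = cls y → Nat.log L (rank y) + 3 ≤ Nat.log L (rank x) → p x ≤ p y)
    {k : ℕ} (b : ℕ) (y : ι) (hk : cls y < k) :
    y ∈ placed cls rank p L b ↔ InWindow k L (windowDigits cls rank p L k b) (cls y)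
      (Nat.log L (rank y)) (groupDigit L (rank y)) (groupPos L (rank y)) := by
  classical
  set μ := lowestSegment cls rank p L b (cls y) with hμ
  have hμ' : windowDigits cls rank p L k b (cls y) = μ := if_pos hk
  have hlow : ∀ z, cls z = cls y → p z ≤ b → μ ≤ Nat.log L (rank z) := by
    intro z h1 h2
    rw [hμ, lowestSegment, if_pos ⟨z, h1, h2⟩]
    exact Nat.sInf_le ⟨z, h1, h2, rfl⟩
  have hkey : ∀ z, groupKey cls rank L z = groupKey cls rank L y ↔ cls z = cls y ∧
      Nat.log L (rank z) = Nat.log L (rank y) ∧ groupDigit L (rank z) = groupDigit L (rank y) := by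
    intro z
    rw [groupKey, groupKey, Prod.mk.injEq, groupStart_eq_iff hL (hR.pos z) (hR.pos y)]
  rw [InWindow, hμ']
  by_cases h3 : μ + 3 ≤ Nat.log L (rank y)
  · simp only [h3, true_or, iff_true]
    have hex : ∃ z, cls z = cls y ∧ p z ≤ b := by
      by_contra hcon
      rw [hμ, lowestSegment, if_neg hcon] at h3
      have := hR.log_lt_card (L := L) y
      omega
    obtain ⟨z, hz1, hz2, hz3⟩ : μ ∈ {m | ∃ z, cls z = cls y ∧ p z ≤ b ∧ Nat.log L (rank z) = m} := by
      rw [hμ, lowestSegment, if_pos hex]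
      obtain ⟨z, h1, h2⟩ := hex
      exact Nat.sInf_mem (s := {m | ∃ z, cls z = cls y ∧ p z ≤ b ∧ Nat.log L (rank z) = m})
        ⟨_, z, h1, h2, rfl⟩
    refine hR.placed_of_le hL fun x hx => ?_
    obtain ⟨h4, h5, -⟩ := (hkey x).1 hx
    exact (hwin x z (h4.trans hz1.symm) (by omega)).trans hz2
  simp only [h3, false_or]
  by_cases h4 : μ ≤ Nat.log L (rank y)
  · simp only [h4, true_and]
    have hd := groupDigit_lt hL (rank y)
    have hL2 : 0 < L ^ 2 := by positivity
    -- The index of a count is decoded into class, segment offset (0, 1 or 2) and group number.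
    have e1 : ((cls y * 3 + (Nat.log L (rank y) - μ)) * L ^ 2 + groupDigit L (rank y)) % L ^ 2 =
        groupDigit L (rank y) := by
      rw [mul_comm, Nat.mul_add_mod, Nat.mod_eq_of_lt hd]
    have e2 : ((cls y * 3 + (Nat.log L (rank y) - μ)) * L ^ 2 + groupDigit L (rank y)) / L ^ 2 =
        cls y * 3 + (Nat.log L (rank y) - μ) := by
      rw [mul_comm, Nat.mul_add_div hL2, Nat.div_eq_of_lt hd, add_zero]
    have e3 : (cls y * 3 + (Nat.log L (rank y) - μ)) / 3 = cls y := by omega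
    have e4 : (cls y * 3 + (Nat.log L (rank y) - μ)) % 3 = Nat.log L (rank y) - μ := by omega
    have : windowDigits cls rank p L k b
        (k + ((cls y * 3 + (Nat.log L (rank y) - μ)) * L ^ 2 + groupDigit L (rank y))) =
        groupCount cls rank p L b (groupKey cls rank L y) := by
      rw [windowDigits, if_neg (by omega), Nat.add_sub_cancel_left, e1, e2, e3, e4, groupCount]
      congr 1
      ext z
      simp only [Finset.mem_filter, Finset.mem_univ, true_and, hkey]
      rw [← hμ, Nat.add_sub_cancel' h4]
      tauto
    rw [this, placed, Finset.mem_filter]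
    simp
  · simp only [h4, false_and, iff_false]
    intro hy
    have hpos := (Finset.mem_filter.1 hy).2
    obtain ⟨z, hz⟩ := Finset.card_pos.1 ((Nat.zero_le _).trans_lt hpos)
    obtain ⟨-, hz1, hz2⟩ := Finset.mem_filter.1 hz
    obtain ⟨h5, h6, -⟩ := (hkey z).1 hz1
    have := hlow z h5 hz2
    omega

end

/-! ## Ranks of numbered items -/

/-- The rank of item `j` among the items of its class in `A`, by decreasing size. -/
def itemRank (A : Finset ℕ) (lab sz : ℕ → ℕ) (j : ℕ) : ℕ :=
  (A.filter fun i => lab i = lab j ∧ (sz j < sz i ∨ sz i = sz j ∧ i < j)).card + 1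

/-- Ties are broken by the item number, so ranks within a class are distinct. They are also bounded
by the size of the class, hence there are no gaps. -/
lemma ranking_itemRank (A : Finset ℕ) (lab sz : ℕ → ℕ) :
    Ranking (fun x : A => lab x) (fun x : A => sz x) (fun x : A => itemRank A lab sz x) := by
  have hlt : ∀ x ∈ A, ∀ y ∈ A, lab x = lab y → (sz y < sz x ∨ sz x = sz y ∧ x < y) →
      itemRank A lab sz x < itemRank A lab sz y := by
    intro x hx y hy hl h
    refine Nat.add_lt_add_right (Finset.card_lt_card ?_) 1
    refine Finset.ssubset_iff_subset_ne.2 ⟨fun i hi => ?_, fun heq => ?_⟩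
    · obtain ⟨h1, h2, h3⟩ := Finset.mem_filter.1 hi
      refine Finset.mem_filter.2 ⟨h1, h2.trans hl, ?_⟩
      omega
    · have : x ∈ A.filter fun i => lab i = lab y ∧ (sz y < sz i ∨ sz i = sz y ∧ i < y) :=
        Finset.mem_filter.2 ⟨hx, hl, h⟩
      rw [← heq] at this
      have := (Finset.mem_filter.1 this).2.2
      omega
  have hinj : ∀ x ∈ A, ∀ y ∈ A, lab x = lab y → itemRank A lab sz x = itemRank A lab sz y →
      x = y := by
    intro x hx y hy hl h
    by_contra hne
    have h1 := hlt x hx y hy hl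
    have h2 := hlt y hy x hx hl.symm
    omega
  have hle : ∀ y ∈ A, itemRank A lab sz y ≤ (A.filter fun i => lab i = lab y).card := by
    intro y hy
    refine Nat.succ_le_of_lt (Finset.card_lt_card
      (Finset.ssubset_iff_subset_ne.2 ⟨fun i hi => ?_, fun heq => ?_⟩))
    · obtain ⟨h1, h2, h3⟩ := Finset.mem_filter.1 hi
      exact Finset.mem_filter.2 ⟨h1, h2⟩
    · have : y ∈ A.filter fun i => lab i = lab y := Finset.mem_filter.2 ⟨hy, rfl⟩
      rw [← heq] at this
      have := (Finset.mem_filter.1 this).2.2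
      omega
  refine ⟨fun x => Nat.le_add_left 1 _, fun x y hl h => Subtype.ext (hinj x x.2 y y.2 hl h), ?_, ?_⟩
  · intro x y hl h
    by_contra hcon
    have := hlt y y.2 x x.2 hl.symm (Or.inl (not_le.1 hcon))
    omega
  · intro y r h1 h2
    set S := A.filter fun i => lab i = lab y with hS
    have himg : S.image (itemRank A lab sz) = Finset.Icc 1 S.card := by
      refine Finset.eq_of_subset_of_card_le (fun r hr => ?_) ?_
      · obtain ⟨x, hx, rfl⟩ := Finset.mem_image.1 hr
        obtain ⟨h3, h4⟩ := Finset.mem_filter.1 hx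
        have := hle x h3
        rw [h4] at this
        exact Finset.mem_Icc.2 ⟨Nat.le_add_left 1 _, this⟩
      · rw [Finset.card_image_of_injOn]
        · simp
        · intro x hx x' hx' h
          obtain ⟨h3, h4⟩ := Finset.mem_filter.1 (Finset.mem_coe.1 hx)
          obtain ⟨h5, h6⟩ := Finset.mem_filter.1 (Finset.mem_coe.1 hx')
          exact hinj x h3 x' h5 (h4.trans h6.symm) h
    have : r ∈ S.image (itemRank A lab sz) := by
      rw [himg]
      exact Finset.mem_Icc.2 ⟨h1, h2.trans (hle y y.2)⟩
    obtain ⟨x, hx, rfl⟩ := Finset.mem_image.1 this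
    obtain ⟨h3, h4⟩ := Finset.mem_filter.1 hx
    exact ⟨⟨x, h3⟩, h4, rfl⟩

/-! ## Digits -/

lemma exists_code (n m : ℕ) (g : ℕ → ℕ) (hg : ∀ i, g i ≤ n) :
    ∃ s < (n + 1) ^ m, ∀ i < m, s / (n + 1) ^ i % (n + 1) = g i := by
  refine ⟨finFunctionFinEquiv (fun i : Fin m => (⟨g i, Nat.lt_succ_of_le (hg i)⟩ : Fin (n + 1))),
    Fin.is_lt _, fun i hi => ?_⟩
  have := finFunctionFinEquiv_symm_apply_val
    (finFunctionFinEquiv (fun i : Fin m => (⟨g i, Nat.lt_succ_of_le (hg i)⟩ : Fin (n + 1)))) ⟨i, hi⟩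
  rw [Equiv.symm_apply_apply] at this
  exact this.symm

/-! ## A cheapest chain -/

/-- The cost of the best completion of a chain from the code `s` if `h` of the `T` bins are
left. -/
noncomputable def chainValue (M T : ℕ) (final : ℕ → Prop) (trans : ℕ → ℕ → ℕ → Prop) (c : ℕ → ℕ) :
    ℕ → ℕ → ℕ
  | 0, s => open Classical in if final s then 0 else M
  | h + 1, s => boundedFind M fun v => ∃ s' < M, trans (T - h) s s' ∧
      c s + chainValue M T final trans c h s' ≤ v

/-- The codes of a cheapest chain from `s₀`. -/
noncomputable def chainPath (M T : ℕ) (final : ℕ → Prop) (trans : ℕ → ℕ → ℕ → Prop) (c : ℕ → ℕ)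
    (s₀ : ℕ) : ℕ → ℕ
  | 0 => s₀
  | b + 1 => boundedFind M fun s' =>
      trans (b + 1) (chainPath M T final trans c s₀ b) s' ∧
      c (chainPath M T final trans c s₀ b) + chainValue M T final trans c (T - (b + 1)) s' ≤
        chainValue M T final trans c (T - b) (chainPath M T final trans c s₀ b)

section

variable {M T : ℕ} {final : ℕ → Prop} {trans : ℕ → ℕ → ℕ → Prop} {c : ℕ → ℕ}

/-- Backward induction along the chain. The bound `M` plays the role of infinity, and `hM` keeps the
cost of the given chain within the range of the search. -/
lemma chainValue_le (s : ℕ → ℕ) (hs : ∀ b < T, s (b + 1) < M) (hfin : final (s T))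
    (htr : ∀ b < T, trans (b + 1) (s b) (s (b + 1)))
    (hM : ∑ b ∈ Finset.range T, c (s b) < M) (h : ℕ) (hh : h ≤ T) :
    chainValue M T final trans c h (s (T - h)) ≤ ∑ b ∈ Finset.Ico (T - h) T, c (s b) := by
  induction h with
  | zero => simp [chainValue, hfin]
  | succ h ih =>
    have h1 := ih (by omega)
    have h2 : T - h = T - (h + 1) + 1 := by omega
    have h3 : ∑ b ∈ Finset.Ico (T - (h + 1)) T, c (s b) =
        c (s (T - (h + 1))) + ∑ b ∈ Finset.Ico (T - h) T, c (s b) := by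
      rw [h2]
      exact Finset.sum_eq_sum_Ico_succ_bot (by omega) _
    have h4 : ∑ b ∈ Finset.Ico (T - (h + 1)) T, c (s b) < M := by
      refine lt_of_le_of_lt (Finset.sum_le_sum_of_subset fun b hb => ?_) hM
      exact Finset.mem_range.2 (Finset.mem_Ico.1 hb).2
    have hp : ∃ s' < M, trans (T - h) (s (T - (h + 1))) s' ∧
        c (s (T - (h + 1))) + chainValue M T final trans c h s' ≤
          ∑ b ∈ Finset.Ico (T - (h + 1)) T, c (s b) := by
      refine ⟨s (T - h), ?_, ?_, by rw [h3]; omega⟩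
      · rw [h2]; exact hs _ (by omega)
      · rw [h2]; exact htr _ (by omega)
    obtain ⟨-, -, h5⟩ := boundedFind_spec (p := fun v => ∃ s' < M, trans (T - h) (s (T - (h + 1))) s' ∧
        c (s (T - (h + 1))) + chainValue M T final trans c h s' ≤ v) ⟨_, h4, hp⟩
    by_contra hcon
    rw [chainValue, not_le] at hcon
    exact h5 _ hcon hp

/-- A value below `M` certifies that a minimising successor exists. Along the path, the cost so far
plus the remaining value never increases. -/
lemma chainPath_spec {s₀ : ℕ} (h0 : chainValue M T final trans c T s₀ < M) :
    final (chainPath M T final trans c s₀ T) ∧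
    (∀ b < T, chainPath M T final trans c s₀ (b + 1) < M ∧
      trans (b + 1) (chainPath M T final trans c s₀ b) (chainPath M T final trans c s₀ (b + 1))) ∧
    ∑ b ∈ Finset.range T, c (chainPath M T final trans c s₀ b) ≤
      chainValue M T final trans c T s₀ := by
  set s := chainPath M T final trans c s₀ with hs
  have step : ∀ b < T, chainValue M T final trans c (T - b) (s b) < M →
      s (b + 1) < M ∧ trans (b + 1) (s b) (s (b + 1)) ∧
        c (s b) + chainValue M T final trans c (T - (b + 1)) (s (b + 1)) ≤
          chainValue M T final trans c (T - b) (s b) := by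
    intro b hb hlt
    have hex : ∃ s' < M, trans (b + 1) (s b) s' ∧
        c (s b) + chainValue M T final trans c (T - (b + 1)) s' ≤
          chainValue M T final trans c (T - b) (s b) := by
      have h1 : T - b = T - (b + 1) + 1 := by omega
      rw [h1] at hlt ⊢
      rw [chainValue] at hlt ⊢
      by_cases hne : ∃ v < M, ∃ s' < M, trans (T - (T - (b + 1))) (s b) s' ∧
          c (s b) + chainValue M T final trans c (T - (b + 1)) s' ≤ v
      · obtain ⟨-, ⟨s', h2, h3, h4⟩, -⟩ := boundedFind_spec hne
        refine ⟨s', h2, ?_, h4⟩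
        rwa [show T - (T - (b + 1)) = b + 1 by omega] at h3
      · rw [boundedFind_of_not (fun v hv hp => hne ⟨v, hv, hp⟩)] at hlt
        exact absurd hlt (lt_irrefl _)
    obtain ⟨h1, ⟨h2, h3⟩, -⟩ := boundedFind_spec hex
    exact ⟨h1, h2, h3⟩
  have acc : ∀ b ≤ T, ∑ i ∈ Finset.range b, c (s i) +
      chainValue M T final trans c (T - b) (s b) ≤ chainValue M T final trans c T s₀ := by
    intro b
    induction b with
    | zero => intro _; simp [hs, chainPath]
    | succ b ih =>
      intro hb
      have h1 := ih (by omega)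
      obtain ⟨-, -, h2⟩ := step b (by omega) (by omega)
      rw [Finset.sum_range_succ]
      omega
  refine ⟨?_, fun b hb => ?_, ?_⟩
  · have := acc T le_rfl
    rw [Nat.sub_self, chainValue] at this
    by_contra hcon
    rw [if_neg hcon] at this
    omega
  · have := acc b hb.le
    obtain ⟨h1, h2, -⟩ := step b hb (by omega)
    exact ⟨h1, h2⟩
  · have := acc T le_rfl
    omega

end

/-! ### Packings as chains of coded sets -/

section

variable (A : Finset ℕ) (mem : ℕ → ℕ → Prop) (sz τ : ℕ → ℕ) (C N : ℕ)

/-- All items are in the set with code `s`. -/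
def FinalCode (s : ℕ) : Prop := ∀ j ∈ A, mem s j

open Classical in
/-- From the set with code `s` to the set with code `s'` by one bin with number `b`. -/
def CodeStep (b s s' : ℕ) : Prop :=
  s' < N ∧ (∀ j ∈ A, mem s j → mem s' j) ∧ (∀ j ∈ A, mem s' j → ¬ mem s j → τ j ≤ b) ∧
    ∑ j ∈ A with mem s' j ∧ ¬ mem s j, sz j ≤ C

open Classical in
/-- The number of items outside the set with code `s`. -/
noncomputable def codeCost (s : ℕ) : ℕ := (A.filter fun j => ¬ mem s j).card

open Classical in
/-- The bin of an item in the packing given by a sequence of `T + 1` codes. -/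
noncomputable def chainBin (T : ℕ) (s : ℕ → ℕ) (j : ℕ) : ℕ :=
  ((Finset.range (T + 1)).filter fun b => ¬ mem (s b) j).card

variable {A mem sz τ C N}

/-- Membership is monotone along the chain, so the number of codes that miss `j` is the first index
at which `j` is present. -/
lemma chainBin_eq {T : ℕ} {s : ℕ → ℕ} {j : ℕ} (hmono : ∀ b < T, mem (s b) j → mem (s (b + 1)) j)
    (h0 : ¬ mem (s 0) j) (hT : mem (s T) j) :
    1 ≤ chainBin mem T s j ∧ chainBin mem T s j ≤ T ∧ mem (s (chainBin mem T s j)) j ∧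
      ¬ mem (s (chainBin mem T s j - 1)) j := by
  classical
  have hm : ∀ b b', b ≤ b' → b' ≤ T → mem (s b) j → mem (s b') j := by
    intro b b' hb
    induction b', hb using Nat.le_induction with
    | base => exact fun _ h => h
    | succ b' _ ih => exact fun h1 h2 => hmono b' (by omega) (ih (by omega) h2)
  have hex : ∃ b, mem (s b) j := ⟨T, hT⟩
  set m := Nat.find hex with hmdef
  have h1 : mem (s m) j := Nat.find_spec hex
  have h2 : m ≤ T := Nat.find_min' hex hT
  have h3 : chainBin mem T s j = m := by
    rw [chainBin, ← Finset.card_range m]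
    congr 1
    ext b
    simp only [Finset.mem_filter, Finset.mem_range]
    constructor
    · rintro ⟨hb, hn⟩
      by_contra hcon
      exact hn (hm m b (by omega) (by omega) h1)
    · exact fun hb => ⟨by omega, Nat.find_min hex hb⟩
  have h4 : 1 ≤ m := by
    rcases Nat.eq_zero_or_pos m with h | h
    · rw [h] at h1; exact absurd h1 h0
    · exact h
  rw [h3]
  exact ⟨h4, h2, h1, Nat.find_min hex (by omega)⟩

/-- The cost is counted in two ways: an item in bin `b` is missing from exactly the sets with the
indices 0 to `b - 1`. -/
theorem chainBin_spec {M T s₀ : ℕ} (h0 : ∀ j ∈ A, ¬ mem s₀ j)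
    (hlt : chainValue M T (FinalCode A mem) (CodeStep A mem sz τ C N) (codeCost A mem) T s₀ < M) :
    let s := chainPath M T (FinalCode A mem) (CodeStep A mem sz τ C N) (codeCost A mem) s₀
    (∀ j ∈ A, τ j ≤ chainBin mem T s j) ∧
    (∀ b, ∑ j ∈ A with chainBin mem T s j = b, sz j ≤ C) ∧
    ∑ j ∈ A, chainBin mem T s j ≤
      chainValue M T (FinalCode A mem) (CodeStep A mem sz τ C N) (codeCost A mem) T s₀ := by
  classical
  intro s
  obtain ⟨hfin, hstep, hcost⟩ := chainPath_spec hlt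
  have key : ∀ j ∈ A, _ := fun j hj => chainBin_eq (mem := mem) (T := T) (s := s) (j := j)
    (fun b hb => (hstep b hb).2.2.1 j hj) (h0 j hj) (hfin j hj)
  refine ⟨fun j hj => ?_, fun b => ?_, ?_⟩
  · obtain ⟨h1, h2, h3, h4⟩ := key j hj
    have := (hstep (chainBin mem T s j - 1) (by omega)).2.2.2.1 j hj
    rw [Nat.sub_add_cancel h1] at this
    exact this h3 h4
  · rcases (A.filter fun j => chainBin mem T s j = b).eq_empty_or_nonempty with h | ⟨j₀, hj₀⟩
    · rw [h]; simp
    · obtain ⟨hj₀A, hb⟩ := Finset.mem_filter.1 hj₀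
      obtain ⟨h1, h2, -, -⟩ := key j₀ hj₀A
      have := (hstep (b - 1) (by omega)).2.2.2.2
      refine le_trans (Finset.sum_le_sum_of_subset fun j hj => ?_) this
      obtain ⟨hjA, hjb⟩ := Finset.mem_filter.1 hj
      obtain ⟨-, -, h3, h4⟩ := key j hjA
      rw [hjb] at h3 h4
      rw [Nat.sub_add_cancel (by omega)]
      exact Finset.mem_filter.2 ⟨hjA, h3, h4⟩
  · refine le_trans (le_of_eq ?_) hcost
    have h1 : codeCost A mem (s T) = 0 := by
      rw [codeCost, Finset.card_eq_zero]
      exact Finset.filter_false_of_mem fun j hj h => h (hfin j hj)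
    have h2 : ∑ b ∈ Finset.range T, codeCost A mem (s b) =
        ∑ b ∈ Finset.range (T + 1), codeCost A mem (s b) := by
      rw [Finset.sum_range_succ, h1, add_zero]
    refine Eq.trans ?_ h2.symm
    simp only [chainBin, codeCost, Finset.card_filter]
    exact Finset.sum_comm

end

/-! ## The chain of a windowed packing -/

lemma InWindow.congr {k L : ℕ} {g g' : ℕ → ℕ} (hgg : ∀ i < k + 3 * k * L ^ 2, g i = g' i)
    {c m d i : ℕ} (hc : c < k) (hd : d < L ^ 2) (h : InWindow k L g c m d i) :
    InWindow k L g' c m d i := by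
  unfold InWindow at h ⊢
  rw [← hgg c (by omega)]
  rcases h with h | ⟨h1, h2⟩
  · exact Or.inl h
  · by_cases h3 : g c + 3 ≤ m
    · exact Or.inl h3
    · refine Or.inr ⟨h1, ?_⟩
      rwa [← hgg]
      have h4 : (c * 3 + (m - g c) + 1) * L ^ 2 ≤ 3 * k * L ^ 2 :=
        Nat.mul_le_mul_right _ (by omega)
      rw [Nat.add_mul, one_mul] at h4
      omega

/-- Membership of item `j` in the set with code `s`, where the digits of `s` in base `n + 1` are the
numbers of the description. -/
def CodeMem (A : Finset ℕ) (lab sz : ℕ → ℕ) (n k L : ℕ) (s j : ℕ) : Prop :=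
  InWindow k L (fun i => s / (n + 1) ^ i % (n + 1)) (lab j) (Nat.log L (itemRank A lab sz j))
    (groupDigit L (itemRank A lab sz j)) (groupPos L (itemRank A lab sz j))

/-- The sets placed by the windowed packing form an admissible chain: the step to `b + 1` adds items
whose rounded sizes sum to the rounded load of bin `b + 1`, so their true sizes fit. The chain may
start at any code `s₀` of the empty set, because that is all the machine's search for a start code
provides. -/
theorem exists_chain {A : Finset ℕ} {lab sz : ℕ → ℕ} {n k L H Q D C : ℕ} {τ p : ℕ → ℕ} {δ : ℝ}
    (hD : 1 ≤ D) (hQ : Q = 11 * (D + 1)) (hLQ : 2 * Q ≤ L) (hH : 2 ≤ H) (hHL : H + 1 ≤ L)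
    (hδ : (1 : ℝ) / D + 4 * Q / H + 4 * Q ^ 4 * H / L ≤ δ)
    (hn : A.card ≤ n) (hlab : ∀ j ∈ A, lab j < k) (hτD : ∀ c, τ c ≤ D)
    (hp : ∀ j ∈ A, 1 ≤ p j) (hτ : ∀ j ∈ A, τ (lab j) ≤ p j)
    (hC : ∀ b, ∑ j ∈ A with p j = b, sz j ≤ C)
    {T M N s₀ : ℕ} (hN : (n + 1) ^ (k + 3 * k * L ^ 2) ≤ N) (hNM : N ≤ M)
    (hT : (1 + δ) * ((∑ j ∈ A, p j : ℕ) : ℝ) ≤ T) (hTM : T < M)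
    (h0 : ∀ j ∈ A, ¬ CodeMem A lab sz n k L s₀ j) :
    (chainValue M T (FinalCode A (CodeMem A lab sz n k L))
      (CodeStep A (CodeMem A lab sz n k L) sz (fun j => τ (lab j)) C N)
      (codeCost A (CodeMem A lab sz n k L)) T s₀ : ℝ) ≤ (1 + δ) * ((∑ j ∈ A, p j : ℕ) : ℝ) ∧
    chainValue M T (FinalCode A (CodeMem A lab sz n k L))
      (CodeStep A (CodeMem A lab sz n k L) sz (fun j => τ (lab j)) C N)
      (codeCost A (CodeMem A lab sz n k L)) T s₀ < M := by
  classical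
  have hL : 2 ≤ L := by omega
  have hR := ranking_itemRank A lab sz
  have sub : ∀ (P : ℕ → Prop) [DecidablePred P] (f : ℕ → ℕ),
      ∑ j ∈ A with P j, f j = ∑ y ∈ Finset.univ.filter (fun y : A => P y.1), f y.1 := by
    intro P _ f
    rw [Finset.sum_filter, Finset.sum_filter]
    exact (Finset.sum_coe_sort A fun j => if P j then f j else 0).symm
  obtain ⟨p', w, h1, h2, h3, h4, h5, h6, h7⟩ := hR.exists_windowed (p := fun x : A => p x) (C := C)
    hD hQ hLQ hH hHL (fun x => hp x x.2) (fun b => by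
      rw [← sub (fun j => p j = b)]; exact hC b)
  have hsum : ∑ y : A, p y = ∑ j ∈ A, p j := Finset.sum_coe_sort A p
  rw [hsum] at h7
  have hcost : ((∑ y, p' y : ℕ) : ℝ) ≤ (1 + δ) * ((∑ j ∈ A, p j : ℕ) : ℝ) :=
    h7.trans (mul_le_mul_of_nonneg_right (by linarith) (Nat.cast_nonneg _))
  have hcostT : ∑ y, p' y ≤ T := by exact_mod_cast hcost.trans hT
  have hp'T : ∀ y, p' y ≤ T := fun y =>
    (Finset.single_le_sum (f := p') (fun _ _ => Nat.zero_le _) (Finset.mem_univ y)).trans hcostT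
  set cls : A → ℕ := fun x => lab x with hcls
  set rank : A → ℕ := fun x => itemRank A lab sz x with hrank
  have hcode : ∀ b, ∃ s < (n + 1) ^ (k + 3 * k * L ^ 2), ∀ i < k + 3 * k * L ^ 2,
      s / (n + 1) ^ i % (n + 1) = windowDigits cls rank p' L k b i := fun b =>
    exists_code n _ _ fun i => (hR.windowDigits_le k b i).trans (by simpa using hn)
  choose code hcodelt hcodedig using hcode
  set s : ℕ → ℕ := fun b => if b = 0 then s₀ else code b with hs
  have hmem : ∀ b (y : A), CodeMem A lab sz n k L (s b) y ↔ y ∈ placed cls rank p' L b := by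
    intro b y
    rcases Nat.eq_zero_or_pos b with rfl | hb
    · rw [placed_zero h2]
      simpa [hs] using h0 y y.2
    · rw [hR.mem_placed_iff hL h6 b y (hlab y y.2)]
      have hsb : s b = code b := if_neg (by omega)
      rw [hsb]
      exact ⟨fun h => InWindow.congr (hcodedig b) (hlab y y.2) (groupDigit_lt hL _) h,
        fun h => InWindow.congr (fun i hi => (hcodedig b i hi).symm) (hlab y y.2)
          (groupDigit_lt hL _) h⟩
  have hsumdiff : ∀ b, ∑ y ∈ placed cls rank p' L (b + 1) \ placed cls rank p' L b, w y ≤ C := by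
    intro b
    have e1 := hR.sum_placed (p := p') hL h4 b
    have e2 := hR.sum_placed (p := p') hL h4 (b + 1)
    have e3 := Finset.sum_sdiff (f := w) (placed_mono (cls := cls) (rank := rank) (p := p') (L := L)
      (Nat.le_succ b))
    have e4 : ∑ y with p' y ≤ b + 1, w y = ∑ y with p' y ≤ b, w y + ∑ y with p' y = b + 1, w y := by
      rw [← Finset.sum_union]
      · congr 1
        ext y
        simp only [Finset.mem_filter, Finset.mem_univ, true_and, Finset.mem_union]
        omega
      · refine Finset.disjoint_filter.2 fun y _ h h' => ?_
        omega
    have := h5 (b + 1)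
    rw [Nat.succ_eq_add_one] at e3
    omega
  have hstep : ∀ b < T, CodeStep A (CodeMem A lab sz n k L) sz (fun j => τ (lab j)) C N (b + 1)
      (s b) (s (b + 1)) := by
    intro b hb
    have hs1 : s (b + 1) = code (b + 1) := if_neg (by omega)
    refine ⟨by rw [hs1]; exact (hcodelt _).trans_le hN, fun j hj h => ?_, fun j hj h h' => ?_, ?_⟩
    · exact (hmem (b + 1) ⟨j, hj⟩).2 (placed_mono (Nat.le_succ b) ((hmem b ⟨j, hj⟩).1 h))
    · obtain ⟨z, hz1, hz2⟩ := exists_of_mem_placed_succ ((hmem (b + 1) ⟨j, hj⟩).1 h)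
        (fun h'' => h' ((hmem b ⟨j, hj⟩).2 h''))
      have hz1' : lab z = lab j := hz1
      -- Either bin `b + 1` is beyond all ready times, or it is not before the bin of some item of
      -- the same class in the original packing.
      rcases h1 z with h8 | ⟨x, hx1, hx2⟩
      · exact (hτD _).trans (by omega)
      · have hx1' : lab x = lab z := hx1
        have := hτ x x.2
        rw [hx1', hz1'] at this
        show τ (lab j) ≤ b + 1
        omega
    · rw [sub (fun j => CodeMem A lab sz n k L (s (b + 1)) j ∧ ¬ CodeMem A lab sz n k L (s b) j)]
      refine le_trans ?_ (hsumdiff b)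
      refine (Finset.sum_le_sum fun y _ => h3 y).trans (le_of_eq ?_)
      congr 1
      ext y
      simp [hmem]
  have hcost' : ∑ b ∈ Finset.range T, codeCost A (CodeMem A lab sz n k L) (s b) = ∑ y, p' y := by
    have e1 : ∀ b, codeCost A (CodeMem A lab sz n k L) (s b) =
        ∑ y, if b < p' y then 1 else 0 := by
      intro b
      have e2 := hR.sum_placed (p := p') (f := fun _ => 1) hL (fun _ _ _ _ => rfl) b
      rw [codeCost, Finset.card_eq_sum_ones, sub (fun j => ¬ CodeMem A lab sz n k L (s b) j),
        ← Finset.sum_filter]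
      simp only [Finset.sum_const, smul_eq_mul, mul_one] at e2 ⊢
      have e3 := Finset.card_filter_add_card_filter_not (s := (Finset.univ : Finset A))
        (fun y => y ∈ placed cls rank p' L b)
      have e4 := Finset.card_filter_add_card_filter_not (s := (Finset.univ : Finset A))
        (fun y => p' y ≤ b)
      simp only [Finset.filter_univ_mem, not_le] at e3 e4
      have e5 : (Finset.univ.filter fun y : A => ¬ CodeMem A lab sz n k L (s b) y) =
          Finset.univ.filter fun y => y ∉ placed cls rank p' L b := by
        ext y; simp [hmem]
      rw [e5]
      omega
    simp only [e1]
    rw [Finset.sum_comm]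
    refine Finset.sum_congr rfl fun y _ => ?_
    rw [← Finset.sum_filter, Finset.sum_const, smul_eq_mul, mul_one]
    have : (Finset.range T).filter (fun b => b < p' y) = Finset.range (p' y) := by
      have := hp'T y
      ext b; simp; omega
    rw [this, Finset.card_range]
  have hfin : FinalCode A (CodeMem A lab sz n k L) (s T) := fun j hj =>
    (hmem T ⟨j, hj⟩).2 (hR.placed_of_le hL fun z _ => hp'T z)
  have key := chainValue_le (M := M) s (fun b hb => (hstep b hb).1.trans_le hNM) hfin hstep
    (by rw [hcost']; omega) T le_rfl
  have hs0 : s (T - T) = s₀ := by simp [hs]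
  rw [hs0, Nat.sub_self, ← Finset.range_eq_Ico, hcost'] at key
  refine ⟨le_trans (by exact_mod_cast key) hcost, by omega⟩

/-! ## Definability of the dynamic program -/

/-- The memory `σ` with array `a` cut off at `i`. -/
def RamState.truncate (σ : RamState) (a i : ℕ) : RamState :=
  fun b x => if b = a ∧ i ≤ x then 0 else σ b x

lemma RamState.truncate_of_ne {σ : RamState} {a i b : ℕ} (h : b ≠ a) : σ.truncate a i b = σ b := by
  funext x
  simp [RamState.truncate, h]

lemma RamState.truncate_of_lt {σ : RamState} {a i x : ℕ} (h : x < i) :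
    σ.truncate a i a x = σ a x := by
  simp [RamState.truncate, h]

namespace Definable

variable {B k : ℕ} {F G : RamState → (ℕ → ℕ) → ℕ}

lemma of_eq (hF : Definable B k F) (h : ∀ σ v, F σ v = G σ v) : Definable B k G := by
  obtain ⟨e, he, h'⟩ := hF
  exact ⟨e, he, fun σ v => (h' σ v).trans (h σ v)⟩

lemma const_mul (c : ℕ) (hF : Definable B k F) : Definable B k (fun σ v => c * F σ v) := by
  induction c with
  | zero => exact (const 0).of_eq fun _ _ => (Nat.zero_mul _).symm
  | succ c ih => exact (ih.add hF).of_eq fun _ _ => (Nat.succ_mul _ _).symm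

/-- Every read of array `a` is guarded by comparing the address with the variable `m`, whose index
goes up by one under each sum. -/
lemma truncate {a : ℕ} (hBa : B ≠ a) (hF : Definable B k F) (m : ℕ) :
    Definable B k (fun σ v => F (σ.truncate a (v m)) v) := by
  obtain ⟨e, he, h⟩ := hF
  refine Definable.of_eq (F := fun σ v => e.eval B (σ.truncate a (v m)) v) ?_ (fun _ _ => h _ _)
  clear h
  induction e generalizing m with
  | lit c => exact const c
  | var i => exact var i
  | read b x ih =>
    by_cases hb : b = a
    · refine (ite (.lt (ih m he.2) (var m)) (read he.1 (ih m he.2)) (const 0)).of_eq fun σ v => ?_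
      simp only [SumExpr.eval, RamState.truncate, hb, true_and]
      split_ifs <;> first | rfl | omega
    · refine (read he.1 (ih m he.2)).of_eq fun σ v => ?_
      simp only [SumExpr.eval]
      rw [RamState.truncate_of_ne hb]
  | add x y hx hy => exact (hx m he.1).add (hy m he.2)
  | sub x y hx hy => exact (hx m he.1).sub (hy m he.2)
  | ite c x y hc hx hy =>
    exact (ite (.ne (hc m he.1) (const 0)) (hx m he.2.1) (hy m he.2.2)).of_eq fun σ v => rfl
  | sum x ih =>
    refine (sum (H := fun σ v i => x.eval B (σ.truncate a (v m)) (envCons i v)) ?_).of_eq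
      fun σ v => ?_
    · refine (ih (m + 1) he).of_eq fun σ w => ?_
      congr 1
      funext i
      cases i <;> rfl
    · simp only [SumExpr.eval]
      rw [RamState.truncate_of_ne hBa]

end Definable

/-- Cutting the array off at the current index makes the rule recursive by construction; that the
cut does no harm is checked only when the tables are evaluated. -/
lemma FillRule.truncate {B a : ℕ} (hB : B < a) {F : RamState → (ℕ → ℕ) → ℕ}
    (hF : Definable B (a + 1) F) : FillRule B a (fun σ v => F (σ.truncate a (v 0)) v) := by
  refine ⟨hF.truncate hB.ne 0, fun σ τ i h1 h2 => hF.congr_arrays (by omega) (fun b hb => ?_) _⟩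
  rcases Nat.lt_succ_iff_lt_or_eq.1 hb with hb | rfl
  · rw [RamState.truncate_of_ne hb.ne, RamState.truncate_of_ne hb.ne, h1 b hb]
  · funext x
    simp only [RamState.truncate, true_and]
    split_ifs with hx
    · rfl
    · exact h2 x (by omega)

open Classical in
/-- The items below the content of cell 0 of array `B` that satisfy `act`. -/
noncomputable def activeSet (B : ℕ) (act : RamState → ℕ → Prop) (σ : RamState) : Finset ℕ :=
  (Finset.range (σ B 0)).filter (act σ)

section

variable {B k : ℕ} {act : RamState → ℕ → Prop} {mem : RamState → ℕ → ℕ → Prop}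
  {F G F₁ F₂ F₃ F₄ : RamState → (ℕ → ℕ) → ℕ} {f : RamState → ℕ → ℕ}

open Classical in
lemma Definable.sum_activeSet
    (hact : DefinableRel B k (fun σ v => act σ (v 0)))
    {r : RamState → (ℕ → ℕ) → ℕ → Prop} {H : RamState → (ℕ → ℕ) → ℕ → ℕ}
    (hr : DefinableRel B k (fun σ w => r σ (fun i => w (i + 1)) (w 0)))
    (hH : Definable B k (fun σ w => H σ (fun i => w (i + 1)) (w 0))) :
    Definable B k (fun σ v => ∑ j ∈ activeSet B act σ with r σ v j, H σ v j) :=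
  (Definable.sum (H := fun σ v j => if act σ j ∧ r σ v j then H σ v j else 0)
    (.ite (hact.and hr) hH (.const 0))).of_eq fun σ v => by
      rw [activeSet, Finset.filter_filter, Finset.sum_filter]

lemma DefinableRel.finalCode
    (hact : DefinableRel B k (fun σ v => act σ (v 0)))
    (hmem : ∀ {F G}, Definable B k F → Definable B k G →
      DefinableRel B k (fun σ v => mem σ (F σ v) (G σ v)))
    (hF : Definable B k F) :
    DefinableRel B k (fun σ v => FinalCode (activeSet B act σ) (mem σ) (F σ v)) :=
  (DefinableRel.all (r := fun σ v j => act σ j → mem σ (F σ v) j)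
    (.imp hact (hmem hF.shift (.var 0)))).of_iff fun σ v => by
      simp [FinalCode, activeSet]

lemma Definable.codeCost
    (hact : DefinableRel B k (fun σ v => act σ (v 0)))
    (hmem : ∀ {F G}, Definable B k F → Definable B k G →
      DefinableRel B k (fun σ v => mem σ (F σ v) (G σ v)))
    (hF : Definable B k F) :
    Definable B k (fun σ v => codeCost (activeSet B act σ) (mem σ) (F σ v)) := by
  classical
  refine (Definable.sum_activeSet hact (r := fun σ v j => ¬ mem σ (F σ v) j) (H := fun _ _ _ => 1)
    (.not (hmem hF.shift (.var 0))) (.const 1)).of_eq fun σ v => ?_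
  rw [_root_.codeCost, Finset.card_eq_sum_ones]
  exact Finset.sum_congr (Finset.filter_congr_decidable _ _ _) fun _ _ => rfl

lemma DefinableRel.codeStep {sz τ : RamState → ℕ → ℕ} {C N : RamState → ℕ}
    (hact : DefinableRel B k (fun σ v => act σ (v 0)))
    (hmem : ∀ {F G}, Definable B k F → Definable B k G →
      DefinableRel B k (fun σ v => mem σ (F σ v) (G σ v)))
    (hsz : Definable B k (fun σ v => sz σ (v 0))) (hτ : Definable B k (fun σ v => τ σ (v 0)))
    (hC : Definable B k (fun σ _ => C σ)) (hN : Definable B k (fun σ _ => N σ))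
    (hF : Definable B k F) (hF₁ : Definable B k F₁) (hF₂ : Definable B k F₂) :
    DefinableRel B k (fun σ v => CodeStep (activeSet B act σ) (mem σ) (sz σ) (τ σ) (C σ) (N σ)
      (F σ v) (F₁ σ v) (F₂ σ v)) := by
  classical
  have h1 : DefinableRel B k (fun σ w => mem σ (F₁ σ fun i => w (i + 1)) (w 0)) :=
    hmem hF₁.shift (.var 0)
  have h2 : DefinableRel B k (fun σ w => mem σ (F₂ σ fun i => w (i + 1)) (w 0)) :=
    hmem hF₂.shift (.var 0)
  refine ((DefinableRel.lt hF₂ hN).and ((DefinableRel.all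
    (r := fun σ v j => act σ j → mem σ (F₁ σ v) j → mem σ (F₂ σ v) j) (.imp hact (.imp h1 h2))).and
    ((DefinableRel.all
      (r := fun σ v j => act σ j → mem σ (F₂ σ v) j → ¬ mem σ (F₁ σ v) j → τ σ j ≤ F σ v)
        (.imp hact (.imp h2 (.imp h1.not (.le hτ hF.shift))))).and
      (DefinableRel.le (Definable.sum_activeSet hact
        (r := fun σ v j => mem σ (F₂ σ v) j ∧ ¬ mem σ (F₁ σ v) j) (H := fun σ _ j => sz σ j)
        (.and h2 h1.not) hsz) hC)))).of_iff fun σ v => ?_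
  simp only [CodeStep, activeSet, Finset.mem_filter, Finset.mem_range, and_imp]
  refine and_congr Iff.rfl (and_congr Iff.rfl (and_congr Iff.rfl ?_))
  rw [Finset.sum_congr (Finset.filter_congr_decidable _ _ _) fun _ _ => rfl]

lemma Definable.itemRank {lab sz : RamState → ℕ → ℕ}
    (hact : DefinableRel B k (fun σ v => act σ (v 0)))
    (hlab : ∀ {F}, Definable B k F → Definable B k (fun σ v => lab σ (F σ v)))
    (hsz : ∀ {F}, Definable B k F → Definable B k (fun σ v => sz σ (F σ v)))
    (hF : Definable B k F) :
    Definable B k (fun σ v => itemRank (activeSet B act σ) (lab σ) (sz σ) (F σ v)) := by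
  classical
  refine ((Definable.sum_activeSet hact (r := fun σ v i => lab σ i = lab σ (F σ v) ∧
    (sz σ (F σ v) < sz σ i ∨ sz σ i = sz σ (F σ v) ∧ i < F σ v)) (H := fun _ _ _ => 1) ?_
    (.const 1)).add (.const 1)).of_eq fun σ v => ?_
  · exact .and (.eq (hlab (.var 0)) (hlab hF.shift))
      (.or (.lt (hsz hF.shift) (hsz (.var 0))) (.and (.eq (hsz (.var 0)) (hsz hF.shift))
        (.lt (.var 0) hF.shift)))
  · rw [_root_.itemRank, Finset.card_eq_sum_ones]
    congr 1
    exact Finset.sum_congr (Finset.filter_congr_decidable _ _ _) fun _ _ => rfl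

lemma DefinableRel.inWindow (k' L : ℕ) {g : RamState → (ℕ → ℕ) → ℕ → ℕ}
    (hg : ∀ {F}, Definable B k F → Definable B k (fun σ v => g σ v (F σ v)))
    (h₁ : Definable B k F₁) (h₂ : Definable B k F₂) (h₃ : Definable B k F₃)
    (h₄ : Definable B k F₄) :
    DefinableRel B k (fun σ v => InWindow k' L (g σ v) (F₁ σ v) (F₂ σ v) (F₃ σ v) (F₄ σ v)) := by
  have hgc := hg h₁
  refine (DefinableRel.or (.le (hgc.add (.const 3)) h₂) (.and (.le hgc h₂)
    (.lt h₄ (hg (F := fun σ v => k' + (L ^ 2 * (3 * F₁ σ v + (F₂ σ v - g σ v (F₁ σ v))) + F₃ σ v))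
      ((Definable.const k').add ((Definable.const_mul _ ((Definable.const_mul _ h₁).add
        (h₂.sub hgc))).add h₃)))))).of_iff fun σ v => ?_
  rw [InWindow, mul_comm (L ^ 2), mul_comm 3]

end

/-! ## The dynamic program on the machine -/

/-- `Nat.log L r`, read off from a table of the powers of `L`. -/
noncomputable def tableLog (M : ℕ) (t : ℕ → ℕ) (r : ℕ) : ℕ := boundedFind M fun i => r < t (i + 1)

lemma tableLog_eq {M L r : ℕ} {t : ℕ → ℕ} (ht : ∀ i < M, t i = L ^ i) (hL : 2 ≤ L) (hr : 1 ≤ r)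
    (hrM : r < M) : tableLog M t r = Nat.log L r := by
  have h1 : Nat.log L r < r := Nat.log_lt_self L (by omega)
  refine boundedFind_eq_of_least (by omega) ?_ fun j hj => ?_
  · rw [ht _ (by omega)]
    exact Nat.lt_pow_succ_log_self (by omega) r
  · rw [ht _ (by omega), not_lt]
    exact Nat.pow_le_of_le_log (by omega) hj

section

variable (B k L K : ℕ) (τ : ℕ → ℕ)

/-- The items with a positive ready time. -/
def coreAct (ρ : RamState) (j : ℕ) : Prop := j < ρ 0 0 ∧ τ (ρ 3 j) ≠ 0

/-- The set of the items with a positive ready time. -/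
noncomputable abbrev coreSet (ρ : RamState) : Finset ℕ := activeSet B (coreAct τ) ρ

/-- The rank of an item. -/
noncomputable def coreRank (ρ : RamState) (j : ℕ) : ℕ :=
  itemRank (coreSet B τ ρ) (ρ 3) (ρ 2) j

/-- The segment of an item. -/
noncomputable def coreLog (ρ : RamState) (j : ℕ) : ℕ :=
  tableLog (ρ B 0) (ρ (B + 1)) (coreRank B τ ρ j)

/-- The digits of a code. -/
noncomputable def coreDigit (ρ : RamState) (s i : ℕ) : ℕ :=
  boundedMod (ρ B 0) (boundedDiv (ρ B 0) s (ρ (B + 2) i)) (ρ 0 0 + 1)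

/-- The relation `CodeMem` as computed from the tables. -/
def coreMem (ρ : RamState) (s j : ℕ) : Prop :=
  InWindow k L (coreDigit B ρ s) (ρ 3 j) (coreLog B τ ρ j)
    (boundedDiv (ρ B 0) (coreRank B τ ρ j) (ρ (B + 1) (coreLog B τ ρ j - 1)))
    (boundedMod (ρ B 0) (coreRank B τ ρ j) (ρ (B + 1) (coreLog B τ ρ j - 1)))

/-- The number of codes. -/
def coreCodes (ρ : RamState) : ℕ := ρ (B + 2) (k + 3 * k * L ^ 2)

/-- The number of bins. -/
def coreHorizon (ρ : RamState) : ℕ :=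
  boundedMul (ρ B 0) (ρ 0 0 + K) (boundedMul (ρ B 0) (ρ 0 0 + K) (ρ 0 0 + K))

/-- All items are in the set with code `s`. -/
def coreFinal (ρ : RamState) (s : ℕ) : Prop := FinalCode (coreSet B τ ρ) (coreMem B k L τ ρ) s

/-- The steps between codes. -/
def coreStep (ρ : RamState) (b s s' : ℕ) : Prop :=
  CodeStep (coreSet B τ ρ) (coreMem B k L τ ρ) (ρ 2) (fun j => τ (ρ 3 j)) (ρ 1 0)
    (coreCodes B k L ρ) b s s'

/-- The cost of a code. -/
noncomputable def coreCost (ρ : RamState) (s : ℕ) : ℕ :=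
  codeCost (coreSet B τ ρ) (coreMem B k L τ ρ) s

/-- The rule for the table of powers of `L`. -/
def powRule (ρ : RamState) (v : ℕ → ℕ) : ℕ :=
  if v 0 = 0 then 1 else L * ρ (B + 1) (v 0 - 1)

/-- The rule for the table of powers of `n + 1`. -/
def powSuccRule (ρ : RamState) (v : ℕ → ℕ) : ℕ :=
  if v 0 = 0 then 1 else boundedMul (ρ B 0) (ρ 0 0 + 1) (ρ (B + 2) (v 0 - 1))

open Classical in
/-- The rule for the table of the costs of best completions. -/
noncomputable def valueRule (ρ : RamState) (v : ℕ → ℕ) : ℕ :=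
  if boundedDiv (ρ B 0) (v 0) (coreCodes B k L ρ) = 0 then
    if coreFinal B k L τ ρ (boundedMod (ρ B 0) (v 0) (coreCodes B k L ρ)) then 0 else ρ B 0
  else boundedFind (ρ B 0) fun x => ∃ s' < ρ B 0,
    coreStep B k L τ ρ (coreHorizon B K ρ - (boundedDiv (ρ B 0) (v 0) (coreCodes B k L ρ) - 1))
      (boundedMod (ρ B 0) (v 0) (coreCodes B k L ρ)) s' ∧
    coreCost B k L τ ρ (boundedMod (ρ B 0) (v 0) (coreCodes B k L ρ)) +
      ρ (B + 3) (boundedMul (ρ B 0) (boundedDiv (ρ B 0) (v 0) (coreCodes B k L ρ) - 1)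
        (coreCodes B k L ρ) + s') ≤ x

/-- The rule for the codes of a cheapest chain. -/
noncomputable def pathRule (ρ : RamState) (v : ℕ → ℕ) : ℕ :=
  if v 0 = 0 then boundedFind (ρ B 0) fun s => ∀ j < ρ B 0, coreAct τ ρ j → ¬ coreMem B k L τ ρ s j
  else boundedFind (ρ B 0) fun s' => coreStep B k L τ ρ (v 0) (ρ (B + 4) (v 0 - 1)) s' ∧
    coreCost B k L τ ρ (ρ (B + 4) (v 0 - 1)) +
      ρ (B + 3) (boundedMul (ρ B 0) (coreHorizon B K ρ - v 0) (coreCodes B k L ρ) + s') ≤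
    ρ (B + 3) (boundedMul (ρ B 0) (coreHorizon B K ρ - (v 0 - 1)) (coreCodes B k L ρ) +
      ρ (B + 4) (v 0 - 1))

open Classical in
/-- The rule for the bins. -/
noncomputable def binRule (ρ : RamState) (v : ℕ → ℕ) : ℕ :=
  ∑ b ∈ Finset.range (ρ B 0), if b < coreHorizon B K ρ + 1 ∧ ¬ coreMem B k L τ ρ (ρ (B + 4) b) (v 0)
    then 1 else 0

variable {B k L K τ}

section definability

variable {l : ℕ} {F G F₁ F₂ F₃ : RamState → (ℕ → ℕ) → ℕ}

lemma definable_ready (hB : 4 ≤ B) (hl : B + 3 ≤ l) (hτ : ∀ c, k ≤ c → τ c = 0)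
    (hF : Definable B l F) : Definable B l (fun ρ v => τ (ρ 3 (F ρ v))) :=
  (Definable.table τ k (.read (a := 3) (by omega) hF)).of_eq fun ρ v => by
    split_ifs with h
    · rfl
    · exact (hτ _ (not_lt.1 h)).symm

lemma definableRel_coreAct (hB : 4 ≤ B) (hl : B + 3 ≤ l) (hτ : ∀ c, k ≤ c → τ c = 0)
    (hF : Definable B l F) : DefinableRel B l (fun ρ v => coreAct τ ρ (F ρ v)) :=
  .and (.lt hF (.read (a := 0) (by omega) (.const 0)))
    (.ne (definable_ready hB hl hτ hF) (.const 0))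

lemma definable_size (hl : B + 3 ≤ l) : Definable B l (fun ρ _ => ρ B 0) :=
  .read (by omega) (.const 0)

lemma definable_coreRank (hB : 4 ≤ B) (hl : B + 3 ≤ l) (hτ : ∀ c, k ≤ c → τ c = 0)
    (hF : Definable B l F) : Definable B l (fun ρ v => coreRank B τ ρ (F ρ v)) :=
  Definable.itemRank (lab := fun ρ => ρ 3) (sz := fun ρ => ρ 2)
    (definableRel_coreAct hB hl hτ (.var 0)) (fun h => .read (by omega) h)
    (fun h => .read (by omega) h) hF

lemma definable_coreLog (hB : 4 ≤ B) (hl : B + 3 ≤ l) (hτ : ∀ c, k ≤ c → τ c = 0)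
    (hF : Definable B l F) : Definable B l (fun ρ v => coreLog B τ ρ (F ρ v)) :=
  Definable.boundedFind (r := fun ρ v i => coreRank B τ ρ (F ρ v) < ρ (B + 1) (i + 1))
    (.lt (definable_coreRank hB hl hτ hF.shift) (.read (by omega) ((Definable.var 0).add (.const 1))))

lemma definable_coreDigit (hB : 4 ≤ B) (hl : B + 3 ≤ l)
    (hF : Definable B l F) (hG : Definable B l G) :
    Definable B l (fun ρ v => coreDigit B ρ (F ρ v) (G ρ v)) :=
  (hF.boundedDiv (.read (by omega) hG)).boundedMod
    ((Definable.read (a := 0) (by omega) (.const 0)).add (.const 1))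

lemma definableRel_coreMem (hB : 4 ≤ B) (hl : B + 3 ≤ l) (hτ : ∀ c, k ≤ c → τ c = 0)
    (hF : Definable B l F) (hG : Definable B l G) :
    DefinableRel B l (fun ρ v => coreMem B k L τ ρ (F ρ v) (G ρ v)) := by
  have h1 := definable_coreRank hB hl hτ hG
  have h2 := definable_coreLog hB hl hτ hG
  have h3 : Definable B l (fun ρ v => ρ (B + 1) (coreLog B τ ρ (G ρ v) - 1)) :=
    .read (by omega) (h2.sub (.const 1))
  exact DefinableRel.inWindow k L (g := fun ρ v => coreDigit B ρ (F ρ v))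
    (fun h => definable_coreDigit hB hl hF h) (.read (by omega) hG) h2 (h1.boundedDiv h3)
    (h1.boundedMod h3)

lemma definable_coreCodes (hl : B + 3 ≤ l) : Definable B l (fun ρ _ => coreCodes B k L ρ) :=
  .read (by omega) (.const _)

lemma definable_coreHorizon (hB : 4 ≤ B) (hl : B + 3 ≤ l) :
    Definable B l (fun ρ _ => coreHorizon B K ρ) := by
  have : Definable B l (fun ρ _ => ρ 0 0 + K) :=
    (Definable.read (a := 0) (by omega) (.const 0)).add (.const K)
  exact this.boundedMul (this.boundedMul this)

lemma definableRel_coreFinal (hB : 4 ≤ B) (hl : B + 3 ≤ l) (hτ : ∀ c, k ≤ c → τ c = 0)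
    (hF : Definable B l F) : DefinableRel B l (fun ρ v => coreFinal B k L τ ρ (F ρ v)) :=
  .finalCode (definableRel_coreAct hB hl hτ (.var 0))
    (fun h h' => definableRel_coreMem hB hl hτ h h') hF

lemma definable_coreCost (hB : 4 ≤ B) (hl : B + 3 ≤ l) (hτ : ∀ c, k ≤ c → τ c = 0)
    (hF : Definable B l F) : Definable B l (fun ρ v => coreCost B k L τ ρ (F ρ v)) :=
  .codeCost (definableRel_coreAct hB hl hτ (.var 0))
    (fun h h' => definableRel_coreMem hB hl hτ h h') hF

lemma definableRel_coreStep (hB : 4 ≤ B) (hl : B + 3 ≤ l) (hτ : ∀ c, k ≤ c → τ c = 0)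
    (hF : Definable B l F) (hF₁ : Definable B l F₁) (hF₂ : Definable B l F₂) :
    DefinableRel B l (fun ρ v => coreStep B k L τ ρ (F ρ v) (F₁ ρ v) (F₂ ρ v)) :=
  .codeStep (sz := fun ρ => ρ 2) (τ := fun ρ j => τ (ρ 3 j)) (C := fun ρ => ρ 1 0)
    (N := fun ρ => coreCodes B k L ρ) (definableRel_coreAct hB hl hτ (.var 0))
    (fun h h' => definableRel_coreMem hB hl hτ h h') (.read (by omega) (.var 0))
    (definable_ready hB hl hτ (.var 0)) (.read (by omega) (.const 0)) (definable_coreCodes hl)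
    hF hF₁ hF₂

lemma definable_powRule : Definable B (B + 1 + 1) (powRule B L) :=
  .ite (.eq (.var 0) (.const 0)) (.const 1)
    (.const_mul _ (.read (by omega) ((Definable.var 0).sub (.const 1))))

lemma definable_powSuccRule (hB : 4 ≤ B) : Definable B (B + 2 + 1) (powSuccRule B) :=
  .ite (.eq (.var 0) (.const 0)) (.const 1)
    (.boundedMul ((Definable.read (a := 0) (by omega) (.const 0)).add (.const 1))
      (.read (by omega) ((Definable.var 0).sub (.const 1))))

lemma definable_valueRule (hB : 4 ≤ B) (hτ : ∀ c, k ≤ c → τ c = 0) :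
    Definable B (B + 3 + 1) (valueRule B k L K τ) := by
  classical
  have hl : B + 3 ≤ B + 3 + 1 := by omega
  have hN := definable_coreCodes (B := B) (k := k) (L := L) hl
  have hd := (Definable.var (B := B) (k := B + 3 + 1) 0).boundedDiv hN
  have hm := (Definable.var (B := B) (k := B + 3 + 1) 0).boundedMod hN
  refine .ite (.eq hd (.const 0)) (.ite (definableRel_coreFinal hB hl hτ hm) (.const 0)
    (definable_size hl)) (.boundedFind (r := fun ρ v x => ∃ s' < ρ B 0,
    coreStep B k L τ ρ (coreHorizon B K ρ - (boundedDiv (ρ B 0) (v 0) (coreCodes B k L ρ) - 1))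
      (boundedMod (ρ B 0) (v 0) (coreCodes B k L ρ)) s' ∧
    coreCost B k L τ ρ (boundedMod (ρ B 0) (v 0) (coreCodes B k L ρ)) +
      ρ (B + 3) (boundedMul (ρ B 0) (boundedDiv (ρ B 0) (v 0) (coreCodes B k L ρ) - 1)
        (coreCodes B k L ρ) + s') ≤ x)
    (.ex (r := fun ρ v s' =>
    coreStep B k L τ ρ (coreHorizon B K ρ - (boundedDiv (ρ B 0) (v 1) (coreCodes B k L ρ) - 1))
      (boundedMod (ρ B 0) (v 1) (coreCodes B k L ρ)) s' ∧
    coreCost B k L τ ρ (boundedMod (ρ B 0) (v 1) (coreCodes B k L ρ)) +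
      ρ (B + 3) (boundedMul (ρ B 0) (boundedDiv (ρ B 0) (v 1) (coreCodes B k L ρ) - 1)
        (coreCodes B k L ρ) + s') ≤ v 0) ?_))
  have hd' := (Definable.var (B := B) (k := B + 3 + 1) 2).boundedDiv hN
  have hm' := (Definable.var (B := B) (k := B + 3 + 1) 2).boundedMod hN
  exact .and (definableRel_coreStep hB hl hτ ((definable_coreHorizon hB hl).sub (hd'.sub (.const 1)))
      hm' (.var 0))
    (.le ((definable_coreCost hB hl hτ hm').add (.read (by omega)
      (((hd'.sub (.const 1)).boundedMul hN).add (.var 0)))) (.var 1))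

lemma definable_pathRule (hB : 4 ≤ B) (hτ : ∀ c, k ≤ c → τ c = 0) :
    Definable B (B + 4 + 1) (pathRule B k L K τ) := by
  have hl : B + 3 ≤ B + 4 + 1 := by omega
  have hN := definable_coreCodes (B := B) (k := k) (L := L) hl
  have hT := definable_coreHorizon (K := K) hB hl
  have hp : Definable B (B + 4 + 1) (fun ρ w => ρ (B + 4) (w 1 - 1)) :=
    .read (by omega) ((Definable.var 1).sub (.const 1))
  refine .ite (.eq (.var 0) (.const 0))
    (.boundedFind (r := fun ρ _ s => ∀ j < ρ B 0, coreAct τ ρ j → ¬ coreMem B k L τ ρ s j)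
      (.all (r := fun ρ w j => coreAct τ ρ j → ¬ coreMem B k L τ ρ (w 0) j)
        (.imp (definableRel_coreAct hB hl hτ (.var 0))
          (.not (definableRel_coreMem hB hl hτ (.var 1) (.var 0))))))
    (.boundedFind (r := fun ρ v s' => coreStep B k L τ ρ (v 0) (ρ (B + 4) (v 0 - 1)) s' ∧
      coreCost B k L τ ρ (ρ (B + 4) (v 0 - 1)) +
        ρ (B + 3) (boundedMul (ρ B 0) (coreHorizon B K ρ - v 0) (coreCodes B k L ρ) + s') ≤
      ρ (B + 3) (boundedMul (ρ B 0) (coreHorizon B K ρ - (v 0 - 1)) (coreCodes B k L ρ) +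
        ρ (B + 4) (v 0 - 1)))
      (.and (definableRel_coreStep hB hl hτ (.var 1) hp (.var 0)) (.le
        ((definable_coreCost hB hl hτ hp).add (.read (by omega)
          (((hT.sub (.var 1)).boundedMul hN).add (.var 0))))
        (.read (by omega) (((hT.sub ((Definable.var 1).sub (.const 1))).boundedMul hN).add hp)))))

lemma definable_binRule (hB : 4 ≤ B) (hτ : ∀ c, k ≤ c → τ c = 0) :
    Definable B (B + 5) (binRule B k L K τ) := by
  classical
  have hl : B + 3 ≤ B + 5 := by omega
  exact .sum (H := fun ρ v b => if b < coreHorizon B K ρ + 1 ∧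
      ¬ coreMem B k L τ ρ (ρ (B + 4) b) (v 0) then 1 else 0)
    (.ite (.and (.lt (.var 0) ((definable_coreHorizon hB hl).add (.const 1)))
      (.not (definableRel_coreMem hB hl hτ (.read (by omega) (.var 0)) (.var 1))))
      (.const 1) (.const 0))

end definability

end

/-! ### Correctness of the tables -/

lemma FinalCode.congr {A : Finset ℕ} {mem mem' : ℕ → ℕ → Prop} {s : ℕ}
    (h : ∀ j ∈ A, (mem s j ↔ mem' s j)) : FinalCode A mem s ↔ FinalCode A mem' s :=
  forall₂_congr h

lemma codeCost.congr {A : Finset ℕ} {mem mem' : ℕ → ℕ → Prop} {s : ℕ}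
    (h : ∀ j ∈ A, (mem s j ↔ mem' s j)) : codeCost A mem s = codeCost A mem' s := by
  classical
  unfold codeCost
  congr 1
  exact Finset.filter_congr fun j hj => not_congr (h j hj)

lemma CodeStep.congr {A : Finset ℕ} {mem mem' : ℕ → ℕ → Prop} {sz τ : ℕ → ℕ} {C N b s s' : ℕ}
    (h : ∀ j ∈ A, (mem s j ↔ mem' s j)) (h' : s' < N → ∀ j ∈ A, (mem s' j ↔ mem' s' j)) :
    CodeStep A mem sz τ C N b s s' ↔ CodeStep A mem' sz τ C N b s s' := by
  classical
  unfold CodeStep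
  refine and_congr_right fun hs => ?_
  have h' := h' hs
  refine and_congr (forall₂_congr fun j hj => ?_) (and_congr (forall₂_congr fun j hj => ?_) ?_)
  · rw [h j hj, h' j hj]
  · rw [h j hj, h' j hj]
  · rw [Finset.filter_congr fun j hj => by rw [h j hj, h' j hj]]

section

variable {B k L K : ℕ} {τ : ℕ → ℕ} {ρ : RamState}

/-- These notions read only the input, the bound and the two tables of powers, so truncating a later
table does not change them. -/
lemma core_congr {ρ' : RamState} (hB : 4 ≤ B) (h : ∀ b < B + 3, ρ' b = ρ b) :
    coreCodes B k L ρ' = coreCodes B k L ρ ∧ coreHorizon B K ρ' = coreHorizon B K ρ ∧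
    coreMem B k L τ ρ' = coreMem B k L τ ρ ∧
    coreFinal B k L τ ρ' = coreFinal B k L τ ρ ∧ coreStep B k L τ ρ' = coreStep B k L τ ρ ∧
    coreCost B k L τ ρ' = coreCost B k L τ ρ := by
  have h0 := h 0 (by omega)
  have h1 := h 1 (by omega)
  have h2 := h 2 (by omega)
  have h3 := h 3 (by omega)
  have h4 := h B (by omega)
  have h5 := h (B + 1) (by omega)
  have h6 := h (B + 2) (by omega)
  have hact : coreAct τ ρ' = coreAct τ ρ := by
    funext j
    rw [coreAct, coreAct, h0, h3]
  have hset : coreSet B τ ρ' = coreSet B τ ρ := by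
    rw [coreSet, coreSet, activeSet, activeSet, hact, h4]
  have hrank : coreRank B τ ρ' = coreRank B τ ρ := by
    funext j
    rw [coreRank, coreRank, hset, h3, h2]
  have hlog : coreLog B τ ρ' = coreLog B τ ρ := by
    funext j
    rw [coreLog, coreLog, hrank, h4, h5]
  have hdig : coreDigit B ρ' = coreDigit B ρ := by
    funext s i
    rw [coreDigit, coreDigit, h4, h6, h0]
  have hmem : coreMem B k L τ ρ' = coreMem B k L τ ρ := by
    funext s j
    rw [coreMem, coreMem, hdig, hlog, hrank, h3, h4, h5]
  have hcodes : coreCodes B k L ρ' = coreCodes B k L ρ := by rw [coreCodes, coreCodes, h6]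
  refine ⟨hcodes, ?_, hmem, ?_, ?_, ?_⟩
  · rw [coreHorizon, coreHorizon, h4, h0]
  · funext s
    rw [coreFinal, coreFinal, hset, hmem]
  · funext b s s'
    rw [coreStep, coreStep, hset, hmem, h1, h2, h3, hcodes]
  · funext s
    rw [coreCost, coreCost, hset, hmem]

variable (B L) in
/-- The tables of powers are correct. -/
structure PowerTables (ρ : RamState) : Prop where
  lt : ρ 0 0 + 1 < ρ B 0
  pow : ∀ i < ρ B 0, ρ (B + 1) i = L ^ i
  pow_succ : ∀ i < ρ B 0, ρ (B + 2) i = (ρ 0 0 + 1) ^ i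

lemma powerTables_of_rules (hlt : ρ 0 0 + 1 < ρ B 0)
    (h1 : ∀ i < ρ B 0, ρ (B + 1) i = powRule B L (ρ.truncate (B + 1) i) (fun _ => i))
    (h2 : ∀ i < ρ B 0, ρ (B + 2) i = powSuccRule B (ρ.truncate (B + 2) i) (fun _ => i)) :
    PowerTables B L ρ := by
  refine ⟨hlt, fun i hi => ?_, fun i hi => ?_⟩
  · induction i with
    | zero => rw [h1 0 hi]; simp [powRule]
    | succ i ih =>
      rw [h1 _ hi]
      simp only [powRule, Nat.add_eq_zero_iff, one_ne_zero, and_false, if_false,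
        Nat.add_sub_cancel]
      rw [RamState.truncate_of_lt (Nat.lt_succ_self i), ih (by omega), pow_succ, mul_comm]
  · induction i with
    | zero => rw [h2 0 hi]; simp [powSuccRule]
    | succ i ih =>
      rw [h2 _ hi]
      simp only [powSuccRule, Nat.add_eq_zero_iff, one_ne_zero, and_false, if_false,
        Nat.add_sub_cancel]
      rw [RamState.truncate_of_lt (Nat.lt_succ_self i), ih (by omega),
        RamState.truncate_of_ne (by omega)]
      by_cases h0 : (0 : ℕ) = B + 2
      · omega
      -- Only the factor `n + 1` has to respect the bound; the powers may exceed it.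
      · rw [RamState.truncate_of_ne h0, boundedMul_eq hlt.le, pow_succ, mul_comm]

lemma mem_coreSet {j : ℕ} : j ∈ coreSet B τ ρ ↔ j < ρ B 0 ∧ j < ρ 0 0 ∧ τ (ρ 3 j) ≠ 0 := by
  simp [coreSet, activeSet, coreAct]

lemma card_coreSet_le : (coreSet B τ ρ).card ≤ ρ 0 0 := by
  refine (Finset.card_le_card fun j hj => ?_).trans (Finset.card_range _).le
  exact Finset.mem_range.2 (mem_coreSet.1 hj).2.1

/-- Codes and ranks are below the bound of the sums, so bounded division is exact, and only digits
covered by the table are used. -/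
lemma PowerTables.coreMem_iff (h : PowerTables B L ρ) (hL : 2 ≤ L) (hτ : ∀ c, k ≤ c → τ c = 0)
    (hM : k + 3 * k * L ^ 2 < ρ B 0) {s j : ℕ} (hs : s < ρ B 0) (hj : j ∈ coreSet B τ ρ) :
    coreMem B k L τ ρ s j ↔ CodeMem (coreSet B τ ρ) (ρ 3) (ρ 2) (ρ 0 0) k L s j := by
  have hk : ρ 3 j < k := by
    by_contra hcon
    exact (mem_coreSet.1 hj).2.2 (hτ _ (not_lt.1 hcon))
  have hlt := h.lt
  set r := coreRank B τ ρ j with hr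
  have hr1 : 1 ≤ r := Nat.le_add_left 1 _
  have hrn : r ≤ ρ 0 0 := by
    have := (ranking_itemRank (coreSet B τ ρ) (ρ 3) (ρ 2)).rank_le_card ⟨j, hj⟩
    rw [Fintype.card_coe] at this
    exact this.trans card_coreSet_le
  have hlog : coreLog B τ ρ j = Nat.log L r := tableLog_eq h.pow hL hr1 (by omega)
  have hlogr : Nat.log L r < r := Nat.log_lt_self L (by omega)
  have hw : ρ (B + 1) (Nat.log L r - 1) = groupWidth L r := by
    rw [h.pow _ (by omega), groupWidth]
  have hwpos := groupWidth_pos hL (r := r)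
  have hdig : ∀ i < k + 3 * k * L ^ 2,
      coreDigit B ρ s i = s / (ρ 0 0 + 1) ^ i % (ρ 0 0 + 1) := by
    intro i hi
    rw [coreDigit, h.pow_succ i (by omega), boundedDiv_eq hs (by positivity),
      boundedMod_eq ((Nat.div_le_self _ _).trans_lt hs) (by omega)]
  rw [coreMem, hlog, ← hr, hw, boundedDiv_eq (by omega) hwpos, boundedMod_eq (by omega) hwpos]
  exact ⟨fun h => InWindow.congr hdig hk (groupDigit_lt hL _) h,
    fun h => InWindow.congr (fun i hi => (hdig i hi).symm) hk (groupDigit_lt hL _) h⟩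

/-- Cell `x * N + s` stands for `x` remaining bins and the code `s`. A step has `s' < N`, so the
cell consulted for `x - 1` lies before the current one and is not truncated. -/
theorem PowerTables.value (h : PowerTables B L ρ) (hB : 4 ≤ B) (hL : 2 ≤ L)
    (hτ : ∀ c, k ≤ c → τ c = 0)
    (hM : k + 3 * k * L ^ 2 < ρ B 0) {T N : ℕ} (hN : coreCodes B k L ρ = N) (hN0 : 0 < N)
    (hT : coreHorizon B K ρ = T) (hTN : (T + 1) * N ≤ ρ B 0)
    (hW : ∀ i < ρ B 0, ρ (B + 3) i = valueRule B k L K τ (ρ.truncate (B + 3) i) (fun _ => i))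
    {x : ℕ} (hx : x ≤ T) {s : ℕ} (hs : s < N) :
    ρ (B + 3) (x * N + s) = chainValue (ρ B 0) T
      (FinalCode (coreSet B τ ρ) (CodeMem (coreSet B τ ρ) (ρ 3) (ρ 2) (ρ 0 0) k L))
      (CodeStep (coreSet B τ ρ) (CodeMem (coreSet B τ ρ) (ρ 3) (ρ 2) (ρ 0 0) k L) (ρ 2)
        (fun j => τ (ρ 3 j)) (ρ 1 0) N)
      (codeCost (coreSet B τ ρ) (CodeMem (coreSet B τ ρ) (ρ 3) (ρ 2) (ρ 0 0) k L)) x s := by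
  classical
  have hNM : N ≤ ρ B 0 := le_trans (Nat.le_mul_of_pos_left N (Nat.succ_pos T)) hTN
  have hmem : ∀ s < N, ∀ j ∈ coreSet B τ ρ, (coreMem B k L τ ρ s j ↔
      CodeMem (coreSet B τ ρ) (ρ 3) (ρ 2) (ρ 0 0) k L s j) := fun s hs j hj =>
    h.coreMem_iff hL hτ hM (hs.trans_le hNM) hj
  have hidx : ∀ x ≤ T, ∀ s < N, x * N + s < ρ B 0 := by
    intro x hx s hs
    have : x * N ≤ T * N := Nat.mul_le_mul_right _ hx
    rw [Nat.add_mul, one_mul] at hTN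
    omega
  have hrule : ∀ x ≤ T, ∀ s < N, ρ (B + 3) (x * N + s) =
      if x = 0 then open Classical in if coreFinal B k L τ ρ s then 0 else ρ B 0
      else boundedFind (ρ B 0) fun y => ∃ s' < ρ B 0, coreStep B k L τ ρ (T - (x - 1)) s s' ∧
        coreCost B k L τ ρ s + ρ.truncate (B + 3) (x * N + s) (B + 3) ((x - 1) * N + s') ≤ y := by
    intro x hx s hs
    have hi := hidx x hx s hs
    rw [hW _ hi]
    obtain ⟨h1, h2, -, h4, h5, h6⟩ := core_congr (ρ := ρ) (k := k) (L := L) (K := K) (τ := τ)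
      (ρ' := ρ.truncate (B + 3) (x * N + s)) hB
      fun b hb => RamState.truncate_of_ne (by omega)
    have hdiv : boundedDiv (ρ B 0) (x * N + s) N = x := by
      rw [boundedDiv_eq hi hN0, mul_comm, Nat.mul_add_div hN0, Nat.div_eq_of_lt hs, add_zero]
    have hmod : boundedMod (ρ B 0) (x * N + s) N = s := by
      rw [boundedMod_eq hi hN0, mul_comm, Nat.mul_add_mod, Nat.mod_eq_of_lt hs]
    have hx1 : x - 1 ≤ ρ B 0 := by
      have := Nat.le_mul_of_pos_right x hN0
      omega
    simp only [valueRule, h1, h2, h4, h5, h6, hN, hT,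
      RamState.truncate_of_ne (show B ≠ B + 3 by omega), hdiv, hmod, boundedMul_eq hx1]
  induction x generalizing s with
  | zero =>
    rw [hrule 0 hx s hs, if_pos rfl, chainValue]
    exact if_congr (FinalCode.congr (hmem s hs)) rfl rfl
  | succ x ih =>
    rw [hrule _ hx s hs, if_neg (by omega), chainValue]
    congr 1
    funext y
    simp only [Nat.add_sub_cancel]
    refine propext (exists_congr fun s' => and_congr_right fun _ => ?_)
    rw [coreStep, hN, CodeStep.congr (hmem s hs) (hmem s')]
    refine and_congr_right fun hst => ?_
    have hs' : s' < N := hst.1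
    rw [RamState.truncate_of_lt, ih (by omega) hs', coreCost, codeCost.congr (hmem s hs)]
    rw [Nat.add_mul, one_mul]
    omega

theorem PowerTables.path (h : PowerTables B L ρ) (hB : 4 ≤ B) (hL : 2 ≤ L)
    (hτ : ∀ c, k ≤ c → τ c = 0)
    (hM : k + 3 * k * L ^ 2 < ρ B 0) {T N : ℕ} (hN : coreCodes B k L ρ = N) (hN0 : 0 < N)
    (hT : coreHorizon B K ρ = T) (hTN : (T + 1) * N ≤ ρ B 0)
    (hW : ∀ i < ρ B 0, ρ (B + 3) i = valueRule B k L K τ (ρ.truncate (B + 3) i) (fun _ => i))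
    (hS : ∀ i < ρ B 0, ρ (B + 4) i = pathRule B k L K τ (ρ.truncate (B + 4) i) (fun _ => i))
    (hs₀ : ρ (B + 4) 0 < N)
    (hlt : chainValue (ρ B 0) T
      (FinalCode (coreSet B τ ρ) (CodeMem (coreSet B τ ρ) (ρ 3) (ρ 2) (ρ 0 0) k L))
      (CodeStep (coreSet B τ ρ) (CodeMem (coreSet B τ ρ) (ρ 3) (ρ 2) (ρ 0 0) k L) (ρ 2)
        (fun j => τ (ρ 3 j)) (ρ 1 0) N)
      (codeCost (coreSet B τ ρ) (CodeMem (coreSet B τ ρ) (ρ 3) (ρ 2) (ρ 0 0) k L)) T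
      (ρ (B + 4) 0) < ρ B 0)
    {b : ℕ} (hb : b ≤ T) :
    ρ (B + 4) b < N ∧ ρ (B + 4) b = chainPath (ρ B 0) T
      (FinalCode (coreSet B τ ρ) (CodeMem (coreSet B τ ρ) (ρ 3) (ρ 2) (ρ 0 0) k L))
      (CodeStep (coreSet B τ ρ) (CodeMem (coreSet B τ ρ) (ρ 3) (ρ 2) (ρ 0 0) k L) (ρ 2)
        (fun j => τ (ρ 3 j)) (ρ 1 0) N)
      (codeCost (coreSet B τ ρ) (CodeMem (coreSet B τ ρ) (ρ 3) (ρ 2) (ρ 0 0) k L))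
      (ρ (B + 4) 0) b := by
  have hNM : N ≤ ρ B 0 := le_trans (Nat.le_mul_of_pos_left N (Nat.succ_pos T)) hTN
  have hTM : T < ρ B 0 := le_trans (Nat.le_mul_of_pos_right (T + 1) hN0) hTN
  have hmem : ∀ s < N, ∀ j ∈ coreSet B τ ρ, (coreMem B k L τ ρ s j ↔
      CodeMem (coreSet B τ ρ) (ρ 3) (ρ 2) (ρ 0 0) k L s j) := fun s hs j hj =>
    h.coreMem_iff hL hτ hM (hs.trans_le hNM) hj
  obtain ⟨-, hpath, -⟩ := chainPath_spec hlt
  induction b with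
  | zero => exact ⟨hs₀, rfl⟩
  | succ b ih =>
    obtain ⟨ih1, ih2⟩ := ih (by omega)
    suffices heq : ρ (B + 4) (b + 1) = _ from ⟨by rw [heq]; exact (hpath b (by omega)).2.1, heq⟩
    obtain ⟨h1, h2, -, h4, h5, h6⟩ := core_congr (ρ := ρ) (k := k) (L := L) (K := K) (τ := τ)
      (ρ' := ρ.truncate (B + 4) (b + 1)) hB
      fun b hb => RamState.truncate_of_ne (by omega)
    rw [hS _ (by omega), chainPath, ← ih2]
    simp only [pathRule, h1, h2, h5, h6, hN, hT, Nat.add_eq_zero_iff, one_ne_zero, and_false,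
      if_false, Nat.add_sub_cancel, RamState.truncate_of_ne (show B ≠ B + 4 by omega),
      RamState.truncate_of_ne (show B + 3 ≠ B + 4 by omega),
      RamState.truncate_of_lt (Nat.lt_succ_self b)]
    congr 1
    funext s'
    rw [coreStep, hN, CodeStep.congr (hmem _ ih1) (hmem s')]
    refine propext (and_congr_right fun hst => ?_)
    have hs' : s' < N := hst.1
    rw [boundedMul_eq (by omega), boundedMul_eq (by omega),
      h.value hB hL hτ hM hN hN0 hT hTN hW (by omega) hs',
      h.value hB hL hτ hM hN hN0 hT hTN hW (by omega) ih1, coreCost, codeCost.congr (hmem _ ih1)]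

end

/-! ### The packing read off from the tables -/

section

variable {B k L K : ℕ} {τ : ℕ → ℕ} {ρ : RamState}

/-- The code that gives `n` as the lowest segment of every class describes the empty set, because
segment numbers are below `n`. The search returns a least such code, hence one no larger than this
witness. -/
lemma PowerTables.start_lt (h : PowerTables B L ρ) (hB : 4 ≤ B) (hL : 2 ≤ L)
    (hτ : ∀ c, k ≤ c → τ c = 0) (hM : k + 3 * k * L ^ 2 < ρ B 0)
    (hNM : (ρ 0 0 + 1) ^ (k + 3 * k * L ^ 2) ≤ ρ B 0)
    (hS : ∀ i < ρ B 0, ρ (B + 4) i = pathRule B k L K τ (ρ.truncate (B + 4) i) (fun _ => i)) :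
    ρ (B + 4) 0 < (ρ 0 0 + 1) ^ (k + 3 * k * L ^ 2) ∧ ∀ j ∈ coreSet B τ ρ,
      ¬ CodeMem (coreSet B τ ρ) (ρ 3) (ρ 2) (ρ 0 0) k L (ρ (B + 4) 0) j := by
  obtain ⟨s, hs, hdig⟩ := exists_code (ρ 0 0) (k + 3 * k * L ^ 2)
    (fun i => if i < k then ρ 0 0 else 0) (fun i => by split_ifs <;> omega)
  have hsM := hs.trans_le hNM
  have hmem : ∀ s < ρ B 0, ∀ j ∈ coreSet B τ ρ, (coreMem B k L τ ρ s j ↔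
      CodeMem (coreSet B τ ρ) (ρ 3) (ρ 2) (ρ 0 0) k L s j) := fun s hs j hj =>
    h.coreMem_iff hL hτ hM hs hj
  have h1 : ∀ j ∈ coreSet B τ ρ, ¬ CodeMem (coreSet B τ ρ) (ρ 3) (ρ 2) (ρ 0 0) k L s j := by
    intro j hj hcon
    have hk : ρ 3 j < k := by
      by_contra hcon
      exact (mem_coreSet.1 hj).2.2 (hτ _ (not_lt.1 hcon))
    have := InWindow.congr hdig hk (groupDigit_lt hL _) hcon
    have hlog : Nat.log L (itemRank (coreSet B τ ρ) (ρ 3) (ρ 2) j) < ρ 0 0 := by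
      have := (ranking_itemRank (coreSet B τ ρ) (ρ 3) (ρ 2)).log_lt_card (L := L) ⟨j, hj⟩
      rw [Fintype.card_coe] at this
      exact this.trans_le card_coreSet_le
    simp only [InWindow, hk, if_true] at this
    omega
  have hS0 := hS 0 (by omega)
  obtain ⟨-, -, h3, -⟩ := core_congr (ρ := ρ) (k := k) (L := L) (K := K) (τ := τ)
    (ρ' := ρ.truncate (B + 4) 0) hB fun b hb => RamState.truncate_of_ne (by omega)
  have hact : coreAct τ (ρ.truncate (B + 4) 0) = coreAct τ ρ := by
    funext j
    rw [coreAct, coreAct, RamState.truncate_of_ne (by omega), RamState.truncate_of_ne (by omega)]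
  simp only [pathRule, if_true, h3, hact, RamState.truncate_of_ne (show B ≠ B + 4 by omega)] at hS0
  obtain ⟨h4, h5, h6⟩ := boundedFind_spec (M := ρ B 0)
    (p := fun s => ∀ j < ρ B 0, coreAct τ ρ j → ¬ coreMem B k L τ ρ s j)
    ⟨s, hsM, fun j hj ha hm => by
      have hjA : j ∈ coreSet B τ ρ := mem_coreSet.2 ⟨hj, ha⟩
      exact h1 j hjA ((hmem s hsM j hjA).1 hm)⟩
  rw [← hS0] at h4 h5 h6
  refine ⟨lt_of_le_of_lt ?_ hs, fun j hj hm => ?_⟩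
  · by_contra hcon
    refine h6 s (not_le.1 hcon) fun j hj ha hm => ?_
    have hjA : j ∈ coreSet B τ ρ := mem_coreSet.2 ⟨hj, ha⟩
    exact h1 j hjA ((hmem s hsM j hjA).1 hm)
  · exact h5 j (mem_coreSet.1 hj).1 (mem_coreSet.1 hj).2 ((hmem _ h4 j hj).2 hm)

/-- The horizon `(n + K) ^ 3` is at least twice `n * (n + K)`, so it suffices for competitors of
cost up to `n * (n + K)`. The packing with item `j` alone in bin `K + j` is such a competitor: it
shows that the value is below the bound, and it settles the comparison with more expensive packings.
-/
theorem PowerTables.packing (h : PowerTables B L ρ) {H Q D : ℕ} {δ : ℝ} (hB : 4 ≤ B)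
    (hD : 1 ≤ D) (hQ : Q = 11 * (D + 1)) (hLQ : 2 * Q ≤ L) (hH : 2 ≤ H) (hHL : H + 1 ≤ L)
    (hδ : (1 : ℝ) / D + 4 * Q / H + 4 * Q ^ 4 * H / L ≤ δ) (hδ1 : δ ≤ 1)
    (hτ : ∀ c, k ≤ c → τ c = 0) (hτD : ∀ c, τ c ≤ D) (hDK : D ≤ K) (hK : 2 ≤ K)
    (hM : k + 3 * k * L ^ 2 < ρ B 0)
    (hTN : ((ρ 0 0 + K) ^ 3 + 1) * (ρ 0 0 + 1) ^ (k + 3 * k * L ^ 2) ≤ ρ B 0)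
    (hW : ∀ i < ρ B 0, ρ (B + 3) i = valueRule B k L K τ (ρ.truncate (B + 3) i) (fun _ => i))
    (hS : ∀ i < ρ B 0, ρ (B + 4) i = pathRule B k L K τ (ρ.truncate (B + 4) i) (fun _ => i))
    (hO : ∀ i < ρ B 0, ρ (B + 5) i = binRule B k L K τ ρ (fun _ => i))
    (hsz : ∀ j ∈ coreSet B τ ρ, ρ 2 j ≤ ρ 1 0) :
    (∀ j ∈ coreSet B τ ρ, τ (ρ 3 j) ≤ ρ (B + 5) j) ∧
    (∀ b, ∑ j ∈ coreSet B τ ρ with ρ (B + 5) j = b, ρ 2 j ≤ ρ 1 0) ∧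
    ∀ q : ℕ → ℕ, (∀ j ∈ coreSet B τ ρ, τ (ρ 3 j) ≤ q j) →
      (∀ b, ∑ j ∈ coreSet B τ ρ with q j = b, ρ 2 j ≤ ρ 1 0) →
      ((∑ j ∈ coreSet B τ ρ, ρ (B + 5) j : ℕ) : ℝ) ≤
        (1 + δ) * ((∑ j ∈ coreSet B τ ρ, q j : ℕ) : ℝ) := by
  classical
  have hL : 2 ≤ L := by omega
  set n := ρ 0 0 with hn
  set A := coreSet B τ ρ with hA
  set N := (n + 1) ^ (k + 3 * k * L ^ 2) with hNdef
  set T := (n + K) ^ 3 with hTdef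
  have hN0 : 0 < N := by positivity
  have hNM : N ≤ ρ B 0 := le_trans (Nat.le_mul_of_pos_left N (Nat.succ_pos T)) hTN
  have hTM : T < ρ B 0 := le_trans (Nat.le_mul_of_pos_right (T + 1) hN0) hTN
  have hXT : n + K ≤ T := Nat.le_self_pow (by norm_num) _
  have hcodes : coreCodes B k L ρ = N := h.pow_succ _ hM
  have hhor : coreHorizon B K ρ = T := by
    rw [coreHorizon, boundedMul_eq (by omega), boundedMul_eq (by omega), hTdef]
    ring
  obtain ⟨hs0, hs0mem⟩ := h.start_lt hB hL hτ hM hNM hS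
  have hpos : ∀ j ∈ A, 1 ≤ τ (ρ 3 j) := fun j hj =>
    Nat.one_le_iff_ne_zero.2 (mem_coreSet.1 hj).2.2
  have hcard : A.card ≤ n := card_coreSet_le
  have hchain : ∀ q : ℕ → ℕ, (∀ j ∈ A, τ (ρ 3 j) ≤ q j) →
      (∀ b, ∑ j ∈ A with q j = b, ρ 2 j ≤ ρ 1 0) → ∑ j ∈ A, q j ≤ n * (n + K) → _ :=
    fun q hq1 hq2 hq3 => exists_chain (A := A) (lab := ρ 3) (sz := ρ 2) (n := n) (k := k)
      (C := ρ 1 0) (τ := τ) (p := q) (δ := δ) (T := T) (M := ρ B 0) (N := N) (s₀ := ρ (B + 4) 0)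
      hD hQ hLQ hH hHL hδ hcard
      (fun j hj => by
        by_contra hcon
        exact (mem_coreSet.1 hj).2.2 (hτ _ (not_lt.1 hcon)))
      hτD (fun j hj => (hpos j hj).trans (hq1 j hj)) hq1 hq2 le_rfl hNM (by
        have h1 : 2 * (n * (n + K)) ≤ T := by
          have h2 : 2 * n * (n + K) ≤ (n + K) * (n + K) * (n + K) :=
            Nat.mul_le_mul_right _ (Nat.mul_le_mul (by omega) (by omega))
          rw [hTdef]
          calc 2 * (n * (n + K)) = 2 * n * (n + K) := by ring
            _ ≤ _ := h2
            _ = _ := by ring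
        have h3 : (1 + δ) * ((∑ j ∈ A, q j : ℕ) : ℝ) ≤ 2 * ((∑ j ∈ A, q j : ℕ) : ℝ) :=
          mul_le_mul_of_nonneg_right (by linarith) (Nat.cast_nonneg _)
        refine h3.trans ?_
        have : 2 * (∑ j ∈ A, q j) ≤ T := by omega
        exact_mod_cast this) hTM hs0mem
  have hq0 : ∑ j ∈ A, (K + j) ≤ n * (n + K) := by
    calc ∑ j ∈ A, (K + j) ≤ ∑ _j ∈ A, (n + K) := Finset.sum_le_sum fun j hj => by
          have := (mem_coreSet.1 hj).2.1
          omega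
      _ = A.card * (n + K) := by rw [Finset.sum_const, smul_eq_mul]
      _ ≤ n * (n + K) := Nat.mul_le_mul_right _ hcard
  obtain ⟨hv1, hv2⟩ := hchain (fun j => K + j) (fun j _ => (hτD _).trans (by omega)) (fun b => by
    rcases (A.filter fun j => K + j = b).eq_empty_or_nonempty with he | ⟨j, hj⟩
    · rw [he]; simp
    · obtain ⟨h1, h2⟩ := Finset.mem_filter.1 hj
      have : A.filter (fun j => K + j = b) = {j} := by
        refine Finset.eq_singleton_iff_unique_mem.2 ⟨hj, fun i hi => ?_⟩
        have := (Finset.mem_filter.1 hi).2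
        omega
      rw [this, Finset.sum_singleton]
      exact hsz j h1) hq0
  have hpath := fun b (hb : b ≤ T) =>
    h.path hB hL hτ hM hcodes hN0 hhor hTN hW hS hs0 hv2 (b := b) hb
  have hout : ∀ j ∈ A, ρ (B + 5) j = chainBin (CodeMem A (ρ 3) (ρ 2) n k L) T
      (chainPath (ρ B 0) T (FinalCode A (CodeMem A (ρ 3) (ρ 2) n k L))
        (CodeStep A (CodeMem A (ρ 3) (ρ 2) n k L) (ρ 2) (fun j => τ (ρ 3 j)) (ρ 1 0) N)
        (codeCost A (CodeMem A (ρ 3) (ρ 2) n k L)) (ρ (B + 4) 0)) j := by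
    intro j hj
    rw [hO j (mem_coreSet.1 hj).1, binRule, chainBin, hhor, Finset.card_filter,
      ← Finset.sum_filter, ← Finset.sum_filter, Finset.sum_const, Finset.sum_const]
    congr 2
    ext b
    simp only [Finset.mem_filter, Finset.mem_range]
    constructor
    · rintro ⟨-, h1, h2⟩
      obtain ⟨h3, h4⟩ := hpath b (by omega)
      refine ⟨h1, fun hm => h2 ?_⟩
      rw [← h4] at hm
      exact (h.coreMem_iff hL hτ hM (h3.trans_le hNM) hj).2 hm
    · rintro ⟨h1, h2⟩
      obtain ⟨h3, h4⟩ := hpath b (by omega)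
      refine ⟨by omega, h1, fun hm => h2 ?_⟩
      rw [← h4]
      exact (h.coreMem_iff hL hτ hM (h3.trans_le hNM) hj).1 hm
  obtain ⟨hc1, hc2, hc3⟩ := chainBin_spec hs0mem hv2
  refine ⟨fun j hj => by rw [hout j hj]; exact hc1 j hj, fun b => ?_, fun q hq1 hq2 => ?_⟩
  · rw [Finset.filter_congr fun j hj => by rw [hout j hj]]
    exact hc2 b
  · rw [Finset.sum_congr rfl hout]
    have hc3' := (Nat.cast_le (α := ℝ)).2 hc3
    have hδ0 : 0 ≤ δ := le_trans (by positivity) hδ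
    by_cases hq3 : ∑ j ∈ A, q j ≤ n * (n + K)
    · exact hc3'.trans (hchain q hq1 hq2 hq3).1
    · refine (hc3'.trans hv1).trans (mul_le_mul_of_nonneg_left ?_ (by linarith))
      exact_mod_cast hq0.trans (not_le.1 hq3).le

end

/-- The choice is made in the order `D`, `H`, `L`: each quotient is made at most `δ / 3` by its own
denominator, once the quantities in its numerator are fixed. -/
lemma exists_parameters {δ : ℝ} (hδ : 0 < δ) (K : ℕ) : ∃ D Q H L : ℕ, K ≤ D ∧ 1 ≤ D ∧
    Q = 11 * (D + 1) ∧ 2 * Q ≤ L ∧ 2 ≤ H ∧ H + 1 ≤ L ∧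
    (1 : ℝ) / D + 4 * Q / H + 4 * Q ^ 4 * H / L ≤ δ := by
  have key : ∀ x : ℝ, 0 ≤ x → ∀ m : ℕ, ∃ y : ℕ, m ≤ y ∧ 1 ≤ y ∧ x / y ≤ δ / 3 := by
    intro x hx m
    obtain ⟨z, hz⟩ := exists_nat_ge (x / (δ / 3))
    refine ⟨max (max m 1) z, by omega, by omega, ?_⟩
    have h1 : (1 : ℝ) ≤ (max (max m 1) z : ℕ) := by
      exact_mod_cast (by omega : 1 ≤ max (max m 1) z)
    have h2 : (z : ℝ) ≤ (max (max m 1) z : ℕ) := by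
      exact_mod_cast (by omega : z ≤ max (max m 1) z)
    rw [div_le_iff₀ (by positivity)] at hz ⊢
    nlinarith
  obtain ⟨D, hD1, hD2, hD3⟩ := key 1 zero_le_one K
  obtain ⟨H, hH1, -, hH3⟩ := key (4 * ((11 * (D + 1) : ℕ) : ℝ)) (by positivity) 2
  obtain ⟨L, hL1, -, hL3⟩ := key (4 * ((11 * (D + 1) : ℕ) : ℝ) ^ 4 * H) (by positivity)
    (2 * (11 * (D + 1)) + H + 1)
  exact ⟨D, _, H, L, hD1, hD2, rfl, by omega, hH1, by omega, by linarith⟩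

/-- The machine computes nearly optimal packings of the items with a positive ready time, where the
ready time depends on the label. -/
theorem exists_packing_program (k : ℕ) (τ : ℕ → ℕ) (hτ : ∀ c, k ≤ c → τ c = 0) {δ : ℝ}
    (hδ : 0 < δ) (base : ℕ) (hbase : 4 ≤ base) :
    ∃ P g o, PolyBounded g ∧ base ≤ o ∧ ∀ σ : RamState, ∃ σ' T, RamRun P σ σ' T ∧ T ≤ g (σ 0 0) ∧
      (∀ b < base, σ' b = σ b) ∧
      ∀ A : Finset ℕ, (∀ j, j ∈ A ↔ j < σ 0 0 ∧ τ (σ 3 j) ≠ 0) → (∀ j ∈ A, σ 2 j ≤ σ 1 0) →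
        (∀ j ∈ A, τ (σ 3 j) ≤ σ' o j) ∧ (∀ b, ∑ j ∈ A with σ' o j = b, σ 2 j ≤ σ 1 0) ∧
        ∀ q : ℕ → ℕ, (∀ j ∈ A, τ (σ 3 j) ≤ q j) → (∀ b, ∑ j ∈ A with q j = b, σ 2 j ≤ σ 1 0) →
          ((∑ j ∈ A, σ' o j : ℕ) : ℝ) ≤ (1 + δ) * ((∑ j ∈ A, q j : ℕ) : ℝ) := by
  obtain ⟨D, Q, H, L, hKD, hD, hQ, hLQ, hH, hHL, hpar⟩ :=
    exists_parameters (δ := min δ 1) (lt_min hδ one_pos) (∑ c ∈ Finset.range k, τ c)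
  have hτD : ∀ c, τ c ≤ D := by
    intro c
    rcases lt_or_ge c k with h | h
    · exact (Finset.single_le_sum (f := τ) (fun _ _ => Nat.zero_le _)
        (Finset.mem_range.2 h)).trans hKD
    · rw [hτ c h]; omega
  set NN := k + 3 * k * L ^ 2 with hNN
  -- `D ≤ K` makes all bins from `K` on available to every class, and `NN ≤ K` puts all digit
  -- indices below the bound.
  set K := NN + D + 2 with hK
  set B := base + (NN + 4) with hB
  -- The exponent `NN` accounts for the number of codes and 4 for the number of possible values of
  -- remaining bins; the exponent `2 ^ (NN + 4)` obtained by squaring is larger than their sum.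
  obtain ⟨P₁, g₁, hg₁, hP₁⟩ := exists_large_number base K (NN + 4)
  obtain ⟨P₂, g₂, hg₂, hP₂⟩ := exists_fill_list (B := B)
    [fun σ v => powRule B L (σ.truncate (B + 1) (v 0)) v,
      fun σ v => powSuccRule B (σ.truncate (B + 2) (v 0)) v,
      fun σ v => valueRule B k L K τ (σ.truncate (B + 3) (v 0)) v,
      fun σ v => pathRule B k L K τ (σ.truncate (B + 4) (v 0)) v, binRule B k L K τ] (B + 1)
    (by omega) (by
      have h0 : FillRule B (B + 1) (fun σ v => powRule B L (σ.truncate (B + 1) (v 0)) v) :=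
        .truncate (by omega) definable_powRule
      have h1 : FillRule B (B + 2) (fun σ v => powSuccRule B (σ.truncate (B + 2) (v 0)) v) :=
        .truncate (by omega) (definable_powSuccRule (by omega))
      have h2 : FillRule B (B + 3) (fun σ v => valueRule B k L K τ (σ.truncate (B + 3) (v 0)) v) :=
        .truncate (by omega) (definable_valueRule (by omega) hτ)
      have h3 : FillRule B (B + 4) (fun σ v => pathRule B k L K τ (σ.truncate (B + 4) (v 0)) v) :=
        .truncate (by omega) (definable_pathRule (by omega) hτ)
      have h4 : FillRule B (B + 5) (binRule B k L K τ) :=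
        .of_definable (by omega) (definable_binRule (by omega) hτ)
      intro j hj
      match j, hj with
      | 0, _ => exact h0
      | 1, _ => exact h1
      | 2, _ => exact h2
      | 3, _ => exact h3
      | 4, _ => exact h4)
  refine ⟨.seq P₁ P₂, fun n => g₁ n + g₂ ((n + (K + 1)) ^ 2 ^ (NN + 4)), B + 5,
    hg₁.add (hg₂.comp ((PolyBounded.id.add (.const _)).pow _)), by omega, fun σ => ?_⟩
  obtain ⟨σ₁, T₁, r₁, l₁, a₁, e₁⟩ := hP₁ σ
  obtain ⟨ρ, T₂, r₂, l₂, a₂, e₂⟩ := hP₂ σ₁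
  have hlow : ∀ b < base, ρ b = σ b := fun b hb => by rw [a₂ b (by omega), a₁ b hb]
  have hM : ρ B 0 = (σ 0 0 + (K + 1)) ^ 2 ^ (NN + 4) := by rw [a₂ B (by omega), e₁]
  rw [e₁] at l₂
  refine ⟨ρ, _, .seq r₁ r₂, add_le_add l₁ l₂, hlow, fun A hA hsz => ?_⟩
  have hM₁ : σ₁ B 0 = ρ B 0 := by rw [a₂ B (by omega)]
  rw [hM₁] at e₂
  have h0 := hlow 0 (by omega)
  have h1 := hlow 1 (by omega)
  have h2 := hlow 2 (by omega)
  have h3 := hlow 3 (by omega)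
  have hbig : (σ 0 0 + (K + 1)) ^ (NN + 4) ≤ ρ B 0 := by
    rw [hM]
    exact Nat.pow_le_pow_right (by omega) (Nat.lt_two_pow_self).le
  have hbig1 : σ 0 0 + (K + 1) ≤ ρ B 0 := (Nat.le_self_pow (by omega) _).trans hbig
  have htab : PowerTables B L ρ := powerTables_of_rules (by rw [h0]; omega)
    (e₂ 0 (by simp)) (e₂ 1 (by simp))
  have hcore : coreSet B τ ρ = A := by
    ext j
    rw [mem_coreSet, hA, h0, h3]
    constructor
    · exact fun h => h.2
    · exact fun h => ⟨by omega, h⟩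
  have key := htab.packing (k := k) (K := K) (τ := τ) (by omega) hD hQ hLQ hH hHL hpar
    (min_le_right _ _) hτ hτD (by omega) (by omega) (by omega) (by
      rw [h0]
      refine le_trans ?_ hbig
      have h4 : (σ 0 0 + K) ^ 3 + 1 ≤ (σ 0 0 + (K + 1)) ^ 4 := by
        have h5 : (σ 0 0 + K) ^ 3 < (σ 0 0 + (K + 1)) ^ 3 :=
          Nat.pow_lt_pow_left (by omega) (by norm_num)
        exact h5.trans_le (Nat.pow_le_pow_right (by omega) (by omega))
      have h6 : (σ 0 0 + 1) ^ (k + 3 * k * L ^ 2) ≤ (σ 0 0 + (K + 1)) ^ NN :=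
        Nat.pow_le_pow_left (by omega) _
      calc _ ≤ (σ 0 0 + (K + 1)) ^ 4 * (σ 0 0 + (K + 1)) ^ NN := Nat.mul_le_mul h4 h6
        _ = _ := by rw [← pow_add, Nat.add_comm 4])
    (e₂ 2 (by simp)) (e₂ 3 (by simp)) (e₂ 4 (by simp)) (by rw [hcore, h1, h2]; exact hsz)
  rw [hcore, h1, h2, h3] at key
  refine ⟨key.1, key.2.1, fun q hq1 hq2 => (key.2.2 q hq1 hq2).trans ?_⟩
  exact mul_le_mul_of_nonneg_right (by have := min_le_left δ 1; linarith) (Nat.cast_nonneg _)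

/-! ## Minsum bin packing -/

section

variable {n C : ℕ} {size label : Fin n → ℕ}

lemma ramInput_size (j : Fin n) : ramInput n C size label 2 j = size j := by
  simp [ramInput]

lemma ramInput_label (j : Fin n) : ramInput n C size label 3 j = label j := by
  simp [ramInput]

end

/-- A function on `Fin n`, extended by zero. -/
def extendZero {n : ℕ} (q : Fin n → ℕ) (j : ℕ) : ℕ := if h : j < n then q ⟨j, h⟩ else 0

lemma extendZero_apply {n : ℕ} (q : Fin n → ℕ) (j : Fin n) : extendZero q j = q j := by
  simp [extendZero]

lemma PackingInstance.cost_eq_sum {n : ℕ} (p : Fin n → ℕ) : PackingInstance.cost p = ∑ j, p j := by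
  rw [PackingInstance.cost, ← Finset.sum_fiberwise_of_maps_to
    (fun j hj => Finset.mem_image_of_mem p hj)]
  refine Finset.sum_congr rfl fun b _ => ?_
  rw [PackingInstance.bin, Finset.sum_congr rfl fun j hj => (Finset.mem_filter.1 hj).2,
    Finset.sum_const, smul_eq_mul, mul_comm]

lemma PackingInstance.exists_feasible_cost_eq_opt {k n : ℕ} {I : PackingInstance k n} {τ : Fin k → ℕ}
    {p : Fin n → ℕ} (hp : I.Feasible τ p) :
    ∃ q, I.Feasible τ q ∧ PackingInstance.cost q = I.opt τ :=
  Nat.sInf_mem (s := {x | ∃ q : Fin n → ℕ, I.Feasible τ q ∧ PackingInstance.cost q = x})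
    ⟨_, p, hp, rfl⟩

lemma constD_pos (k t : ℕ) : 0 < constD k t := by
  have h1 : 0 ≤ constC k t := Finset.sum_nonneg fun i _ => by positivity
  have h2 : 0 < constC1 k := by unfold constC1; positivity
  unfold constD
  positivity

/-- Positive ready times make every item active, so the general packing program applies; a second
program copies its result into array 4. -/
theorem exists_bin_packing_program (k : ℕ) (τ : Fin k → ℕ) (hτ : ∀ i, 1 ≤ τ i) {δ : ℝ}
    (hδ : 0 < δ) : ∃ (P : RamProgram) (a b : ℕ), ∀ (n : ℕ) (I : PackingInstance k n),
      ∃ (σ : RamState) (T : ℕ), RamRun P I.input σ T ∧ T ≤ a * (n + 1) ^ b ∧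
        I.Feasible τ (ramPacking n σ) ∧
        (PackingInstance.cost (ramPacking n σ) : ℝ) ≤ (1 + δ) * (I.opt τ : ℝ) := by
  obtain ⟨P, g, o, hg, ho, hP⟩ := exists_packing_program k (extendZero τ)
    (fun c hc => by simp [extendZero, not_lt.2 hc]) hδ 5 (by norm_num)
  have hd : Definable 0 (o + 1) (fun σ v => σ o (v 0)) := .read (by omega) (.var 0)
  obtain ⟨P', g', hg', hP'⟩ := exists_fill (B := 0) (a := 4) (s := o + 1) (by omega) (by omega)
    (by omega) hd (fun σ τ i h _ => by rw [h o (by omega) (by omega)])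
  obtain ⟨a, b, hab⟩ := hg.add hg'
  refine ⟨.seq P P', a, b, fun n I => ?_⟩
  obtain ⟨σ₁, T₁, r₁, l₁, a₁, e₁⟩ := hP I.input
  obtain ⟨σ₂, T₂, r₂, l₂, a₂, e₂⟩ := hP' σ₁
  have hn : σ₁ 0 0 = n := by rw [a₁ 0 (by omega)]; rfl
  have hn' : I.input 0 0 = n := rfl
  rw [hn] at l₂ e₂
  rw [hn'] at l₁
  have hτ3 : ∀ j : Fin n, extendZero τ (I.input 3 j) = τ (I.cls j) := fun j => by
    rw [PackingInstance.input, ramInput_label, extendZero_apply]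
  have hs : ∀ j : Fin n, I.input 2 j = I.size j := fun j => ramInput_size j
  obtain ⟨h1, h2, h3⟩ := e₁ (Finset.range n) (fun j => by
      rw [Finset.mem_range, hn']
      refine ⟨fun hj => ⟨hj, ?_⟩, fun h => h.1⟩
      have := hτ3 ⟨j, hj⟩
      have := hτ (I.cls ⟨j, hj⟩)
      simp only at *
      omega)
    (fun j hj => by
      have := I.size_le ⟨j, Finset.mem_range.1 hj⟩
      rw [← hs] at this
      exact this)
  have hp : ∀ j : Fin n, ramPacking n σ₂ j = σ₁ o j := fun j => by
    rw [ramPacking, e₂ j j.2, a₂ o (by omega) (by omega)]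
  have hbin : ∀ (q : ℕ → ℕ) (q' : Fin n → ℕ), (∀ j, q' j = q j) → ∀ b,
      ∑ j ∈ Finset.range n with q j = b, I.input 2 j = ∑ j ∈ PackingInstance.bin q' b, I.size j := by
    intro q q' hq b
    rw [PackingInstance.bin, Finset.sum_filter, Finset.sum_filter, Finset.sum_range]
    simp only [hs, hq]
  have hfeas : I.Feasible τ (ramPacking n σ₂) := by
    refine ⟨fun j => ?_, fun b => ?_⟩
    · rw [hp, ← hτ3]
      exact h1 j (Finset.mem_range.2 j.2)
    · rw [← hbin _ _ hp]
      exact h2 b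
  refine ⟨σ₂, _, .seq r₁ r₂, (add_le_add l₁ l₂).trans (hab n), hfeas, ?_⟩
  obtain ⟨q, hq, hcost⟩ := PackingInstance.exists_feasible_cost_eq_opt hfeas
  have key := h3 (extendZero q)
    (fun j hj => by
      have h := hq.1 ⟨j, Finset.mem_range.1 hj⟩
      rw [← hτ3, ← extendZero_apply q] at h
      exact h)
    (fun b => by
      rw [hbin _ q fun j => (extendZero_apply q j).symm]
      exact hq.2 b)
  rw [← hcost, PackingInstance.cost_eq_sum, PackingInstance.cost_eq_sum]
  rw [Finset.sum_range, Finset.sum_range] at key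
  simp only [extendZero_apply] at key
  simpa only [hp] using key

/-! ## Flows to a single facility -/

namespace FlowInstance

variable {V : Type} {n : ℕ} {I : FlowInstance V n} {D : GroupFlow V n} {f : V}

lemma arrivalTime_le (hfac : I.facilities = {f}) {g : Fin n} {t : ℕ} (h : g ∈ I.present D t f) :
    I.arrivalTime D g ≤ t :=
  Nat.sInf_le ⟨f, by rw [hfac]; rfl, h⟩

lemma Feasible.mem_present_arrivalTime (hD : I.Feasible D) (hfac : I.facilities = {f})
    (g : Fin n) : g ∈ I.present D (I.arrivalTime D g) f := by
  obtain ⟨v, hv, h⟩ := Nat.sInf_mem (s := {t | ∃ v ∈ I.facilities, g ∈ I.present D t v}) (hD.reaches g)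
  rw [hfac, Set.mem_singleton_iff] at hv
  rw [← hv]
  exact h

lemma exists_feasible_cost_eq_opt (hD : I.Feasible D) :
    ∃ D', I.Feasible D' ∧ I.cost D' = I.opt :=
  Nat.sInf_mem (s := {x | ∃ D : GroupFlow V n, I.Feasible D ∧ I.cost D = x}) ⟨_, D, hD, rfl⟩

/-- The flow in which every group moves along its route without delay, so as to be at `f` at the
time `p g`. -/
theorem feasible_of_schedule (hfac : I.facilities = {f}) {next : V → V} {δ : V → ℕ}
    {route : V → V → Prop} {p : Fin n → ℕ} {C : ℕ}
    (hadj : ∀ u, u ≠ f → I.graph.Adj u (next u))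
    (hδ : ∀ u, u ≠ f → δ u = I.distance s(u, next u) + δ (next u)) (hδf : δ f = 0)
    (hpre : ∀ h u, route h u → u = h ∨ ∃ u', u' ≠ f ∧ route h u' ∧ next u' = u)
    (hroute : ∀ h, route h f) (hle : ∀ h u, route h u → δ u ≤ δ h)
    (hp : ∀ g, δ (I.home g) ≤ p g)
    (hcap : ∀ e ∈ I.graph.edgeSet, I.capacity e = C)
    (hload : ∀ u b (S : Finset (Fin n)), u ≠ f → (∀ g ∈ S, route (I.home g) u ∧ p g = b) →
      ∑ g ∈ S, I.size g ≤ C)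
    (hD : ∀ u v t g, g ∈ D u v t ↔ u ≠ f ∧ v = next u ∧ route (I.home g) u ∧ t + δ u = p g) :
    I.Feasible D ∧ ∀ g, I.arrivalTime D g ≤ p g := by
  -- A group stays at home until the remaining travel time just suffices, and then passes `u` at the
  -- time `p g - δ u`.
  have hpres : ∀ g u, route (I.home g) u → g ∈ I.present D (p g - δ u) u := by
    intro g u hu
    rcases hpre _ _ hu with rfl | ⟨u', hu', hr, rfl⟩
    · have key : ∀ t, t + δ (I.home g) ≤ p g → g ∈ I.present D t (I.home g) := by
        intro t
        induction t with
        | zero => exact fun _ => rfl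
        | succ t ih =>
          intro ht
          refine Or.inl ⟨ih (by omega), fun hmem => ?_⟩
          obtain ⟨v, hv⟩ := Set.mem_iUnion.1 hmem
          have := ((hD _ _ _ _).1 hv).2.2.2
          omega
      exact key _ (by have := hp g; omega)
    · have h1 := hδ u' hu'
      have h2 := (hle _ _ hr).trans (hp g)
      have h3 := I.distance_pos _ ((SimpleGraph.mem_edgeSet _).2 (hadj u' hu'))
      obtain ⟨t, ht⟩ : ∃ t, p g - δ (next u') = t + 1 := ⟨p g - δ (next u') - 1, by omega⟩
      rw [ht]
      refine Or.inr (Set.mem_iUnion.2 ⟨u', hadj u' hu', by omega, ?_⟩)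
      exact (hD _ _ _ _).2 ⟨hu', rfl, hr, by omega⟩
  have hf : ∀ g, g ∈ I.present D (p g) f := fun g => by
    have := hpres g f (hroute _)
    rwa [hδf, Nat.sub_zero] at this
  refine ⟨⟨?_, ?_, ?_, ?_, ?_⟩, fun g => arrivalTime_le hfac (hf g)⟩
  · rintro u v t ⟨g, hg⟩
    obtain ⟨h1, rfl, -⟩ := (hD _ _ _ _).1 hg
    exact hadj u h1
  · intro u v t g hg
    obtain ⟨-, -, h2, h3⟩ := (hD _ _ _ _).1 hg
    have := hpres g u h2
    rwa [← h3, Nat.add_sub_cancel] at this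
  · intro u v v' t hv
    refine Finset.disjoint_left.2 fun g hg hg' => hv ?_
    rw [((hD _ _ _ _).1 hg).2.1, ((hD _ _ _ _).1 hg').2.1]
  · intro u v t huv
    rw [hcap _ ((SimpleGraph.mem_edgeSet _).2 huv)]
    rcases (D u v t).eq_empty_or_nonempty with he | ⟨g, hg⟩
    · rw [he]; simp
    -- Groups leaving `u` simultaneously have the same arrival time `t + δ u`, so they share a bin.
    · refine hload u (t + δ u) _ ((hD _ _ _ _).1 hg).1 fun g' hg' => ?_
      exact ⟨((hD _ _ _ _).1 hg').2.2.1, ((hD _ _ _ _).1 hg').2.2.2.symm⟩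
  · exact fun g => ⟨p g, f, by rw [hfac]; rfl, hf g⟩

/-- A group travels no faster than the lengths of the edges allow. -/
lemma Feasible.dist_le (hD : I.Feasible D) {δ : V → ℕ}
    (hδ : ∀ u v, I.graph.Adj u v → δ u ≤ δ v + I.distance s(u, v)) {g : Fin n} (t : ℕ) (v : V)
    (h : g ∈ I.present D t v) : δ (I.home g) ≤ δ v + t := by
  induction t using Nat.strong_induction_on generalizing v with
  | _ t ih =>
    cases t with
    | zero =>
      have : I.home g = v := h
      rw [this]; omega
    | succ t =>
      rcases h with ⟨h, -⟩ | h
      · have := ih t (by omega) v h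
        omega
      · obtain ⟨u, h1, h2, h3⟩ := Set.mem_iUnion.1 h
        have h4 := I.distance_pos _ ((SimpleGraph.mem_edgeSet _).2 h1)
        have h5 := ih _ (by omega) u (hD.isPresent _ _ _ h3)
        have h6 := hδ u v h1
        omega

/-- The groups that start on one side of `f` and reach `f` at the same time use the same edge. -/
theorem Feasible.sum_arrivalTime_le (hD : I.Feasible D) (hfac : I.facilities = {f}) {S : Set V}
    {u₀ : V} {C : ℕ} (hf : f ∉ S) (hS : ∀ u ∈ S, ∀ v, I.graph.Adj u v → v ∈ S ∨ v = f)
    (hu₀ : ∀ u ∈ S, I.graph.Adj u f → u = u₀) (hcap : ∀ e ∈ I.graph.edgeSet, I.capacity e = C)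
    {b : ℕ} (A : Finset (Fin n)) (hA : ∀ g ∈ A, I.home g ∈ S ∧ I.arrivalTime D g = b) :
    ∑ g ∈ A, I.size g ≤ C := by
  -- Before its arrival a group cannot have left its side, since the only way out leads through `f`.
  have hside : ∀ g ∈ A, ∀ t v, t < b → g ∈ I.present D t v → v ∈ S := by
    intro g hg t
    induction t using Nat.strong_induction_on with
    | _ t ih =>
      intro v htb h
      have hvf : v ≠ f := by
        rintro rfl
        have := arrivalTime_le hfac h
        rw [(hA g hg).2] at this
        omega
      cases t with
      | zero =>
        have : I.home g = v := h
        rw [← this]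
        exact (hA g hg).1
      | succ t =>
        rcases h with ⟨h, -⟩ | h
        · exact ih t (by omega) v (by omega) h
        · obtain ⟨u, h1, h2, h3⟩ := Set.mem_iUnion.1 h
          have h4 := I.distance_pos _ ((SimpleGraph.mem_edgeSet _).2 h1)
          have h5 := ih _ (by omega) u (by omega) (hD.isPresent _ _ _ h3)
          exact (hS u h5 v h1).resolve_right hvf
  have harr : ∀ g ∈ A, I.graph.Adj u₀ f ∧ g ∈ D u₀ f (b - I.distance s(u₀, f)) := by
    intro g hg
    have h := hD.mem_present_arrivalTime hfac g
    rw [(hA g hg).2] at h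
    cases b with
    | zero =>
      have : I.home g = f := h
      exact absurd (hA g hg).1 (by rwa [this])
    | succ b =>
      rcases h with ⟨h, -⟩ | h
      · exact absurd (hside g hg b f (by omega) h) hf
      · obtain ⟨u, h1, h2, h3⟩ := Set.mem_iUnion.1 h
        have h4 := I.distance_pos _ ((SimpleGraph.mem_edgeSet _).2 h1)
        have h5 := hside g hg _ u (by omega) (hD.isPresent _ _ _ h3)
        obtain rfl := hu₀ u h5 h1
        exact ⟨h1, h3⟩
  rcases A.eq_empty_or_nonempty with he | ⟨g, hg⟩
  · rw [he]; simp
  · have h1 := (harr g hg).1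
    rw [← hcap _ ((SimpleGraph.mem_edgeSet _).2 h1)]
    exact (Finset.sum_le_sum_of_subset fun g' hg' => (harr g' hg').2).trans
      (hD.capacity_le u₀ f _ h1)

end FlowInstance

/-! ## Writing the output -/

/-- Consecutive arrays below `B` are filled by rules that read only other arrays. -/
theorem exists_fill_below {B s lo hi : ℕ} (hBs : B < s) (hhi : hi ≤ B)
    (L : List (RamState → (ℕ → ℕ) → ℕ)) : ∀ a, lo ≤ a → a + L.length ≤ hi →
    (∀ F ∈ L, Definable B s F ∧ ∀ σ τ : RamState, (∀ b < s, b < lo ∨ hi ≤ b → σ b = τ b) →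
      ∀ v, F σ v = F τ v) →
    ∃ P g, PolyBounded g ∧ ∀ σ, ∃ σ' T, RamRun P σ σ' T ∧ T ≤ g (σ B 0) ∧
      (∀ b < s, b < a ∨ a + L.length ≤ b → σ' b = σ b) ∧
      ∀ j (hj : j < L.length), ∀ i < σ B 0, σ' (a + j) i = L[j] σ (fun _ => i) := by
  induction L with
  | nil =>
    intro a _ _ _
    exact ⟨.skip, fun _ => 1, .const 1, fun σ => ⟨σ, 1, .skip σ, le_rfl, fun _ _ _ => rfl,
      fun j hj => by simp at hj⟩⟩
  | cons F L ih =>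
    intro a hlo ha hL
    rw [List.length_cons] at ha
    obtain ⟨hF1, hF2⟩ := hL F (by simp)
    obtain ⟨P, g, hg, hP⟩ := exists_fill (B := B) (a := a) (s := s) hBs (by omega)
      (by omega) hF1 (fun σ τ i h₁ _ => hF2 σ τ (fun b hb h => h₁ b hb (by omega)) _)
    obtain ⟨Q, g', hg', hQ⟩ := ih (a + 1) (by omega) (by omega)
      (fun G hG => hL G (List.mem_cons_of_mem _ hG))
    refine ⟨.seq P Q, fun n => g n + g' n, hg.add hg', fun σ => ?_⟩
    obtain ⟨σ₁, T₁, r₁, l₁, a₁, e₁⟩ := hP σ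
    obtain ⟨σ₂, T₂, r₂, l₂, a₂, e₂⟩ := hQ σ₁
    have hBσ : σ₁ B = σ B := a₁ B (by omega) (by omega)
    rw [hBσ] at l₂ e₂
    refine ⟨σ₂, _, .seq r₁ r₂, add_le_add l₁ l₂, fun b hb h => ?_, ?_⟩
    · rw [List.length_cons] at h
      rw [a₂ b hb (by omega), a₁ b hb (by omega)]
    · intro j hj i hi
      cases j with
      | zero =>
        simp only [add_zero, List.getElem_cons_zero]
        rw [a₂ a (by omega) (by omega), e₁ i hi]
        exact hF2 _ _ (fun b hb h => a₁ b hb (by omega)) _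
      | succ j =>
        have hj' : j < L.length := by simpa using hj
        have := e₂ j hj' i hi
        rw [show a + (j + 1) = a + 1 + j by omega, this, List.getElem_cons_succ]
        exact (hL _ (List.mem_cons_of_mem _ (List.getElem_mem hj'))).2 _ _
          (fun b hb h => a₁ b hb (by omega)) _

/-! ## Paths -/

section

variable {k : ℕ}

/-- The length of the edge from `i` to `i + 1`. -/
def edgeLength (dist : Sym2 (Fin k) → ℕ) (i : ℕ) : ℕ :=
  if h : i + 1 < k then dist s(⟨i, by omega⟩, ⟨i + 1, h⟩) else 0

/-- The distance of the node `m` of the path from the node `0`. -/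
def pathPosition (dist : Sym2 (Fin k) → ℕ) (m : ℕ) : ℕ := ∑ i ∈ Finset.range m, edgeLength dist i

variable {dist : Sym2 (Fin k) → ℕ}

lemma pathPosition_of_succ {u v : Fin k} (h : (u : ℕ) + 1 = v) :
    pathPosition dist v = pathPosition dist u + dist s(u, v) := by
  have hv := v.2
  rw [← h, pathPosition, Finset.sum_range_succ, edgeLength, dif_pos (by omega)]
  have hv' : (⟨u + 1, by omega⟩ : Fin k) = v := Fin.ext h
  rw [hv']
  rfl

lemma pathPosition_mono : Monotone (pathPosition dist) :=
  fun _ _ h => Finset.sum_le_sum_of_subset (Finset.range_mono h)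

/-- The distance of two nodes. -/
def pathDist (dist : Sym2 (Fin k) → ℕ) (f u : ℕ) : ℕ :=
  (pathPosition dist f - pathPosition dist u) + (pathPosition dist u - pathPosition dist f)

/-- The next node on the way to `f`. -/
def pathNext (f u : ℕ) : ℕ := if u < f then u + 1 else u - 1

/-- The node `u` is on the way from `h` to `f`, and is not `f`. -/
def OnPath (f h u : ℕ) : Prop := h ≤ u ∧ u < f ∨ f < u ∧ u ≤ h

end

/-- Two packings, one for each side of the path, give a flow. -/
theorem exists_path_flow {k n C : ℕ} {dist : Sym2 (Fin k) → ℕ} {f : Fin k}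
    {I : FlowInstance (Fin k) n} (hG : I.graph = SimpleGraph.pathGraph k)
    (hfac : I.facilities = {f}) (hcap : ∀ e ∈ I.graph.edgeSet, I.capacity e = C)
    (hdist : ∀ e ∈ I.graph.edgeSet, I.distance e = dist e) {D : GroupFlow (Fin k) n}
    {p : Fin n → ℕ} (hp : ∀ g, pathDist dist f (I.home g) ≤ p g)
    (hleft : ∀ b (S : Finset (Fin n)), (∀ g ∈ S, I.home g < f ∧ p g = b) → ∑ g ∈ S, I.size g ≤ C)
    (hright : ∀ b (S : Finset (Fin n)), (∀ g ∈ S, f < I.home g ∧ p g = b) → ∑ g ∈ S, I.size g ≤ C)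
    (hD : ∀ u v t g, g ∈ D u v t ↔ OnPath f (I.home g) u ∧ (v : ℕ) = pathNext f u ∧
      t + pathDist dist f u = p g) :
    I.Feasible D ∧ ∀ g, I.arrivalTime D g ≤ p g := by
  have hlt : ∀ u : Fin k, pathNext f u < k := fun u => by
    have := f.2; have := u.2; unfold pathNext; split_ifs <;> omega
  have hmono := pathPosition_mono (dist := dist)
  refine FlowInstance.feasible_of_schedule (f := f) hfac (next := fun u => ⟨pathNext f u, hlt u⟩)
    (δ := fun u => pathDist dist f u)
    (route := fun h u => (h : ℕ) ≤ u ∧ (u : ℕ) ≤ f ∨ (f : ℕ) ≤ u ∧ (u : ℕ) ≤ h) (p := p) (C := C)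
    (fun u hu => ?_) (fun u hu => ?_) ?_ (fun h u hr => ?_) (fun h => ?_) (fun h u hr => ?_) hp hcap
    (fun u b S hu hS => ?_) (fun u v t g => ?_)
  · have hu' : (u : ℕ) ≠ f := fun h => hu (Fin.ext h)
    rw [hG, SimpleGraph.pathGraph_adj]
    simp only [pathNext]
    split_ifs <;> omega
  · have hu' : (u : ℕ) ≠ f := fun h => hu (Fin.ext h)
    show pathDist dist f u = I.distance s(u, ⟨pathNext f u, hlt u⟩) +
      pathDist dist f (⟨pathNext f u, hlt u⟩ : Fin k)
    have hw : ((⟨pathNext f u, hlt u⟩ : Fin k) : ℕ) = pathNext f u := rfl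
    generalize (⟨pathNext f u, hlt u⟩ : Fin k) = w at hw ⊢
    rw [pathNext] at hw
    have hadj : I.graph.Adj u w := by
      rw [hG, SimpleGraph.pathGraph_adj]
      split_ifs at hw <;> omega
    rw [hdist _ ((SimpleGraph.mem_edgeSet _).2 hadj)]
    rcases lt_or_gt_of_ne hu' with h | h
    · rw [if_pos h] at hw
      have h2 := pathPosition_of_succ (dist := dist) hw.symm
      have h3 : pathPosition dist w ≤ pathPosition dist f := hmono (by omega)
      simp only [pathDist]
      omega
    · rw [if_neg (by omega)] at hw
      have h2 := pathPosition_of_succ (dist := dist) (u := w) (v := u) (by omega)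
      have h3 : pathPosition dist f ≤ pathPosition dist w := hmono (by omega)
      rw [Sym2.eq_swap]
      simp only [pathDist]
      omega
  · simp [pathDist]
  · by_cases huh : u = h
    · exact Or.inl huh
    · have huh' : (u : ℕ) ≠ h := fun h' => huh (Fin.ext h')
      have hu := u.2
      have hf := f.2
      rcases hr with hr | hr
      · refine Or.inr ⟨⟨u - 1, by omega⟩, fun he => ?_, Or.inl ⟨?_, ?_⟩, Fin.ext ?_⟩
        · have := congrArg Fin.val he
          simp only at this
          omega
        · simp only; omega
        · simp only; omega
        · simp only [pathNext]; split_ifs <;> omega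
      · have hh := h.2
        refine Or.inr ⟨⟨u + 1, by omega⟩, fun he => ?_, Or.inr ⟨?_, ?_⟩, Fin.ext ?_⟩
        · have := congrArg Fin.val he
          simp only at this
          omega
        · simp only; omega
        · simp only; omega
        · simp only [pathNext]; split_ifs <;> omega
  · omega
  · simp only [pathDist]
    rcases hr with ⟨h1, h2⟩ | ⟨h1, h2⟩
    · have := hmono h1; have := hmono h2
      omega
    · have := hmono h1; have := hmono h2
      omega
  · have hu' : (u : ℕ) ≠ f := fun h => hu (Fin.ext h)
    rcases lt_or_gt_of_ne hu' with h | h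
    · exact hleft b S fun g hg => ⟨Fin.lt_def.2 (by have := (hS g hg).1; omega), (hS g hg).2⟩
    · exact hright b S fun g hg => ⟨Fin.lt_def.2 (by have := (hS g hg).1; omega), (hS g hg).2⟩
  · rw [hD, OnPath, Fin.ext_iff, Ne, Fin.ext_iff]
    constructor
    · rintro ⟨h1, h2, h3⟩
      exact ⟨by omega, h2, by omega, h3⟩
    · rintro ⟨h1, h2, h3, h4⟩
      exact ⟨by omega, h2, h4⟩

/-- A flow gives two packings, one for each side of the path. -/
theorem FlowInstance.Feasible.path_packing {k n C : ℕ} {dist : Sym2 (Fin k) → ℕ} {f : Fin k}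
    {I : FlowInstance (Fin k) n} (hG : I.graph = SimpleGraph.pathGraph k)
    (hfac : I.facilities = {f}) (hcap : ∀ e ∈ I.graph.edgeSet, I.capacity e = C)
    (hdist : ∀ e ∈ I.graph.edgeSet, I.distance e = dist e) {D : GroupFlow (Fin k) n}
    (hD : I.Feasible D) : (∀ g, pathDist dist f (I.home g) ≤ I.arrivalTime D g) ∧
      (∀ b (S : Finset (Fin n)), (∀ g ∈ S, I.home g < f ∧ I.arrivalTime D g = b) →
        ∑ g ∈ S, I.size g ≤ C) ∧
      ∀ b (S : Finset (Fin n)), (∀ g ∈ S, f < I.home g ∧ I.arrivalTime D g = b) →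
        ∑ g ∈ S, I.size g ≤ C := by
  have hadj : ∀ u v, I.graph.Adj u v ↔ (u : ℕ) + 1 = v ∨ (v : ℕ) + 1 = u := fun u v => by
    rw [hG, SimpleGraph.pathGraph_adj]
  have hf := f.2
  refine ⟨fun g => ?_, fun b S hS => ?_, fun b S hS => ?_⟩
  · have := hD.dist_le (δ := fun u => pathDist dist f u) (fun u v huv => ?_) (I.arrivalTime D g) f
      (hD.mem_present_arrivalTime hfac g)
    · have h0 : pathDist dist f f = 0 := by simp [pathDist]
      omega
    · rw [hdist _ ((SimpleGraph.mem_edgeSet _).2 huv)]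
      rcases (hadj u v).1 huv with h | h
      · have := pathPosition_of_succ (dist := dist) h
        simp only [pathDist]
        omega
      · have := pathPosition_of_succ (dist := dist) h
        rw [Sym2.eq_swap]
        simp only [pathDist]
        omega
  -- For `f = 0` the truncated `f - 1` is harmless, as this side is empty.
  · refine hD.sum_arrivalTime_le hfac (S := {u | u < f}) (u₀ := ⟨f - 1, by omega⟩)
      (by simp) (fun u hu v huv => ?_) (fun u hu huv => ?_) hcap S hS
    · have hu' : (u : ℕ) < f := hu
      have := (hadj u v).1 huv
      rw [Set.mem_ofPred_eq, Fin.lt_def, Fin.ext_iff]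
      omega
    · have hu' : (u : ℕ) < f := hu
      have := (hadj u f).1 huv
      rw [Fin.ext_iff]
      simp only
      omega
  -- The node `f + 1` is known to exist only if some group starts beyond `f`.
  · rcases S.eq_empty_or_nonempty with he | ⟨g₀, hg₀⟩
    · rw [he]; simp
    · have h0 : (f : ℕ) < I.home g₀ := (hS g₀ hg₀).1
      have h1 := (I.home g₀).2
      refine hD.sum_arrivalTime_le hfac (S := {u | f < u}) (u₀ := ⟨f + 1, by omega⟩)
        (by simp) (fun u hu v huv => ?_) (fun u hu huv => ?_) hcap S hS
      · have hu' : (f : ℕ) < u := hu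
        have := (hadj u v).1 huv
        rw [Set.mem_ofPred_eq, Fin.lt_def, Fin.ext_iff]
        omega
      · have hu' : (f : ℕ) < u := hu
        have := (hadj u f).1 huv
        rw [Fin.ext_iff]
        simp only
        omega

/-! ### The list of dispatches -/

section

variable {k : ℕ} (dist : Sym2 (Fin k) → ℕ) (f B o o' : ℕ)

/-- The dispatches are numbered so that dispatch `l` is that of item `l / k` at the node `l % k`. The
rules give, in this order, their number, the item (or the number of items, if the node is not on its
way), the node, the next node, and the time. -/
noncomputable def dispatchRules : List (RamState → (ℕ → ℕ) → ℕ) :=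
  open Classical in
  [fun σ _ => k * σ 0 0,
    fun σ v => if OnPath f (σ 3 (boundedDiv (σ B 0) (v 0) k)) (boundedMod (σ B 0) (v 0) k) then
      boundedDiv (σ B 0) (v 0) k else σ 0 0,
    fun σ v => boundedMod (σ B 0) (v 0) k,
    fun σ v => pathNext f (boundedMod (σ B 0) (v 0) k),
    fun σ v => (if boundedMod (σ B 0) (v 0) k < f then σ o (boundedDiv (σ B 0) (v 0) k)
      else σ o' (boundedDiv (σ B 0) (v 0) k)) -
        if boundedMod (σ B 0) (v 0) k < k then pathDist dist f (boundedMod (σ B 0) (v 0) k) else 0]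

variable {f B o o'}

lemma definable_dispatchRules (ho : 9 ≤ o) (ho' : 9 ≤ o') (hoB : o < B) (hoB' : o' < B) :
    ∀ F ∈ dispatchRules dist f B o o', Definable B (B + 1) F ∧
      ∀ σ τ : RamState, (∀ b < B + 1, b < 4 ∨ 9 ≤ b → σ b = τ b) → ∀ v, F σ v = F τ v := by
  classical
  have hdiv : Definable B (B + 1) (fun σ v => boundedDiv (σ B 0) (v 0) k) :=
    (Definable.var 0).boundedDiv (.const k)
  have hmod : Definable B (B + 1) (fun σ v => boundedMod (σ B 0) (v 0) k) :=
    (Definable.var 0).boundedMod (.const k)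
  have h0 : Definable B (B + 1) (fun σ _ => σ 0 0) := .read (by omega) (.const 0)
  have h3 : Definable B (B + 1) (fun σ v => σ 3 (boundedDiv (σ B 0) (v 0) k)) :=
    .read (by omega) hdiv
  simp only [dispatchRules, List.mem_cons, List.not_mem_nil, or_false, forall_eq_or_imp, forall_eq]
  refine ⟨⟨.const_mul k h0, ?_⟩, ⟨.ite (.or (.and (.le h3 hmod) (.lt hmod (.const f)))
      (.and (.lt (.const f) hmod) (.le hmod h3))) hdiv h0, ?_⟩, ⟨hmod, ?_⟩,
    ⟨.ite (.lt hmod (.const f)) (hmod.add (.const 1)) (hmod.sub (.const 1)), ?_⟩,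
    ⟨.sub (.ite (.lt hmod (.const f)) (.read (by omega) hdiv) (.read (by omega) hdiv))
      (.table (pathDist dist f) k hmod), ?_⟩⟩ <;>
  · intro σ τ h v
    simp only [h 0 (by omega) (by omega), h 3 (by omega) (by omega), h B (by omega) (by omega),
      h o (by omega) (by omega), h o' (by omega) (by omega)]

variable {dist}

/-- The flow written by the rules. -/
lemma mem_ramFlow_of_dispatchRules {n : ℕ} {σ σ' : RamState} {f : ℕ} (hn : σ 0 0 = n)
    (hM : k * n < σ B 0)
    (h : ∀ j (hj : j < (dispatchRules dist f B o o').length), ∀ i < σ B 0,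
      σ' (4 + j) i = (dispatchRules dist f B o o')[j] σ (fun _ => i))
    (u v : Fin k) (t : ℕ) (g : Fin n) :
    g ∈ ramFlow k n σ' u v t ↔ OnPath f (σ 3 g) u ∧ (v : ℕ) = pathNext f u ∧
      t = (if (u : ℕ) < f then σ o g else σ o' g) - pathDist dist f u := by
  classical
  have hk : 0 < k := u.pos
  have e0 : σ' 4 0 = k * n := by
    rw [← hn]
    exact h 0 (by simp [dispatchRules]) 0 (by omega)
  have e : ∀ l < k * n, (σ' 5 l = if OnPath f (σ 3 (l / k)) (l % k) then l / k else n) ∧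
      σ' 6 l = l % k ∧ σ' 7 l = pathNext f (l % k) ∧
      σ' 8 l = (if l % k < f then σ o (l / k) else σ o' (l / k)) - pathDist dist f (l % k) := by
    intro l hl
    have hl' : l < σ B 0 := by omega
    have h1 : σ' 5 l = if OnPath f (σ 3 (boundedDiv (σ B 0) l k)) (boundedMod (σ B 0) l k) then
      boundedDiv (σ B 0) l k else σ 0 0 := h 1 (by simp [dispatchRules]) l hl'
    have h2 : σ' 6 l = boundedMod (σ B 0) l k := h 2 (by simp [dispatchRules]) l hl'
    have h3 : σ' 7 l = pathNext f (boundedMod (σ B 0) l k) := h 3 (by simp [dispatchRules]) l hl'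
    have h4 : σ' 8 l = (if boundedMod (σ B 0) l k < f then σ o (boundedDiv (σ B 0) l k)
      else σ o' (boundedDiv (σ B 0) l k)) -
        if boundedMod (σ B 0) l k < k then pathDist dist f (boundedMod (σ B 0) l k) else 0 :=
      h 4 (by simp [dispatchRules]) l hl'
    rw [boundedDiv_eq hl' hk, boundedMod_eq hl' hk, hn] at h1
    rw [boundedMod_eq hl' hk] at h2 h3
    rw [boundedDiv_eq hl' hk, boundedMod_eq hl' hk, if_pos (Nat.mod_lt _ hk)] at h4
    exact ⟨h1, h2, h3, h4⟩
  simp only [ramFlow, Finset.mem_filter, Finset.mem_univ, true_and, e0]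
  constructor
  · rintro ⟨l, hl, h1, h2, h3, h4⟩
    obtain ⟨e1, e2, e3, e4⟩ := e l hl
    have hg := g.2
    rw [h1] at e1
    rw [h2] at e2
    rw [h3, ← e2] at e3
    rw [h4, ← e2] at e4
    rw [← e2] at e1
    split_ifs at e1 with hr
    · rw [← e1] at hr e4
      exact ⟨hr, e3, e4⟩
    -- Off the route the rule wrote `n`, which is the number of no group.
    · omega
  · rintro ⟨h1, h2, h3⟩
    have hu := u.2
    have hdiv : (k * g + u) / k = g := by
      rw [Nat.mul_add_div hk, Nat.div_eq_of_lt hu, add_zero]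
    have hmod : (k * g + u) % k = u := by rw [Nat.mul_add_mod, Nat.mod_eq_of_lt hu]
    have hl : k * g + u < k * n := by
      have : k * (g + 1) ≤ k * n := Nat.mul_le_mul_left k g.2
      rw [Nat.mul_add, mul_one] at this
      omega
    obtain ⟨e1, e2, e3, e4⟩ := e _ hl
    rw [hdiv, hmod, if_pos h1] at e1
    rw [hmod] at e2 e3
    rw [hdiv, hmod] at e4
    exact ⟨_, hl, e1, e2, e3.trans h2.symm, e4.trans h3.symm⟩

end

lemma Finset.sum_eq_sum_fin {n : ℕ} {A : Finset ℕ} {P : Fin n → Prop} [DecidablePred P]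
    (hlt : ∀ j ∈ A, j < n) (hA : ∀ g : Fin n, (g : ℕ) ∈ A ↔ P g) (F : ℕ → ℕ) :
    ∑ j ∈ A, F j = ∑ g : Fin n, if P g then F g else 0 := by
  have h1 : A = (Finset.range n).filter (· ∈ A) := by
    ext j
    simp only [Finset.mem_filter, Finset.mem_range]
    exact ⟨fun h => ⟨hlt j h, h⟩, fun h => h.2⟩
  rw [h1, Finset.sum_filter, Finset.sum_range]
  exact Finset.sum_congr rfl fun g _ => if_congr (hA g) rfl rfl

/-- The ready times `τ₁` and `τ₂` vanish off the left and the right side respectively, which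
deactivates the other groups; groups at the facility get arrival time 0. The base 9 protects the
input and output arrays, and the second packing program works above the result `o` of the first. -/
theorem exists_path_flow_program (k : ℕ) (dist : Sym2 (Fin k) → ℕ) (f : Fin k) {δ : ℝ}
    (hδ : 0 < δ) :
    ∃ (P : RamProgram) (a b : ℕ), ∀ (n C : ℕ) (I : FlowInstance (Fin k) n),
      I.graph = SimpleGraph.pathGraph k → I.facilities = {f} →
      (∀ e ∈ I.graph.edgeSet, I.capacity e = C) →
      (∀ e ∈ I.graph.edgeSet, I.distance e = dist e) →
      (∀ g, I.weight g = 1) → (∀ g, I.home g ≠ f → I.size g ≤ C) →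
      ∃ (σ : RamState) (T : ℕ),
        RamRun P (ramInput n C I.size (fun g => (I.home g : ℕ))) σ T ∧
        T ≤ a * (n + 1) ^ b ∧ I.Feasible (ramFlow k n σ) ∧
        (I.cost (ramFlow k n σ) : ℝ) ≤ (1 + δ) * (I.opt : ℝ) := by
  set τ₁ := extendZero (fun u : Fin k => pathPosition dist f - pathPosition dist u) with hτ₁
  set τ₂ := extendZero (fun u : Fin k => pathPosition dist u - pathPosition dist f) with hτ₂
  obtain ⟨P₁, g₁, o, hg₁, ho, hP₁⟩ := exists_packing_program k τ₁
    (fun c hc => by simp [τ₁, extendZero, not_lt.2 hc]) hδ 9 (by norm_num)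
  obtain ⟨P₂, g₂, o', hg₂, ho', hP₂⟩ := exists_packing_program k τ₂
    (fun c hc => by simp [τ₂, extendZero, not_lt.2 hc]) hδ (o + 1) (by omega)
  -- One squaring suffices: `(n + k + 1) ^ 2` exceeds the number `k * n` of dispatches.
  obtain ⟨P₃, g₃, hg₃, hP₃⟩ := exists_large_number (o' + 1) k 1
  obtain ⟨P₄, g₄, hg₄, hP₄⟩ := exists_fill_below (B := o' + 1 + 1) (s := o' + 1 + 1 + 1) (lo := 4)
    (hi := 9) (by omega) (by omega) (dispatchRules dist f (o' + 1 + 1) o o') 4 le_rfl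
    (by simp [dispatchRules]) (definable_dispatchRules dist ho (by omega) (by omega) (by omega))
  obtain ⟨a, b, hab⟩ := hg₁.add (hg₂.add (hg₃.add
    (hg₄.comp ((PolyBounded.id.add (.const (k + 1))).pow 2))))
  refine ⟨.seq P₁ (.seq P₂ (.seq P₃ P₄)), a, b,
    fun n C I hG hfac hcap hdist hw hsize => ?_⟩
  set σ := ramInput n C I.size (fun g => (I.home g : ℕ)) with hσ
  obtain ⟨σ₁, T₁, r₁, l₁, a₁, e₁⟩ := hP₁ σ
  obtain ⟨σ₂, T₂, r₂, l₂, a₂, e₂⟩ := hP₂ σ₁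
  obtain ⟨σ₃, T₃, r₃, l₃, a₃, e₃⟩ := hP₃ σ₂
  obtain ⟨σ₄, T₄, r₄, l₄, a₄, e₄⟩ := hP₄ σ₃
  have hn : σ 0 0 = n := rfl
  have hC : σ 1 0 = C := rfl
  have hs : ∀ g : Fin n, σ 2 g = I.size g := fun g => ramInput_size g
  have hl : ∀ g : Fin n, σ 3 g = I.home g := fun g => ramInput_label g
  rw [a₁ 0 (by omega)] at e₂ l₂
  rw [a₂ 0 (by omega), a₁ 0 (by omega)] at l₃ e₃
  rw [a₁ 1 (by omega), a₁ 2 (by omega), a₁ 3 (by omega)] at e₂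
  rw [e₃] at l₄
  rw [hn] at l₁ l₂ l₃ l₄ e₁ e₂
  rw [hC] at e₁ e₂
  have hlow : ∀ b < 9, σ₃ b = σ b := fun b hb => by
    rw [a₃ b (by omega), a₂ b (by omega), a₁ b (by omega)]
  have hoσ : σ₃ o = σ₁ o := by rw [a₃ o (by omega), a₂ o (by omega)]
  have hoσ' : σ₃ o' = σ₂ o' := a₃ o' (by omega)
  have hstrict : ∀ u v : Fin k, u < v → pathPosition dist u < pathPosition dist v := by
    intro u v huv
    rw [Fin.lt_def] at huv
    have hv := v.2
    have h1 : (u : ℕ) + 1 = (⟨u + 1, by omega⟩ : Fin k) := rfl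
    have h2 := pathPosition_of_succ (dist := dist) h1
    have h3 : s(u, (⟨u + 1, by omega⟩ : Fin k)) ∈ I.graph.edgeSet := by
      rw [SimpleGraph.mem_edgeSet, hG, SimpleGraph.pathGraph_adj]
      exact Or.inl h1
    have h4 := I.distance_pos _ h3
    rw [hdist _ h3] at h4
    have h5 : pathPosition dist ((⟨u + 1, by omega⟩ : Fin k) : ℕ) ≤ pathPosition dist v :=
      pathPosition_mono (by rw [← h1]; omega)
    omega
  have ht₁ : ∀ g, τ₁ (σ 3 (g : Fin n)) = pathPosition dist f - pathPosition dist (I.home g) :=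
    fun g => by rw [hl, hτ₁, extendZero_apply]
  have ht₂ : ∀ g, τ₂ (σ 3 (g : Fin n)) = pathPosition dist (I.home g) - pathPosition dist f :=
    fun g => by rw [hl, hτ₂, extendZero_apply]
  set A₁ := (Finset.range n).filter fun j => τ₁ (σ 3 j) ≠ 0 with hA₁
  set A₂ := (Finset.range n).filter fun j => τ₂ (σ 3 j) ≠ 0 with hA₂
  have hm₁ : ∀ g : Fin n, (g : ℕ) ∈ A₁ ↔ I.home g < f := fun g => by
    rw [hA₁, Finset.mem_filter, Finset.mem_range, ht₁]
    constructor
    · rintro ⟨-, h⟩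
      by_contra hcon
      have := pathPosition_mono (dist := dist) (Fin.le_def.1 (not_lt.1 hcon))
      omega
    · intro h
      have := hstrict _ _ h
      exact ⟨g.2, by omega⟩
  have hm₂ : ∀ g : Fin n, (g : ℕ) ∈ A₂ ↔ f < I.home g := fun g => by
    rw [hA₂, Finset.mem_filter, Finset.mem_range, ht₂]
    constructor
    · rintro ⟨-, h⟩
      by_contra hcon
      have := pathPosition_mono (dist := dist) (Fin.le_def.1 (not_lt.1 hcon))
      omega
    · intro h
      have := hstrict _ _ h
      exact ⟨g.2, by omega⟩
  have hlt₁ : ∀ j ∈ A₁, j < n := fun j hj => Finset.mem_range.1 (Finset.mem_filter.1 hj).1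
  have hlt₂ : ∀ j ∈ A₂, j < n := fun j hj => Finset.mem_range.1 (Finset.mem_filter.1 hj).1
  obtain ⟨p1, p2, p3⟩ := e₁ A₁ (fun j => by rw [hA₁, Finset.mem_filter, Finset.mem_range])
    (fun j hj => by
      have := hsize ⟨j, hlt₁ j hj⟩ ((hm₁ ⟨j, hlt₁ j hj⟩).1 hj).ne
      rwa [← hs] at this)
  obtain ⟨q1, q2, q3⟩ := e₂ A₂ (fun j => by rw [hA₂, Finset.mem_filter, Finset.mem_range])
    (fun j hj => by
      have := hsize ⟨j, hlt₂ j hj⟩ ((hm₂ ⟨j, hlt₂ j hj⟩).1 hj).ne'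
      rwa [← hs] at this)
  set p : Fin n → ℕ := fun g => (if I.home g < f then σ₁ o g else 0) +
    if f < I.home g then σ₂ o' g else 0 with hp
  have hpl : ∀ g, I.home g < f → p g = σ₁ o g := fun g h => by
    simp only [hp, if_pos h, if_neg (lt_asymm h), add_zero]
  have hpr : ∀ g, f < I.home g → p g = σ₂ o' g := fun g h => by
    simp only [hp, if_pos h, if_neg (lt_asymm h), zero_add]
  have hpd : ∀ g, pathDist dist f (I.home g) ≤ p g := by
    intro g
    rcases lt_trichotomy (I.home g) f with h | h | h
    · have h1 := p1 g ((hm₁ g).2 h)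
      have := hstrict _ _ h
      rw [ht₁] at h1
      rw [hpl g h, pathDist]
      omega
    · rw [h]; simp [pathDist]
    · have h1 := q1 g ((hm₂ g).2 h)
      have := hstrict _ _ h
      rw [ht₂] at h1
      rw [hpr g h, pathDist]
      omega
  have hsum : ∀ (A : Finset ℕ) (q : ℕ → ℕ) (b : ℕ),
      ∑ j ∈ A with q j = b, σ 2 j ≤ C → ∀ S : Finset (Fin n),
      (∀ g ∈ S, (g : ℕ) ∈ A ∧ q g = b) → ∑ g ∈ S, I.size g ≤ C := by
    intro A q b h S hS
    refine le_trans ?_ h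
    rw [← Finset.sum_congr rfl fun g _ => hs g,
      show ∑ g ∈ S, σ 2 g = ∑ j ∈ S.map Fin.valEmbedding, σ 2 j by
        rw [Finset.sum_map]; rfl]
    refine Finset.sum_le_sum_of_subset fun j hj => ?_
    obtain ⟨g, hg, rfl⟩ := Finset.mem_map.1 hj
    exact Finset.mem_filter.2 (hS g hg)
  obtain ⟨hfeas, harr⟩ := exists_path_flow (D := ramFlow k n σ₄) hG hfac hcap hdist hpd
    (fun b S hS => hsum A₁ (σ₁ o) b (p2 b) S fun g hg =>
      ⟨(hm₁ g).2 (hS g hg).1, (hpl g (hS g hg).1).symm.trans (hS g hg).2⟩)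
    (fun b S hS => hsum A₂ (σ₂ o') b (q2 b) S fun g hg =>
      ⟨(hm₂ g).2 (hS g hg).1, (hpr g (hS g hg).1).symm.trans (hS g hg).2⟩)
    (fun u v t g => by
      rw [mem_ramFlow_of_dispatchRules (σ := σ₃) (by rw [hlow 0 (by omega), hn])
        (by rw [e₃, hn, pow_one, sq]; exact Nat.mul_lt_mul'' (by omega) (by omega)) e₄, hlow 3 (by omega), hoσ, hoσ', hl]
      refine and_congr_right fun hr => and_congr_right fun _ => ?_
      have h1 : (if (u : ℕ) < f then σ₁ o g else σ₂ o' g) = p g := by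
        rcases hr with hr | hr
        · rw [if_pos hr.2, hpl g (Fin.lt_def.2 (by omega))]
        · rw [if_neg (by omega), hpr g (Fin.lt_def.2 (by omega))]
      have h2 : pathDist dist f u ≤ pathDist dist f (I.home g) := by
        rcases hr with ⟨h, h'⟩ | ⟨h, h'⟩
        · have := pathPosition_mono (dist := dist) h
          have := pathPosition_mono (dist := dist) h'.le
          simp only [pathDist]
          omega
        · have := pathPosition_mono (dist := dist) h.le
          have := pathPosition_mono (dist := dist) h'
          simp only [pathDist]
          omega
      have h3 := hpd g
      rw [h1]
      omega)
  refine ⟨σ₄, _, .seq r₁ (.seq r₂ (.seq r₃ r₄)), ?_, hfeas, ?_⟩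
  · exact (add_le_add l₁ (add_le_add l₂ (add_le_add l₃ l₄))).trans (hab n)
  -- The arrival times of an optimal flow are a competitor in both packing problems at once.
  obtain ⟨D, hD, hcost⟩ := FlowInstance.exists_feasible_cost_eq_opt hfeas
  obtain ⟨d1, d2, d3⟩ := hD.path_packing hG hfac hcap hdist
  have hq : ∀ g : Fin n, extendZero (I.arrivalTime D) g = I.arrivalTime D g := extendZero_apply _
  have hload : ∀ (A : Finset ℕ) (b : ℕ), (∀ j ∈ A, j < n) → (∀ S : Finset (Fin n),
      (∀ g ∈ S, (g : ℕ) ∈ A ∧ I.arrivalTime D g = b) → ∑ g ∈ S, I.size g ≤ C) →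
      ∑ j ∈ A with extendZero (I.arrivalTime D) j = b, σ 2 j ≤ C := by
    intro A b hA h
    rw [Finset.sum_eq_sum_fin (n := n) (P := fun g => (g : ℕ) ∈ A ∧ I.arrivalTime D g = b)
      (fun j hj => hA j (Finset.mem_filter.1 hj).1) (fun g => by rw [Finset.mem_filter, hq]),
      ← Finset.sum_filter, Finset.sum_congr rfl fun g _ => hs g]
    exact h _ fun g hg => (Finset.mem_filter.1 hg).2
  have k1 := p3 (extendZero (I.arrivalTime D))
    (fun j hj => by
      have h := ((hm₁ ⟨j, hlt₁ j hj⟩).1 hj)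
      have h1 := d1 ⟨j, hlt₁ j hj⟩
      have h2 := ht₁ ⟨j, hlt₁ j hj⟩
      rw [← hq] at h1
      simp only [pathDist] at h1 h2
      omega)
    (fun b => hload A₁ b hlt₁ fun S hS => d2 b S fun g hg => ⟨(hm₁ g).1 (hS g hg).1, (hS g hg).2⟩)
  have k2 := q3 (extendZero (I.arrivalTime D))
    (fun j hj => by
      have h := ((hm₂ ⟨j, hlt₂ j hj⟩).1 hj)
      have h1 := d1 ⟨j, hlt₂ j hj⟩
      have h2 := ht₂ ⟨j, hlt₂ j hj⟩
      rw [← hq] at h1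
      simp only [pathDist] at h1 h2
      omega)
    (fun b => hload A₂ b hlt₂ fun S hS => d3 b S fun g hg => ⟨(hm₂ g).1 (hS g hg).1, (hS g hg).2⟩)
  rw [Finset.sum_eq_sum_fin hlt₁ hm₁, Finset.sum_eq_sum_fin hlt₁ hm₁] at k1
  rw [Finset.sum_eq_sum_fin hlt₂ hm₂, Finset.sum_eq_sum_fin hlt₂ hm₂] at k2
  simp only [hq] at k1 k2
  have c1 : I.cost (ramFlow k n σ₄) ≤ (∑ g, if I.home g < f then σ₁ o g else 0) +
      ∑ g, if f < I.home g then σ₂ o' g else 0 := by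
    rw [FlowInstance.cost, ← Finset.sum_add_distrib]
    refine Finset.sum_le_sum fun g _ => ?_
    rw [hw, one_mul]
    exact harr g
  have c2 : (∑ g, if I.home g < f then I.arrivalTime D g else 0) +
      (∑ g, if f < I.home g then I.arrivalTime D g else 0) ≤ I.cost D := by
    rw [FlowInstance.cost, ← Finset.sum_add_distrib]
    refine Finset.sum_le_sum fun g _ => ?_
    rw [hw, one_mul]
    rcases lt_trichotomy (I.home g) f with h | h | h
    · rw [if_pos h, if_neg (lt_asymm h), add_zero]
    · simp [h]
    · rw [if_pos h, if_neg (lt_asymm h), zero_add]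
  rw [← hcost]
  have c1' := (Nat.cast_le (α := ℝ)).2 c1
  have c2' := (Nat.cast_le (α := ℝ)).2 c2
  rw [Nat.cast_add] at c1' c2'
  have := mul_le_mul_of_nonneg_left c2' (by linarith : (0 : ℝ) ≤ 1 + δ)
  linarith

theorem mainTheorem3 :
    -- minsum bin packing with ready times
    (∀ (k : ℕ) (hk : 0 < k) (τ : Fin k → ℕ), StrictMono τ → (∀ i, 1 ≤ τ i) →
      ∀ ε : ℝ, 0 < ε → ε ≤ 1 / 4 → (∃ q : ℕ, 1 / ε = (q : ℝ)) →
      ∃ (P : RamProgram) (a b : ℕ), ∀ (n : ℕ) (I : PackingInstance k n),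
        ∃ (σ : RamState) (T : ℕ), RamRun P I.input σ T ∧ T ≤ a * (n + 1) ^ b ∧
          I.Feasible τ (ramPacking n σ) ∧
          (PackingInstance.cost (ramPacking n σ) : ℝ) ≤
            (1 + constD k (τ ⟨k - 1, Nat.sub_lt hk Nat.one_pos⟩) * ε) * (I.opt τ : ℝ)) ∧
    -- unit-weight flow to a single facility on a fixed path with uniform capacities
    (∀ (k : ℕ) (dist : Sym2 (Fin k) → ℕ) (f : Fin k) (ε : ℝ), 0 < ε →
      ∃ (P : RamProgram) (a b : ℕ), ∀ (n C : ℕ) (I : FlowInstance (Fin k) n),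
        I.graph = SimpleGraph.pathGraph k → I.facilities = {f} →
        (∀ e ∈ I.graph.edgeSet, I.capacity e = C) →
        (∀ e ∈ I.graph.edgeSet, I.distance e = dist e) →
        (∀ g, I.weight g = 1) → (∀ g, I.home g ≠ f → I.size g ≤ C) →
        ∃ (σ : RamState) (T : ℕ),
          RamRun P (ramInput n C I.size (fun g => (I.home g : ℕ))) σ T ∧
          T ≤ a * (n + 1) ^ b ∧ I.Feasible (ramFlow k n σ) ∧
          (I.cost (ramFlow k n σ) : ℝ) ≤ (1 + ε) * (I.opt : ℝ)) := by
  refine ⟨fun k hk τ _ hτ ε hε _ _ => ?_, fun k dist f ε hε => exists_path_flow_program k dist f hε⟩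
  -- The scheme is used with `δ = d * ε`.
  exact exists_bin_packing_program k τ hτ (mul_pos (constD_pos k _) hε)
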